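/- Let $m\in\mathbb C$ with $\operatorname{Re} m>-1$, and work in the Hilbert space $L^2[0,\infty[$. For $\alpha\in\mathbb C$ let $$L_\alpha=-\partial_x^2+\Big(-\frac14+\alpha\Big)\frac1{x^2}.$$ Let $L_\alpha^{\min}$ be the closure of $L_\alpha$ on $C_c^\infty(]0,\infty[)$, and let $L_\alpha^{\max}$ be $L_\alpha$ (in the sense of distributions on $]0,\infty[$) on the domain of all $f\in L^2[0,\infty[$ with $L_\alpha f\in L^2[0,\infty[$. Let $H_m$ be the restriction of $L_{m^2}^{\max}$ to $$\operatorname{Dom}L_{m^2}^{\min}+\mathbb C\,x^{\frac12+m}\xi,$$ where $\xi$ is any smooth compactly supported cutoff equal to $1$ around $0$. Let $X^2$ be the operator of multiplication by $x^2$, with domain all $f\in L^2[0,\infty[$ such that $x^2f\in L^2[0,\infty[$. Let $$A=\frac1{2\mathrm i}(x\partial_x+\partial_x x),$$ with derivatives in the sense of distributions on $]0,\infty[$ and with domain all $f\in L^2[0,\infty[$ such that $Af\in L^2[0,\infty[$. Let $$J_m(z)=\sum_{j=0}^\infty\frac{(-1)^j}{j!\,\Gamma(m+j+1)}\Big(\frac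 z2\Big)^{2j+m},\qquad z>0,$$ be the Bessel function. **Theorem.** The operator $A$ is self-adjoint and is the generator of the dilations $(U_\tau f)(x)=e^{\tau/2}f(e^\tau x)$, $\tau\in\mathbb R$: for $f,g\in L^2[0,\infty[$ one has $f\in\operatorname{Dom}A$ and $Af=g$ if and only if $\tau\mapsto U_\tau f\in L^2[0,\infty[$ is differentiable at $\tau=0$ with derivative $\mathrm i g$. The Hankel transformation $$(\mathcal F_mf)(k)=\int_0^\infty J_m(kx)\sqrt{kx}\,f(x)\,dx$$ is a well-defined bounded invertible operator on $L^2[0,\infty[$; here the integral is the $L^2$-limit, as $R\to\infty$, of the absolutely convergent integrals $\int_0^R$. It is an involution, $\mathcal F_m^2=1$. It diagonalizes $H_m$: $$\mathcal F_mH_m\mathcal F_m^{-1}=X^2.$$ It satisfies $$\mathcal F_mA=-A\mathcal F_m.$$ The last two identities are equalities of unbounded operators, including their domains. -/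

import Mathlib

open MeasureTheory Filter Topology
open scoped ContDiff ENNReal

noncomputable section

namespace HalfLine

/-- Lebesgue measure on the half-line `]0,∞[`. -/
abbrev μ : Measure ℝ := volume.restrict (Set.Ioi (0 : ℝ))

/-- The Hilbert space `L²[0,∞[` of complex square integrable functions on the half-line. -/
abbrev L2 : Type := Lp ℂ 2 μ

/-! ### Test functions -/

/-- `φ ∈ C_c^∞(]0,∞[)`, viewed as a function on `ℝ` vanishing outside its support. -/
structure IsTest (φ : ℝ → ℂ) : Prop where
  contDiff : ContDiff ℝ ∞ φ
  compact : HasCompactSupport φ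
  supp : tsupport φ ⊆ Set.Ioi 0

theorem IsTest.add {φ ψ : ℝ → ℂ} (hφ : IsTest φ) (hψ : IsTest ψ) : IsTest (φ + ψ) :=
  ⟨hφ.contDiff.add hψ.contDiff, hφ.compact.add hψ.compact,
    (tsupport_add φ ψ).trans (Set.union_subset hφ.supp hψ.supp)⟩

theorem IsTest.smul {φ : ℝ → ℂ} (hφ : IsTest φ) (c : ℂ) : IsTest (c • φ) :=
  ⟨contDiff_const.smul hφ.contDiff, hφ.compact.mono (Function.support_const_smul_subset c φ),
    (closure_mono (Function.support_const_smul_subset c φ)).trans hφ.supp⟩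

theorem IsTest.zero : IsTest 0 :=
  ⟨contDiff_const, HasCompactSupport.zero, by simp⟩

theorem IsTest.deriv {φ : ℝ → ℂ} (hφ : IsTest φ) : IsTest (deriv φ) :=
  ⟨hφ.contDiff.iterate_deriv 1, hφ.compact.deriv,
    tsupport_deriv_subset.trans hφ.supp⟩

/-- The product of a test function with a function that is smooth on `]0,∞[`. -/
theorem IsTest.mul_left {φ w : ℝ → ℂ} (hφ : IsTest φ) (hw : ∀ x : ℝ, 0 < x → ContDiffAt ℝ ∞ w x) :
    IsTest (fun x => w x * φ x) := by
  refine ⟨contDiff_iff_contDiffAt.2 fun x => ?_, hφ.compact.mul_left, ?_⟩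
  · by_cases hx : x ∈ tsupport φ
    · exact (hw x (hφ.supp hx)).mul hφ.contDiff.contDiffAt
    · have h0 : (fun y => w y * φ y) =ᶠ[𝓝 x] fun _ => 0 := by
        filter_upwards [notMem_tsupport_iff_eventuallyEq.1 hx] with y hy
        simp [hy]
      exact contDiffAt_const.congr_of_eventuallyEq h0
  · exact (closure_mono (Function.support_mul_subset_right w φ)).trans hφ.supp

theorem IsTest.memLp {φ : ℝ → ℂ} (hφ : IsTest φ) : MemLp φ 2 μ :=
  (hφ.contDiff.continuous.memLp_of_hasCompactSupport (μ := volume) hφ.compact).restrict _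

theorem IsTest.integrable_mul {φ : ℝ → ℂ} (hφ : IsTest φ) (f : L2) :
    Integrable (fun x => f x * φ x) μ :=
  (Lp.memLp f).integrable_mul hφ.memLp

/-! ### Weakly defined operators -/

/-- The graph of the maximal realization of a differential operator on `L²[0,∞[`, where `T` is the
formal transpose of the differential expression: `(f, g)` belongs to it if and only if `f` is
mapped to `g` in the sense of distributions on `]0,∞[`. -/
def weakGraph (T : (ℝ → ℂ) → ℝ → ℂ) (hT : ∀ φ, IsTest φ → IsTest (T φ)) : Submodule ℂ (L2 × L2) where
  carrier := {p | ∀ φ, IsTest φ → ∫ x, p.1 x * T φ x ∂μ = ∫ x, p.2 x * φ x ∂μ}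
  zero_mem' := by
    intro φ _
    have h0 : ((0 : L2) : ℝ → ℂ) =ᵐ[μ] 0 := Lp.coeFn_zero ..
    have h1 : ∀ u : ℝ → ℂ, ∫ x, (0 : L2) x * u x ∂μ = 0 := fun u =>
      integral_eq_zero_of_ae (by filter_upwards [h0] with x hx; rw [hx]; simp)
    exact (h1 _).trans (h1 _).symm
  add_mem' := by
    intro p q hp hq φ hφ
    have h1 := Lp.coeFn_add p.1 q.1
    have h2 := Lp.coeFn_add p.2 q.2
    rw [integral_congr_ae (g := fun x => p.1 x * T φ x + q.1 x * T φ x),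
      integral_congr_ae (f := fun x => (p + q).2 x * φ x)
        (g := fun x => p.2 x * φ x + q.2 x * φ x),
      integral_add ((hT φ hφ).integrable_mul _) ((hT φ hφ).integrable_mul _),
      integral_add (hφ.integrable_mul _) (hφ.integrable_mul _), hp φ hφ, hq φ hφ]
    · filter_upwards [h2] with x hx
      rw [Prod.snd_add, hx, Pi.add_apply, add_mul]
    · filter_upwards [h1] with x hx
      rw [Prod.fst_add, hx, Pi.add_apply, add_mul]
  smul_mem' := by
    intro c p hp φ hφ
    have h1 := Lp.coeFn_smul c p.1
    have h2 := Lp.coeFn_smul c p.2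
    rw [integral_congr_ae (g := fun x => c * (p.1 x * T φ x)),
      integral_congr_ae (f := fun x => (c • p).2 x * φ x) (g := fun x => c * (p.2 x * φ x)),
      integral_const_mul, integral_const_mul, hp φ hφ]
    · filter_upwards [h2] with x hx
      rw [Prod.smul_snd, hx, Pi.smul_apply, smul_eq_mul, mul_assoc]
    · filter_upwards [h1] with x hx
      rw [Prod.smul_fst, hx, Pi.smul_apply, smul_eq_mul, mul_assoc]

theorem eq_zero_of_integral_test {g : L2} (h : ∀ φ, IsTest φ → ∫ x, g x * φ x ∂μ = 0) : g = 0 := by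
  have hloc : LocallyIntegrableOn (g : ℝ → ℂ) (Set.Ioi 0) volume := by
    apply locallyIntegrableOn_of_locallyIntegrable_restrict
    exact (Lp.memLp g).locallyIntegrable (by norm_num)
  have key := isOpen_Ioi.ae_eq_zero_of_integral_contDiff_smul_eq_zero hloc (by
    intro ψ h1 h2 h3
    have ht : IsTest (fun x => (ψ x : ℂ)) :=
      ⟨Complex.ofRealCLM.contDiff.comp h1, h2.comp_left (g := ((↑) : ℝ → ℂ)) (by simp),
        (closure_mono fun x hx => by simpa using hx).trans h3⟩
    have h4 := h _ ht
    rw [setIntegral_eq_integral_of_forall_compl_eq_zero] at h4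
    · rw [← h4]
      congr 1
      ext x
      simp [mul_comm]
    · intro x hx
      have : ψ x = 0 := image_eq_zero_of_notMem_tsupport fun hx' => hx (h3 hx')
      simp [this])
  apply Lp.ext
  have h0 : ((0 : L2) : ℝ → ℂ) =ᵐ[μ] 0 := Lp.coeFn_zero ..
  filter_upwards [(ae_restrict_iff' measurableSet_Ioi).2 key, h0] with x h1 h2
  rw [h1, h2]; rfl

/-- A weak graph is the graph of an operator. -/
theorem weakGraph_functional (T : (ℝ → ℂ) → ℝ → ℂ) (hT : ∀ φ, IsTest φ → IsTest (T φ)) :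
    ∀ p ∈ weakGraph T hT, p.1 = 0 → p.2 = 0 := by
  intro p hp h0
  apply eq_zero_of_integral_test
  intro φ hφ
  rw [← hp φ hφ, h0]
  have h1 : ((0 : L2) : ℝ → ℂ) =ᵐ[μ] 0 := Lp.coeFn_zero ..
  exact integral_eq_zero_of_ae (by filter_upwards [h1] with x hx; rw [hx]; simp)

theorem isClosed_weakGraph (T : (ℝ → ℂ) → ℝ → ℂ) (hT : ∀ φ, IsTest φ → IsTest (T φ)) :
    IsClosed (weakGraph T hT : Set (L2 × L2)) := by
  have hc : ∀ φ, IsTest φ → Continuous fun f : L2 => ∫ x, f x * φ x ∂μ := by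
    intro φ hφ
    have hst : MemLp (fun x => star (φ x)) 2 μ := hφ.memLp.star
    have : (fun f : L2 => ∫ x, f x * φ x ∂μ) = fun f : L2 => inner ℂ (hst.toLp _) f := by
      ext f
      rw [L2.inner_def]
      apply integral_congr_ae
      filter_upwards [hst.coeFn_toLp] with x hx
      rw [hx]
      simp
    rw [this]
    fun_prop
  have : (weakGraph T hT : Set (L2 × L2)) = ⋂ φ, ⋂ _ : IsTest φ,
      {p | ∫ x, p.1 x * T φ x ∂μ = ∫ x, p.2 x * φ x ∂μ} := by
    ext p
    simp [weakGraph]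
  rw [this]
  exact isClosed_iInter fun φ => isClosed_iInter fun hφ =>
    isClosed_eq ((hc _ (hT φ hφ)).comp continuous_fst) ((hc _ hφ).comp continuous_snd)

/-! ### The operators `L_α^min`, `L_α^max` and `H_m` -/

/-- The differential expression `L_α = -∂ₓ² + (-1/4 + α) / x²`; it is its own formal transpose. -/
def schrodinger (α : ℂ) (φ : ℝ → ℂ) (x : ℝ) : ℂ :=
  -(deriv (deriv φ) x) + (-1 / 4 + α) / (x : ℂ) ^ 2 * φ x

theorem IsTest.schrodinger (α : ℂ) (φ : ℝ → ℂ) (hφ : IsTest φ) : IsTest (schrodinger α φ) := by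
  have h1 := hφ.deriv.deriv.smul (-1)
  have h2 : IsTest (fun x : ℝ => (-1 / 4 + α) / (x : ℂ) ^ 2 * φ x) := by
    apply hφ.mul_left
    intro x hx
    have hx' : (x : ℂ) ^ 2 ≠ 0 := by exact_mod_cast (pow_pos hx 2).ne'
    have hp : ContDiffAt ℝ ∞ (fun y : ℝ => (y : ℂ) ^ 2) x :=
      (Complex.ofRealCLM.contDiff.pow 2).contDiffAt
    simp only [div_eq_mul_inv]
    exact contDiffAt_const.mul (hp.inv hx')
  convert h1.add h2 using 1
  ext x
  simp [HalfLine.schrodinger]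

/-- The maximal operator `L_α^max`, with domain all `f ∈ L²` such that `L_α f ∈ L²`. -/
def schrodingerMax (α : ℂ) : L2 →ₗ.[ℂ] L2 :=
  (weakGraph (schrodinger α) (IsTest.schrodinger α)).toLinearPMap

/-- The graph of `L_α` on `C_c^∞(]0,∞[)`. -/
def coreGraph (α : ℂ) : Submodule ℂ (L2 × L2) where
  carrier := {p | ∃ φ, IsTest φ ∧ p.1 =ᵐ[μ] φ ∧ p.2 =ᵐ[μ] schrodinger α φ}
  zero_mem' := by
    have h0 : ((0 : L2) : ℝ → ℂ) =ᵐ[μ] 0 := Lp.coeFn_zero ..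
    refine ⟨0, IsTest.zero, h0, h0.trans (ae_of_all _ fun x => ?_)⟩
    have : deriv (0 : ℝ → ℂ) = 0 := by ext; simp
    simp [schrodinger, this]
  add_mem' := by
    rintro p q ⟨φ, hφ, h1, h2⟩ ⟨ψ, hψ, h3, h4⟩
    refine ⟨φ + ψ, hφ.add hψ, (Lp.coeFn_add p.1 q.1).trans (h1.add h3),
      (Lp.coeFn_add p.2 q.2).trans ((h2.add h4).trans (ae_of_all _ fun x => ?_))⟩
    have hd : deriv (φ + ψ) = deriv φ + deriv ψ := by
      ext y
      exact deriv_add (hφ.contDiff.differentiable (by simp) y)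
        (hψ.contDiff.differentiable (by simp) y)
    have hd2 : deriv (deriv φ + deriv ψ) x = deriv (deriv φ) x + deriv (deriv ψ) x :=
      deriv_add (hφ.deriv.contDiff.differentiable (by simp) x)
        (hψ.deriv.contDiff.differentiable (by simp) x)
    simp only [schrodinger, hd, hd2, Pi.add_apply]
    ring
  smul_mem' := by
    rintro c p ⟨φ, hφ, h1, h2⟩
    refine ⟨c • φ, hφ.smul c, (Lp.coeFn_smul c p.1).trans (h1.const_smul c),
      (Lp.coeFn_smul c p.2).trans ((h2.const_smul c).trans (ae_of_all _ fun x => ?_))⟩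
    have hd : deriv (c • φ) = c • deriv φ := by
      ext y
      exact deriv_const_smul c (hφ.contDiff.differentiable (by simp) y)
    have hd2 : deriv (c • deriv φ) x = c • deriv (deriv φ) x :=
      deriv_const_smul c (hφ.deriv.contDiff.differentiable (by simp) x)
    simp only [schrodinger, hd, hd2, Pi.smul_apply, smul_eq_mul]
    ring

/-- The minimal operator `L_α^min`: the closure of `L_α` on `C_c^∞(]0,∞[)`. -/
def schrodingerMin (α : ℂ) : L2 →ₗ.[ℂ] L2 :=
  (coreGraph α).topologicalClosure.toLinearPMap

theorem schrodingerMax_graph (α : ℂ) :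
    (schrodingerMax α).graph = weakGraph (schrodinger α) (IsTest.schrodinger α) :=
  Submodule.toLinearPMap_graph_eq _ (weakGraph_functional _ _)

theorem integral_mul_deriv_test {φ ψ : ℝ → ℂ} (hφ : IsTest φ) (hψ : IsTest ψ) :
    ∫ x, φ x * deriv ψ x ∂μ = -∫ x, deriv φ x * ψ x ∂μ := by
  have hfull : ∀ {u v : ℝ → ℂ}, IsTest u → ∫ x, u x * v x ∂μ = ∫ x, u x * v x := by
    intro u v hu
    apply setIntegral_eq_integral_of_forall_compl_eq_zero
    intro x hx
    rw [image_eq_zero_of_notMem_tsupport fun hx' => hx (hu.supp hx'), zero_mul]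
  have hint : ∀ {u v : ℝ → ℂ}, IsTest u → IsTest v → Integrable (u * v) := by
    intro u v hu hv
    exact (hu.contDiff.continuous.mul hv.contDiff.continuous).integrable_of_hasCompactSupport
      hu.compact.mul_right
  rw [hfull hφ, hfull hφ.deriv]
  exact integral_mul_deriv_eq_deriv_mul_of_integrable
    (fun x _ => (hφ.contDiff.differentiable (by simp) x).hasDerivAt)
    (fun x _ => (hψ.contDiff.differentiable (by simp) x).hasDerivAt)
    (hint hφ hψ.deriv) (hint hφ.deriv hψ) (hint hφ hψ)

theorem coreGraph_le (α : ℂ) :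
    coreGraph α ≤ weakGraph (schrodinger α) (IsTest.schrodinger α) := by
  rintro p ⟨φ, hφ, h1, h2⟩ ψ hψ
  rw [integral_congr_ae (g := fun x => φ x * schrodinger α ψ x) (by
      filter_upwards [h1] with x hx; rw [hx]),
    integral_congr_ae (f := fun x => p.2 x * ψ x) (g := fun x => schrodinger α φ x * ψ x) (by
      filter_upwards [h2] with x hx; rw [hx])]
  have hi : ∀ {u v : ℝ → ℂ}, IsTest u → IsTest v → Integrable (fun x => u x * v x) μ :=
    fun hu hv => hu.memLp.integrable_mul hv.memLp
  have hw : IsTest (fun x : ℝ => (-1 / 4 + α) / (x : ℂ) ^ 2 * φ x) := by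
    have := (IsTest.schrodinger α φ hφ).add hφ.deriv.deriv
    convert this using 1
    ext x
    simp [schrodinger]
  have e1 : (fun x : ℝ => φ x * schrodinger α ψ x) = fun x : ℝ =>
      (-1 / 4 + α) / (x : ℂ) ^ 2 * φ x * ψ x - φ x * deriv (deriv ψ) x := by
    ext x; simp only [schrodinger]; ring
  have e2 : (fun x : ℝ => schrodinger α φ x * ψ x) = fun x : ℝ =>
      (-1 / 4 + α) / (x : ℂ) ^ 2 * φ x * ψ x - deriv (deriv φ) x * ψ x := by
    ext x; simp only [schrodinger]; ring
  rw [e1, e2, integral_sub (hi hw hψ) (hi hφ hψ.deriv.deriv),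
    integral_sub (hi hw hψ) (hi hφ.deriv.deriv hψ), integral_mul_deriv_test hφ hψ.deriv,
    integral_mul_deriv_test hφ.deriv hψ, neg_neg]

theorem schrodingerMin_graph (α : ℂ) :
    (schrodingerMin α).graph = (coreGraph α).topologicalClosure :=
  Submodule.toLinearPMap_graph_eq _ fun p hp => weakGraph_functional _ _ p <|
    Submodule.topologicalClosure_minimal _ (coreGraph_le α) (isClosed_weakGraph _ _) hp

/-- A smooth compactly supported cutoff that is equal to `1` around `0`. -/
structure IsCutoff (ξ : ℝ → ℝ) : Prop where
  contDiff : ContDiff ℝ ∞ ξ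
  compact : HasCompactSupport ξ
  eq_one : ∀ᶠ x in 𝓝 0, ξ x = 1

/-- The subspace `Dom L_{m²}^min + ℂ x^{1/2+m} ξ` of `L²[0,∞[`. -/
def domH (m : ℂ) (ξ : ℝ → ℝ) : Submodule ℂ L2 where
  carrier := {f | ∃ f₀ ∈ (schrodingerMin (m ^ 2)).domain, ∃ c : ℂ,
    f =ᵐ[μ] fun x => f₀ x + c * ((x : ℂ) ^ (1 / 2 + m) * ξ x)}
  zero_mem' := ⟨0, Submodule.zero_mem _, 0, ae_of_all _ fun x => by simp⟩
  add_mem' := by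
    rintro f g ⟨f₀, hf, c, h1⟩ ⟨g₀, hg, d, h2⟩
    refine ⟨f₀ + g₀, Submodule.add_mem _ hf hg, c + d, ?_⟩
    filter_upwards [h1, h2, Lp.coeFn_add f g, Lp.coeFn_add f₀ g₀] with x h1 h2 h3 h4
    rw [h3, h4, Pi.add_apply, Pi.add_apply, h1, h2]
    ring
  smul_mem' := by
    rintro a f ⟨f₀, hf, c, h1⟩
    refine ⟨a • f₀, Submodule.smul_mem _ a hf, a * c, ?_⟩
    filter_upwards [h1, Lp.coeFn_smul a f, Lp.coeFn_smul a f₀] with x h1 h3 h4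
    rw [h3, h4, Pi.smul_apply, Pi.smul_apply, h1, smul_eq_mul, smul_eq_mul]
    ring

/-- The homogeneous Schrödinger operator `H_m`: the restriction of `L_{m²}^max` to
`Dom L_{m²}^min + ℂ x^{1/2+m} ξ`. -/
def H (m : ℂ) (ξ : ℝ → ℝ) : L2 →ₗ.[ℂ] L2 :=
  (schrodingerMax (m ^ 2)).domRestrict (domH m ξ)

/-! ### The operator `X²` -/

/-- The graph of the operator of multiplication by the function `w` on its maximal domain. -/
def mulGraph (w : ℝ → ℂ) : Submodule ℂ (L2 × L2) where
  carrier := {p | p.2 =ᵐ[μ] fun x => w x * p.1 x}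
  zero_mem' := by
    have h0 : ((0 : L2) : ℝ → ℂ) =ᵐ[μ] 0 := Lp.coeFn_zero ..
    change ((0 : L2) : ℝ → ℂ) =ᵐ[μ] fun x => w x * (0 : L2) x
    filter_upwards [h0] with x hx
    rw [hx]
    simp
  add_mem' := by
    intro p q hp hq
    change (↑(p.2 + q.2) : ℝ → ℂ) =ᵐ[μ] fun x => w x * (p.1 + q.1 : L2) x
    filter_upwards [hp, hq, Lp.coeFn_add p.1 q.1, Lp.coeFn_add p.2 q.2] with x h1 h2 h3 h4
    rw [h3, h4, Pi.add_apply, Pi.add_apply, h1, h2]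
    ring
  smul_mem' := by
    intro a p hp
    change (↑(a • p.2) : ℝ → ℂ) =ᵐ[μ] fun x => w x * (a • p.1 : L2) x
    filter_upwards [hp, Lp.coeFn_smul a p.1, Lp.coeFn_smul a p.2] with x h1 h3 h4
    rw [h3, h4, Pi.smul_apply, Pi.smul_apply, h1, smul_eq_mul, smul_eq_mul]
    ring

theorem mulGraph_functional (w : ℝ → ℂ) : ∀ p ∈ mulGraph w, p.1 = 0 → p.2 = 0 := by
  intro p hp h0
  have h1 : p.2 =ᵐ[μ] fun x => w x * p.1 x := hp
  have h2 : ((0 : L2) : ℝ → ℂ) =ᵐ[μ] 0 := Lp.coeFn_zero ..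
  rw [h0] at h1
  apply Lp.ext
  filter_upwards [h1, h2] with x h3 h4
  rw [h3, h4]
  simp

/-- The operator `X²` of multiplication by `x²`, with domain all `f ∈ L²` such that `x² f ∈ L²`. -/
def Xsq : L2 →ₗ.[ℂ] L2 := (mulGraph fun x => (x : ℂ) ^ 2).toLinearPMap

theorem Xsq_graph : Xsq.graph = mulGraph fun x => (x : ℂ) ^ 2 :=
  Submodule.toLinearPMap_graph_eq _ (mulGraph_functional _)

/-! ### Dilations and their generator -/

/-- The formal transpose of `(1/2i)(x∂ₓ + ∂ₓx)`, namely `-(1/2i)(x∂ₓ + ∂ₓx)`. -/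
def dilationTranspose (φ : ℝ → ℂ) (x : ℝ) : ℂ :=
  -(1 / (2 * Complex.I) * (x * deriv φ x + deriv (fun y : ℝ => (y : ℂ) * φ y) x))

theorem IsTest.dilationTranspose (φ : ℝ → ℂ) (hφ : IsTest φ) : IsTest (dilationTranspose φ) := by
  have hx : ∀ x : ℝ, 0 < x → ContDiffAt ℝ ∞ (fun y : ℝ => (y : ℂ)) x :=
    fun x _ => Complex.ofRealCLM.contDiff.contDiffAt
  have h1 := ((hφ.deriv.mul_left hx).add (hφ.mul_left hx).deriv).smul (-(1 / (2 * Complex.I)))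
  convert h1 using 1
  ext x
  simp [HalfLine.dilationTranspose]

/-- The operator `A = (1/2i)(x∂ₓ + ∂ₓx)` on `L²[0,∞[`, with derivatives in the sense of
distributions and with domain all `f ∈ L²` such that `A f ∈ L²`. -/
def A : L2 →ₗ.[ℂ] L2 :=
  (weakGraph dilationTranspose IsTest.dilationTranspose).toLinearPMap

theorem A_graph : A.graph = weakGraph dilationTranspose IsTest.dilationTranspose :=
  Submodule.toLinearPMap_graph_eq _ (weakGraph_functional _ _)

theorem memLp_dilation (τ : ℝ) (f : L2) :
    MemLp (fun x : ℝ => ((Real.exp (τ / 2) : ℝ) : ℂ) * f (Real.exp τ * x)) 2 μ := by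
  have hmap : Measure.map (fun x => Real.exp τ * x) μ = ENNReal.ofReal |(Real.exp τ)⁻¹| • μ := by
    have hpre : Set.Ioi (0 : ℝ) = (fun x => Real.exp τ * x) ⁻¹' Set.Ioi 0 := by
      ext x; simp [Real.exp_pos]
    have h1 : μ = volume.restrict ((fun x => Real.exp τ * x) ⁻¹' Set.Ioi 0) := by rw [← hpre]
    conv_lhs => rw [h1]
    rw [← Measure.restrict_map (by fun_prop) measurableSet_Ioi,
      Real.map_volume_mul_left (Real.exp_pos τ).ne', Measure.restrict_smul]
  have h2 : MemLp f 2 (Measure.map (fun x => Real.exp τ * x) μ) := by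
    rw [hmap]
    exact (Lp.memLp f).smul_measure ENNReal.ofReal_ne_top
  exact (h2.comp_of_map (by fun_prop)).const_mul _

/-- The dilation `(U_τ f)(x) = e^{τ/2} f(e^τ x)` on `L²[0,∞[`. -/
def U (τ : ℝ) (f : L2) : L2 := (memLp_dilation τ f).toLp _

/-! ### The Hankel transformation -/

/-- The Bessel function `J_m(z) = ∑ⱼ (-1)^j / (j! Γ(m+j+1)) (z/2)^{2j+m}` for `z > 0`. -/
def besselJ (m : ℂ) (z : ℝ) : ℂ :=
  ∑' j : ℕ, (-1) ^ j / (j.factorial * Complex.Gamma (m + j + 1)) * ((z : ℂ) / 2) ^ (2 * j + m)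

/-- The kernel `J_m(kx) √(kx)`. -/
def hankelKernel (m : ℂ) (k x : ℝ) : ℂ := besselJ m (k * x) * (Real.sqrt (k * x) : ℂ)

/-- The truncated integral `∫₀ᴿ J_m(kx) √(kx) f(x) dx`. -/
def hankelTrunc (m : ℂ) (f : ℝ → ℂ) (R k : ℝ) : ℂ := ∫ x in Set.Ioc 0 R, hankelKernel m k x * f x

/-- `F` is the operator `(F f)(k) = ∫₀^∞ J_m(kx) √(kx) f(x) dx` on `L²[0,∞[`: for each `f ∈ L²` the
truncated integrals `∫₀ᴿ` are absolutely convergent and tend to `F f` in `L²` as `R → ∞` (as usual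
for integral transformations on `L²`, the integral over `]0,∞[` need not converge absolutely). -/
structure IsHankelTransform (m : ℂ) (F : L2 → L2) : Prop where
  integrable : ∀ (f : L2) (R k : ℝ), 0 < R → 0 < k →
    IntegrableOn (fun x => hankelKernel m k x * f x) (Set.Ioc 0 R)
  memLp : ∀ (f : L2) (R : ℝ), 0 < R → MemLp (hankelTrunc m f R) 2 μ
  tendsto : ∀ f : L2, Tendsto (fun R => eLpNorm (fun k => hankelTrunc m f R k - F f k) 2 μ) atTop (𝓝 0)

/-! ### Products of bounded and unbounded operators -/

/-- The product `B F` of an unbounded operator `B` with a bounded one `F`, with its natural domain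
`{f | F f ∈ Dom B}`. -/
def compRight (B : L2 →ₗ.[ℂ] L2) (F : L2 →L[ℂ] L2) : L2 →ₗ.[ℂ] L2 where
  domain := B.domain.comap (F : L2 →ₗ[ℂ] L2)
  toFun := B.toFun.comp ((F : L2 →ₗ[ℂ] L2).restrict fun _ hx => hx)

/-- The product `F B` of a bounded operator `F` with an unbounded one `B`, with domain `Dom B`. -/
def compLeft (F : L2 →L[ℂ] L2) (B : L2 →ₗ.[ℂ] L2) : L2 →ₗ.[ℂ] L2 :=
  (F : L2 →ₗ[ℂ] L2).compPMap B

end HalfLine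

end

noncomputable section

namespace HalfLine

/-! Everything is tested on one family of vectors, the Gaussians g_u(x) = e^{(m+1)u/2} x^{m+1/2}
exp(-e^u x²/2) with u real. Dilations translate the parameter, U_τ g_u = g_{u+2τ}, and the Hankel
transformation F should reflect it, g_u ↦ g_{-u}. So F is defined by this reflection, and the
identities are verified on Gaussians and extended by density. Density
(`ae_eq_zero_of_integral_gauss`) is Weierstrass approximation by polynomials in e^{-x²}.

The analytic point is that the reflection is bounded. The inner product of g_u and g_v depends only
on v - u, and Mellin inversion of a Beta integral exhibits it as the Fourier transform of the weight
|Γ((Re m+1)/2 + i(s + Im m/2))|². The span of the Gaussians is thus modelled on trigonometric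
polynomials in a weighted L² space, and the reflection replaces Im m by -Im m in the weight. Euler's
product bounds the ratio of the two weights (`exists_norm_Gamma_add_le`). Then F² = 1 and F U_τ =
U_{-τ} F are immediate.

For A, the weak relation Af = g is upgraded to differentiability of U_τ f by comparison with f +
∫₀^τ i U_s g ds (`hasDerivAt_U_of_mem`). Unitarity of U_τ makes A symmetric, its weak definition
gives A* ⊆ A, and differentiating F U_τ = U_{-τ} F gives FA = -AF.

That F is the Bessel integral follows by integrating the Bessel series term by term against a
Gaussian (`integral_kernelFun_mul_gauss`) and Fubini for truncated functions (`hankelTrunc_ae_eq`).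

For H_m, note that A g_u is a combination of g_u and x² g_u, so FA = -AF yields F(x² g_u) = L g_{-u}
without any Bessel integral (`hankel_sqVec`). By transposition F carries L on test functions, hence
L^min, into X². Conversely the pairs (g_u, x² g_u) span a core of X², and every g_u lies in Dom
L^min + ℂ x^{1/2+m} ξ, because subtracting the right multiple of x^{1/2+m} ξ leaves x^{m+1/2} times
a function O(x²), which a logarithmic cutoff approximates by test functions
(`mem_closure_coreGraph`). -/

/-! ### The Gamma function along vertical lines -/

theorem sum_one_div_add_sq_le {y : ℝ} (hy : 0 < y) (n : ℕ) :
    ∑ j ∈ Finset.range (n + 1), 1 / (y + j) ^ 2 ≤ 1 / y ^ 2 + 1 / y := by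
  -- The extra term -1/(y+n) makes the bound telescope, so that the induction closes.
  have h : ∑ j ∈ Finset.range (n + 1), 1 / (y + j) ^ 2 ≤ 1 / y ^ 2 + 1 / y - 1 / (y + n) := by
    induction n with
    | zero => simp
    | succ n ih =>
      rw [Finset.sum_range_succ]
      have h1 : (0 : ℝ) < y + n := by positivity
      have h2 : 1 / (y + (n + 1 : ℕ)) ^ 2 ≤ 1 / (y + n) - 1 / (y + (n + 1 : ℕ)) := by
        push_cast
        rw [div_sub_div _ _ (by positivity) (by positivity), div_le_div_iff₀ (by positivity)
          (by positivity)]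
        nlinarith
      linarith
  have : (0 : ℝ) ≤ 1 / (y + n) := by positivity
  linarith

/-- The modulus of the Gamma function varies moderately along vertical lines. -/
theorem exists_norm_Gamma_add_le {b : ℝ} (hb : 0 < b) (ν : ℝ) :
    ∃ C : ℝ, 0 ≤ C ∧ ∀ s : ℝ, ‖Complex.Gamma (b + (s + ν : ℝ) * Complex.I)‖ ≤
      C * ‖Complex.Gamma (b + s * Complex.I)‖ := by
  -- K bounds the sum over j of |ν|(2|σ|+|ν|)/(b+|σ|+j)² uniformly in σ: with y = b+|σ| the sum of
  -- 1/(y+j)² is at most 1/y² + 1/y, while 2|σ|+|ν| is O(y).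
  set K : ℝ := |ν| * (2 * (2 + |ν| / b) * (1 / b + 1)) with hK
  refine ⟨Real.exp K, (Real.exp_pos _).le, fun s => ?_⟩
  set σ : ℝ := s + ν with hσ
  have hn2 : ∀ (r : ℝ) (j : ℕ), ‖(b : ℂ) + r * Complex.I + j‖ ^ 2 = (b + j) ^ 2 + r ^ 2 := by
    intro r j
    rw [← Complex.normSq_eq_norm_sq, Complex.normSq_apply]
    simp
    ring
  have hpos : ∀ (r : ℝ) (j : ℕ), 0 < (b + j) ^ 2 + r ^ 2 := fun r j => by positivity
  have hnpos : ∀ (r : ℝ) (j : ℕ), 0 < ‖(b : ℂ) + r * Complex.I + j‖ := by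
    intro r j
    refine norm_pos_iff.2 fun h => ?_
    have := hn2 r j
    rw [h] at this
    simp at this
    linarith [hpos r j]
  -- In Euler's limit formula the product stands in the denominator, which is why s and σ are
  -- exchanged relative to the claim.
  have hprod : ∀ n : ℕ, ∏ j ∈ Finset.range (n + 1), ‖(b : ℂ) + s * Complex.I + j‖ ≤
      Real.exp K * ∏ j ∈ Finset.range (n + 1), ‖(b : ℂ) + σ * Complex.I + j‖ := by
    intro n
    have hterm : ∀ j : ℕ, ‖(b : ℂ) + s * Complex.I + j‖ ≤
        ‖(b : ℂ) + σ * Complex.I + j‖ * Real.exp (|ν| * (2 * |σ| + |ν|) / (b + |σ| + j) ^ 2) := by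
      intro j
      set X := |ν| * (2 * |σ| + |ν|) / (b + |σ| + j) ^ 2 with hX
      have hX0 : 0 ≤ X := by positivity
      refine le_of_sq_le_sq ?_ (by positivity)
      rw [mul_pow, hn2, hn2, ← Real.exp_nat_mul]
      have h1 : 1 + 2 * X ≤ Real.exp ((2 : ℕ) * X) := by
        have := Real.add_one_le_exp ((2 : ℕ) * X)
        push_cast at this ⊢
        linarith
      have h2 : s ^ 2 - σ ^ 2 ≤ |ν| * (2 * |σ| + |ν|) := by
        have e : s ^ 2 - σ ^ 2 = ν ^ 2 - 2 * σ * ν := by rw [hσ]; ring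
        rw [e]
        have := neg_abs_le (σ * ν)
        rw [abs_mul] at this
        nlinarith [sq_abs ν]
      have h3 : |ν| * (2 * |σ| + |ν|) = X * (b + |σ| + j) ^ 2 := by
        rw [hX, div_mul_cancel₀]
        positivity
      have h4 : (b + |σ| + j) ^ 2 ≤ 2 * ((b + j) ^ 2 + σ ^ 2) := by
        nlinarith [sq_nonneg (b + j - |σ|), sq_abs σ]
      calc (b + j) ^ 2 + s ^ 2 ≤ (b + j) ^ 2 + σ ^ 2 + X * (b + |σ| + j) ^ 2 := by linarith
        _ ≤ (b + j) ^ 2 + σ ^ 2 + X * (2 * ((b + j) ^ 2 + σ ^ 2)) := by gcongr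
        _ = ((b + j) ^ 2 + σ ^ 2) * (1 + 2 * X) := by ring
        _ ≤ _ := by gcongr
    refine (Finset.prod_le_prod (fun _ _ => norm_nonneg _) fun j _ => hterm j).trans ?_
    rw [Finset.prod_mul_distrib, ← Real.exp_sum, mul_comm]
    refine mul_le_mul_of_nonneg_right (Real.exp_le_exp.2 ?_)
      (Finset.prod_nonneg fun _ _ => norm_nonneg _)
    have hy : 0 < b + |σ| := by positivity
    calc ∑ j ∈ Finset.range (n + 1), |ν| * (2 * |σ| + |ν|) / (b + |σ| + j) ^ 2
        = |ν| * (2 * |σ| + |ν|) * ∑ j ∈ Finset.range (n + 1), 1 / (b + |σ| + j) ^ 2 := by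
          rw [Finset.mul_sum]
          exact Finset.sum_congr rfl fun j _ => by ring
      _ ≤ |ν| * (2 * |σ| + |ν|) * (1 / (b + |σ|) ^ 2 + 1 / (b + |σ|)) := by
          gcongr
          exact sum_one_div_add_sq_le hy n
      _ ≤ |ν| * ((2 * (2 + |ν| / b) * (b + |σ|)) * (1 / (b + |σ|) ^ 2 + 1 / (b + |σ|))) := by
          rw [mul_assoc]
          gcongr
          have h5 : |ν| ≤ |ν| / b * (b + |σ|) := by
            rw [div_mul_eq_mul_div, le_div_iff₀ hb]
            gcongr
            linarith [abs_nonneg σ]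
          have h6 : 0 ≤ |ν| / b * (b + |σ|) := by positivity
          nlinarith [abs_nonneg σ]
      _ = |ν| * (2 * (2 + |ν| / b) * (1 / (b + |σ|) + 1)) := by
          field_simp
      _ ≤ K := by
          rw [hK]
          gcongr
          linarith [abs_nonneg σ]
  -- The numerators n^z n! have the same modulus at both points, since the real parts agree.
  have hseq : ∀ᶠ n : ℕ in atTop, ‖Complex.GammaSeq (b + σ * Complex.I) n‖ ≤
      Real.exp K * ‖Complex.GammaSeq (b + s * Complex.I) n‖ := by
    filter_upwards [eventually_gt_atTop 0] with n hn
    have hnorm : ∀ r : ℝ, ‖(n : ℂ) ^ ((b : ℂ) + r * Complex.I)‖ = (n : ℝ) ^ b := by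
      intro r
      rw [Complex.norm_natCast_cpow_of_pos hn]
      simp
    simp only [Complex.GammaSeq, norm_div, norm_mul, norm_prod, hnorm]
    have p1 := Finset.prod_pos fun (j : ℕ) (_ : j ∈ Finset.range (n + 1)) => hnpos σ j
    have p2 := Finset.prod_pos fun (j : ℕ) (_ : j ∈ Finset.range (n + 1)) => hnpos s j
    rw [← mul_div_assoc, div_le_div_iff₀ p1 p2]
    have h0 : 0 ≤ (n : ℝ) ^ b * ‖(n.factorial : ℂ)‖ := by positivity
    calc _ ≤ (n : ℝ) ^ b * ‖(n.factorial : ℂ)‖ * _ := mul_le_mul_of_nonneg_left (hprod n) h0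
      _ = _ := by ring
  exact le_of_tendsto_of_tendsto (Complex.GammaSeq_tendsto_Gamma _).norm
    ((Complex.GammaSeq_tendsto_Gamma _).norm.const_mul _) hseq

theorem norm_Gamma_le {s : ℂ} (hs : 0 < s.re) : ‖Complex.Gamma s‖ ≤ Real.Gamma s.re := by
  rw [Complex.Gamma_eq_integral hs, Real.Gamma_eq_integral hs, Complex.GammaIntegral]
  refine (norm_integral_le_integral_norm _).trans (le_of_eq ?_)
  refine setIntegral_congr_fun measurableSet_Ioi fun x hx => ?_
  simp only [norm_mul]
  rw [Complex.norm_cpow_eq_rpow_re_of_pos hx, Complex.norm_real, Real.norm_eq_abs, Real.abs_exp]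
  simp

/-- The weight `|Γ(b + iy)|²`. -/
def gammaWeight (b y : ℝ) : ℝ := ‖Complex.Gamma (b + y * Complex.I)‖ ^ 2

theorem continuous_gammaWeight {b : ℝ} (hb : 0 < b) : Continuous (gammaWeight b) := by
  refine Continuous.pow (Continuous.norm ?_) 2
  refine continuous_iff_continuousAt.2 fun y => ?_
  refine ContinuousAt.comp (g := Complex.Gamma) ?_ (by fun_prop)
  refine (Complex.differentiableAt_Gamma _ fun n h => ?_).continuousAt
  have := congrArg Complex.re h
  simp at this
  have : (0 : ℝ) ≤ n := n.cast_nonneg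
  linarith

/-- The relation Γ(z+1) = zΓ(z) and the bound of |Γ(z+1)| by Γ(b+1) already give decay like
1/(1+y²); Stirling's formula is not needed. -/
theorem integrable_gammaWeight {b : ℝ} (hb : 0 < b) : Integrable (gammaWeight b) := by
  have hd : ∀ y : ℝ, gammaWeight b y ≤ Real.Gamma (b + 1) ^ 2 * max 1 (1 / b ^ 2) *
      (1 + y ^ 2)⁻¹ := by
    intro y
    set z : ℂ := b + y * Complex.I with hz
    have hzre : z.re = b := by simp [hz]
    have hz0 : z ≠ 0 := fun h => by rw [h] at hzre; simp at hzre; linarith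
    have h1 : ‖z‖ ^ 2 * gammaWeight b y ≤ Real.Gamma (b + 1) ^ 2 := by
      rw [gammaWeight, ← mul_pow, ← norm_mul, ← hz, ← Complex.Gamma_add_one z hz0]
      have := norm_Gamma_le (s := z + 1) (by simp [hzre]; linarith)
      simp only [Complex.add_re, hzre, Complex.one_re] at this
      gcongr
    have h2 : ‖z‖ ^ 2 = b ^ 2 + y ^ 2 := by
      rw [← Complex.normSq_eq_norm_sq, Complex.normSq_apply]
      simp [hz]
      ring
    have h3 : 1 + y ^ 2 ≤ max 1 (1 / b ^ 2) * ‖z‖ ^ 2 := by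
      rw [h2, mul_add]
      refine add_le_add ?_ ?_
      · calc (1 : ℝ) = 1 / b ^ 2 * b ^ 2 := by field_simp
          _ ≤ _ := by gcongr; exact le_max_right _ _
      · exact le_mul_of_one_le_left (sq_nonneg _) (le_max_left _ _)
    have hw : 0 ≤ gammaWeight b y := by unfold gammaWeight; positivity
    rw [← div_eq_mul_inv, le_div_iff₀ (by positivity)]
    calc gammaWeight b y * (1 + y ^ 2) ≤ gammaWeight b y * (max 1 (1 / b ^ 2) * ‖z‖ ^ 2) := by gcongr
      _ = max 1 (1 / b ^ 2) * (‖z‖ ^ 2 * gammaWeight b y) := by ring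
      _ ≤ max 1 (1 / b ^ 2) * Real.Gamma (b + 1) ^ 2 := by gcongr
      _ = _ := by ring
  refine (integrable_inv_one_add_sq.const_mul
    (Real.Gamma (b + 1) ^ 2 * max 1 (1 / b ^ 2))).mono'
    (continuous_gammaWeight hb).aestronglyMeasurable (ae_of_all _ fun y => ?_)
  rw [Real.norm_of_nonneg (by unfold gammaWeight; positivity)]
  exact hd y

/-! ### A Mellin transform and its inversion -/

/-- The substitution x = y/(1-y) turns the Mellin integral into the Beta integral B(z, a-z). -/
theorem hasMellin_one_add_rpow_neg {a : ℝ} {z : ℂ} (hz : 0 < z.re) (hz' : z.re < a) :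
    HasMellin (fun x : ℝ => (((1 + x) ^ (-a) : ℝ) : ℂ)) z
      (Complex.Gamma z * Complex.Gamma (a - z) / Complex.Gamma a) := by
  set g : ℝ → ℝ := fun y => y / (1 - y) with hg
  have himg : g '' Set.Ioo 0 1 = Set.Ioi 0 := by
    ext x
    constructor
    · rintro ⟨y, ⟨h0, h1⟩, rfl⟩
      exact div_pos h0 (by linarith)
    · intro hx
      have hx : 0 < x := hx
      refine ⟨x / (1 + x), ⟨by positivity, by rw [div_lt_one (by positivity)]; linarith⟩, ?_⟩
      simp only [hg]
      field_simp
      ring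
  have hinj : Set.InjOn g (Set.Ioo 0 1) := by
    intro x hx y hy h
    simp only [hg] at h
    rw [div_eq_div_iff (by linarith [hx.2]) (by linarith [hy.2])] at h
    linarith
  have hderiv : ∀ y ∈ Set.Ioo (0 : ℝ) 1, HasDerivWithinAt g (1 / (1 - y) ^ 2) (Set.Ioo 0 1) y := by
    intro y hy
    have h1 : 1 - y ≠ 0 := by linarith [hy.2]
    have := (hasDerivAt_id y).div ((hasDerivAt_id y).const_sub 1) h1
    refine (this.congr_deriv ?_).hasDerivWithinAt
    simp
  have hcong : Set.EqOn (fun y : ℝ => |1 / (1 - y) ^ 2| • ((g y : ℂ) ^ (z - 1) •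
      (((1 + g y) ^ (-a) : ℝ) : ℂ)))
      (fun y : ℝ => (y : ℂ) ^ (z - 1) * (1 - (y : ℂ)) ^ ((a - z) - 1)) (Set.Ioo 0 1) := by
    intro y hy
    have h1 : 0 < 1 - y := by linarith [hy.2]
    have hc : (1 - (y : ℂ)) = ((1 - y : ℝ) : ℂ) := by push_cast; rfl
    have hne : ((1 - y : ℝ) : ℂ) ≠ 0 := by exact_mod_cast h1.ne'
    have h2 : 1 + g y = (1 - y)⁻¹ := by simp only [hg]; field_simp; ring
    have h3 : (g y : ℂ) ^ (z - 1) = (y : ℂ) ^ (z - 1) * ((1 - y : ℝ) : ℂ) ^ (-(z - 1)) := by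
      have : (g y : ℂ) = (y : ℂ) * (((1 - y)⁻¹ : ℝ) : ℂ) := by simp [hg, div_eq_mul_inv]
      rw [this, Complex.mul_cpow_ofReal_nonneg hy.1.le (by positivity), Complex.ofReal_inv,
        Complex.inv_cpow, Complex.cpow_neg]
      rw [Complex.arg_ofReal_of_nonneg h1.le]
      exact Real.pi_pos.ne
    have h4 : (((1 + g y) ^ (-a) : ℝ) : ℂ) = ((1 - y : ℝ) : ℂ) ^ (a : ℂ) := by
      rw [h2, Real.inv_rpow h1.le, Real.rpow_neg h1.le, inv_inv, Complex.ofReal_cpow h1.le]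
    have h5 : ((|1 / (1 - y) ^ 2| : ℝ) : ℂ) = ((1 - y : ℝ) : ℂ) ^ (-2 : ℂ) := by
      rw [abs_of_pos (by positivity), Complex.cpow_neg]
      push_cast
      norm_cast
      simp
    simp only [smul_eq_mul, Complex.real_smul]
    rw [h3, h4, h5, hc]
    have : (a : ℂ) - z - 1 = -2 + (-(z - 1)) + a := by ring
    rw [this, Complex.cpow_add _ _ hne, Complex.cpow_add _ _ hne]
    ring
  have hre : 0 < (a - z : ℂ).re := by simp; linarith
  constructor
  · rw [MellinConvergent, ← himg,
      integrableOn_image_iff_integrableOn_abs_deriv_smul measurableSet_Ioo hderiv hinj,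
      integrableOn_congr_fun hcong measurableSet_Ioo]
    have := Complex.betaIntegral_convergent hz hre
    rw [intervalIntegrable_iff_integrableOn_Ioo_of_le zero_le_one] at this
    exact this
  · rw [mellin, ← himg, integral_image_eq_integral_abs_deriv_smul measurableSet_Ioo hderiv hinj,
      setIntegral_congr_fun measurableSet_Ioo hcong]
    have := Complex.betaIntegral_eq_Gamma_mul_div z (a - z) hz hre
    rw [Complex.betaIntegral, intervalIntegral.integral_of_le zero_le_one,
      integral_Ioc_eq_integral_Ioo] at this
    rw [this]
    congr 2
    ring

/-- `(2 cosh(d/2))^{-a}` is the Fourier transform of a multiple of `|Γ(a/2 + iy)|²`. -/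
theorem exp_mul_one_add_exp_rpow {a : ℝ} (ha : 0 < a) (d : ℝ) :
    ((Real.exp (a * d / 2) * (1 + Real.exp d) ^ (-a) : ℝ) : ℂ) =
      (2 * Real.pi * Real.Gamma a : ℝ)⁻¹ *
        ∫ y : ℝ, Complex.exp (-(d * y * Complex.I)) * gammaWeight (a / 2) y := by
  set f : ℝ → ℂ := fun x : ℝ => (((1 + x) ^ (-a) : ℝ) : ℂ) with hf
  have hmel : ∀ y : ℝ, HasMellin f ((a / 2 : ℝ) + y * Complex.I)
      ((Real.Gamma a : ℂ)⁻¹ * gammaWeight (a / 2) y) := by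
    intro y
    set z : ℂ := (a / 2 : ℝ) + y * Complex.I with hz
    have hre : z.re = a / 2 := by simp [hz]
    have := hasMellin_one_add_rpow_neg (a := a) (z := z) (by rw [hre]; linarith)
      (by rw [hre]; linarith)
    convert this using 1
    -- On the central line Re z = a/2 the two Gamma factors are complex conjugates, so their product
    -- is |Γ(z)|².
    have h1 : (a : ℂ) - z = (starRingEnd ℂ) z := by
      simp only [hz, map_add, map_mul, Complex.conj_ofReal, Complex.conj_I]
      push_cast
      ring
    rw [h1, Complex.Gamma_conj, Complex.mul_conj, Complex.normSq_eq_norm_sq, ← Complex.Gamma_ofReal,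
      gammaWeight, ← hz]
    ring
  have hvert : Complex.VerticalIntegrable (mellin f) (a / 2) := by
    have : (fun y : ℝ => mellin f ((a / 2 : ℝ) + y * Complex.I)) =
        fun y : ℝ => (Real.Gamma a : ℂ)⁻¹ * gammaWeight (a / 2) y :=
      funext fun y => (hmel y).2
    rw [Complex.VerticalIntegrable, this]
    exact (integrable_gammaWeight (half_pos ha)).ofReal.const_mul _
  have hpos := Real.exp_pos d
  have hc0 : MellinConvergent f (a / 2 : ℝ) := by simpa using (hmel 0).1
  have hcont : ContinuousAt f (Real.exp d) := by
    refine Complex.continuous_ofReal.continuousAt.comp (f := fun x : ℝ => (1 + x) ^ (-a)) ?_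
    exact (by fun_prop : ContinuousAt (fun x : ℝ => 1 + x) _).rpow_const
      (Or.inl (by positivity))
  -- Mellin inversion on the line Re z = a/2, evaluated at e^d, is Fourier inversion in the variable
  -- d.
  have hinv := mellinInv_mellin_eq (a / 2) f hpos hc0 hvert hcont
  rw [mellinInv] at hinv
  have hexp : ∀ y : ℝ, ((Real.exp d : ℝ) : ℂ) ^ (-((a / 2 : ℝ) + y * Complex.I : ℂ)) =
      Real.exp (-(a * d / 2)) * Complex.exp (-(d * y * Complex.I)) := by
    intro y
    rw [Complex.cpow_def_of_ne_zero (by exact_mod_cast hpos.ne'), ← Complex.ofReal_log hpos.le,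
      Real.log_exp, Complex.ofReal_exp, ← Complex.exp_add]
    congr 1
    push_cast
    ring
  simp only [fun y => (hmel y).2, hexp, smul_eq_mul] at hinv
  have hsplit : ∀ y : ℝ, (Real.exp (-(a * d / 2)) : ℂ) * Complex.exp (-(d * y * Complex.I)) *
      ((Real.Gamma a : ℂ)⁻¹ * gammaWeight (a / 2) y) =
      (Real.exp (-(a * d / 2)) * (Real.Gamma a : ℂ)⁻¹) *
        (Complex.exp (-(d * y * Complex.I)) * gammaWeight (a / 2) y) := fun y => by ring
  simp only [hsplit] at hinv
  rw [integral_const_mul, Complex.real_smul] at hinv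
  have h2 : ((Real.exp (a * d / 2) : ℝ) : ℂ) * (Real.exp (-(a * d / 2)) : ℝ) = 1 := by
    rw [← Complex.ofReal_mul, ← Real.exp_add]
    simp
  have h3 : f (Real.exp d) = (((1 + Real.exp d) ^ (-a) : ℝ) : ℂ) := rfl
  rw [Complex.ofReal_mul, ← h3, ← hinv]
  set J := ∫ y : ℝ, Complex.exp (-(d * y * Complex.I)) * gammaWeight (a / 2) y
  rw [show ((Real.exp (a * d / 2) : ℝ) : ℂ) * (((1 / (2 * Real.pi) : ℝ) : ℂ) *
      (Real.exp (-(a * d / 2)) * (Real.Gamma a : ℂ)⁻¹ * J)) =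
      (Real.exp (a * d / 2) : ℝ) * (Real.exp (-(a * d / 2)) : ℝ) *
        (((1 / (2 * Real.pi) : ℝ) : ℂ) * ((Real.Gamma a : ℂ)⁻¹ * J)) by ring, h2]
  push_cast
  rw [mul_inv]
  ring

/-! ### Uniqueness from integrals against Gaussians -/

/-- An integrable function on the half-line is determined by its integrals against
`exp (-n x²)`. -/
theorem ae_eq_zero_of_integral_exp_neg_sq {v : ℝ → ℂ} (hv : Integrable v μ)
    (h : ∀ n : ℕ, ∫ x, v x * (Real.exp (-x ^ 2) ^ n : ℝ) ∂μ = 0) : v =ᵐ[μ] 0 := by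
  have hpoly : ∀ p : Polynomial ℝ, ∫ x, v x * (p.eval (Real.exp (-x ^ 2)) : ℝ) ∂μ = 0 := by
    have hint : ∀ p : Polynomial ℝ,
        Integrable (fun x => v x * (p.eval (Real.exp (-x ^ 2)) : ℝ)) μ := by
      intro p
      have hc : Continuous fun x : ℝ => p.eval (Real.exp (-x ^ 2)) := by fun_prop
      obtain ⟨C, hC⟩ := (isCompact_Icc (a := (0 : ℝ)) (b := 1)).exists_bound_of_continuousOn
        p.continuous.continuousOn
      refine hv.mul_bdd (c := C) (Complex.continuous_ofReal.comp hc).aestronglyMeasurable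
        (ae_of_all _ fun x => ?_)
      rw [Complex.norm_real]
      exact hC _ ⟨(Real.exp_pos _).le, Real.exp_le_one_iff.2 (by nlinarith [sq_nonneg x])⟩
    intro p
    induction p using Polynomial.induction_on' with
    | add p q hp hq =>
      simp only [Polynomial.eval_add, Complex.ofReal_add, mul_add]
      rw [integral_add (hint p) (hint q), hp, hq, add_zero]
    | monomial n a =>
      simp only [Polynomial.eval_monomial, Complex.ofReal_mul]
      have : ∀ x : ℝ, v x * ((a : ℂ) * (Real.exp (-x ^ 2) ^ n : ℝ)) =
        a * (v x * (Real.exp (-x ^ 2) ^ n : ℝ)) := fun x => by ring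
      simp only [this]
      rw [integral_const_mul, h n, mul_zero]
  have hloc : LocallyIntegrableOn v (Set.Ioi 0) volume :=
    locallyIntegrableOn_of_locallyIntegrable_restrict hv.locallyIntegrable
  refine (ae_restrict_iff' measurableSet_Ioi).2
    (isOpen_Ioi.ae_eq_zero_of_integral_contDiff_smul_eq_zero hloc ?_)
  intro φ hφ hcomp hsupp
  have hzero : ∀ x, x ≤ 0 → φ x = 0 := fun x hx =>
    image_eq_zero_of_notMem_tsupport fun hx' => absurd (hsupp hx') (not_lt.2 hx)
  have hfull : ∫ x, φ x • v x = ∫ x, φ x • v x ∂μ := by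
    refine (setIntegral_eq_integral_of_forall_compl_eq_zero fun x hx => ?_).symm
    rw [hzero x (not_lt.1 hx), zero_smul]
  rw [hfull]
  -- In the variable y = exp(-x²) the test function becomes continuous on [0,1], so Weierstrass
  -- approximation applies. Compact support gives the value 0 near y = 0.
  set c : ℝ → ℝ := fun y => φ (Real.sqrt (-Real.log y)) with hc
  have hcont : ContinuousOn c (Set.Icc 0 1) := by
    intro y hy
    rcases hy.1.eq_or_lt with h0 | h0
    · obtain ⟨M, hM⟩ := hcomp.isCompact.isBounded.subset_closedBall 0
      have hev : ∀ᶠ y in 𝓝[≠] (0 : ℝ), c y = 0 := by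
        have ht : Tendsto (fun y => Real.sqrt (-Real.log y)) (𝓝[≠] 0) atTop :=
          Real.tendsto_sqrt_atTop.comp (tendsto_neg_atBot_atTop.comp Real.tendsto_log_nhdsNE_zero)
        filter_upwards [ht.eventually_gt_atTop M] with z hz
        refine image_eq_zero_of_notMem_tsupport (f := φ) fun hz' => ?_
        have := hM hz'
        rw [mem_closedBall_zero_iff] at this
        exact absurd ((le_abs_self _).trans this) (not_le.2 hz)
      -- Since `Real.log 0 = 0`, c 0 is φ 0, which vanishes because φ is supported in ]0,∞[.
      have hc0 : c 0 = 0 := by simp [hc, hzero]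
      rw [← h0]
      refine ContinuousAt.continuousWithinAt ?_
      rw [continuousAt_iff_punctured_nhds, hc0]
      exact tendsto_const_nhds.congr' (hev.mono fun _ h => h.symm)
    · refine ContinuousAt.continuousWithinAt ?_
      exact hφ.continuous.continuousAt.comp
        (Real.continuous_sqrt.continuousAt.comp (Real.continuousAt_log h0.ne').neg)
  have hcx : ∀ x : ℝ, 0 < x → c (Real.exp (-x ^ 2)) = φ x := by
    intro x hx
    simp [hc, Real.sqrt_sq hx.le]
  refine norm_le_zero_iff.1 (le_of_forall_pos_le_add fun ε hε => ?_)
  set I := ∫ x, ‖v x‖ ∂μ with hI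
  have hI0 : 0 ≤ I := integral_nonneg fun _ => norm_nonneg _
  -- Dividing by I + 1 rather than I allows for I = 0.
  obtain ⟨p, hp⟩ := exists_polynomial_near_of_continuousOn 0 1 c hcont (ε / (I + 1)) (by positivity)
  have hiφ : Integrable (fun x => φ x • v x) μ := by
    obtain ⟨C, hC⟩ := hcomp.exists_bound_of_continuous hφ.continuous
    exact hv.bdd_smul C hφ.continuous.aestronglyMeasurable (ae_of_all _ hC)
  have hip : Integrable (fun x => v x * (p.eval (Real.exp (-x ^ 2)) : ℝ)) μ := by
    have hcp : Continuous fun x : ℝ => p.eval (Real.exp (-x ^ 2)) := by fun_prop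
    obtain ⟨C, hC⟩ := (isCompact_Icc (a := (0 : ℝ)) (b := 1)).exists_bound_of_continuousOn
      p.continuous.continuousOn
    refine hv.mul_bdd (c := C) (Complex.continuous_ofReal.comp hcp).aestronglyMeasurable
      (ae_of_all _ fun x => ?_)
    rw [Complex.norm_real]
    exact hC _ ⟨(Real.exp_pos _).le, Real.exp_le_one_iff.2 (by nlinarith [sq_nonneg x])⟩
  have hsub : ∫ x, φ x • v x ∂μ =
      ∫ x, (φ x • v x - v x * (p.eval (Real.exp (-x ^ 2)) : ℝ)) ∂μ := by
    rw [integral_sub hiφ hip, hpoly p, sub_zero]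
  rw [hsub, zero_add]
  calc _ ≤ ∫ x, ‖φ x • v x - v x * (p.eval (Real.exp (-x ^ 2)) : ℝ)‖ ∂μ :=
        norm_integral_le_integral_norm _
    _ ≤ ∫ x, ε / (I + 1) * ‖v x‖ ∂μ := by
        refine integral_mono_ae (hiφ.sub hip).norm (hv.norm.const_mul _) ?_
        filter_upwards [ae_restrict_mem measurableSet_Ioi] with x hx
        have e : φ x • v x - v x * (p.eval (Real.exp (-x ^ 2)) : ℝ) =
            ((φ x - p.eval (Real.exp (-x ^ 2)) : ℝ) : ℂ) * v x := by
          rw [Complex.real_smul]; push_cast; ring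
        rw [e, norm_mul, Complex.norm_real, Real.norm_eq_abs, abs_sub_comm, ← hcx x hx]
        gcongr
        exact (hp _ ⟨(Real.exp_pos _).le, Real.exp_le_one_iff.2 (by nlinarith [sq_nonneg x])⟩).le
    _ = ε / (I + 1) * I := by rw [integral_const_mul]
    _ ≤ ε := by
        rw [div_mul_eq_mul_div, div_le_iff₀ (by positivity)]
        nlinarith

/-! ### The family of Gaussians and its Gram matrix -/

/-- The function `e^{(m+1)u/2} x^{m+1/2} exp (-e^u x²/2)`: the dilations of the Gaussian
`x^{m+1/2} exp (-x²/2)`. -/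
def gauss (m : ℂ) (u x : ℝ) : ℂ :=
  Complex.exp ((m + 1) * u / 2) * (x : ℂ) ^ (m + 1 / 2) * (Real.exp (-(Real.exp u * x ^ 2 / 2)) : ℝ)

theorem norm_gauss (m : ℂ) (u : ℝ) {x : ℝ} (hx : 0 < x) :
    ‖gauss m u x‖ = Real.exp ((m.re + 1) * u / 2) * x ^ (m.re + 1 / 2) *
      Real.exp (-(Real.exp u * x ^ 2 / 2)) := by
  rw [gauss, norm_mul, norm_mul, Complex.norm_exp, Complex.norm_cpow_eq_rpow_re_of_pos hx,
    Complex.norm_real, Real.norm_eq_abs, Real.abs_exp]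
  congr 3
  · have : (m + 1) * (u : ℂ) / 2 = (((u / 2 : ℝ) : ℂ)) * (m + 1) := by push_cast; ring
    rw [this, Complex.re_ofReal_mul]
    simp
    ring
  · simp

theorem gauss_ne_zero (m : ℂ) (u : ℝ) {x : ℝ} (hx : 0 < x) : gauss m u x ≠ 0 := by
  rw [← norm_pos_iff, norm_gauss m u hx]
  positivity

theorem continuousOn_ofReal_cpow (b : ℂ) :
    ContinuousOn (fun x : ℝ => (x : ℂ) ^ b) (Set.Ioi 0) := by
  intro x hx
  refine ContinuousAt.continuousWithinAt ?_
  exact (continuousAt_cpow_const (Complex.ofReal_mem_slitPlane.2 hx)).comp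
    Complex.continuous_ofReal.continuousAt

theorem continuousOn_gauss (m : ℂ) (u : ℝ) : ContinuousOn (gauss m u) (Set.Ioi 0) := by
  unfold gauss
  refine (continuousOn_const.mul (continuousOn_ofReal_cpow _)).mul (Continuous.continuousOn ?_)
  fun_prop

theorem aestronglyMeasurable_gauss (m : ℂ) (u : ℝ) : AEStronglyMeasurable (gauss m u) μ :=
  (continuousOn_gauss m u).aestronglyMeasurable measurableSet_Ioi

/-- Functions of moderate growth on the half-line are determined by their integrals against the
functions `gauss m u` with `u` large. -/
theorem ae_eq_zero_of_integral_gauss {f : ℝ → ℂ} (m : ℂ) (u₀ : ℝ)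
    (hf : Integrable (fun x => f x * gauss m u₀ x) μ)
    (h : ∀ u, u₀ ≤ u → ∫ x, f x * gauss m u x ∂μ = 0) : f =ᵐ[μ] 0 := by
  have key := ae_eq_zero_of_integral_exp_neg_sq hf (by
    intro n
    -- With e^u = e^{u₀} + 2n, `gauss m u` is a constant times `gauss m u₀` times exp(-x²)^n.
    set u : ℝ := Real.log (Real.exp u₀ + 2 * n) with hu
    have hpos : 0 < Real.exp u₀ + 2 * n := by positivity
    have hexp : Real.exp u = Real.exp u₀ + 2 * n := Real.exp_log hpos
    have hle : u₀ ≤ u := by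
      rw [hu, Real.le_log_iff_exp_le hpos]
      have : (0 : ℝ) ≤ n := n.cast_nonneg
      linarith
    have hk : ∀ x, f x * gauss m u₀ x * (Real.exp (-x ^ 2) ^ n : ℝ) =
        Complex.exp ((m + 1) * u₀ / 2 - (m + 1) * u / 2) * (f x * gauss m u x) := by
      intro x
      simp only [gauss]
      rw [hexp, Complex.exp_sub, ← Real.exp_nat_mul]
      have e1 : Real.exp (-((Real.exp u₀ + 2 * n) * x ^ 2 / 2)) =
          Real.exp (-(Real.exp u₀ * x ^ 2 / 2)) * Real.exp (n * -x ^ 2) := by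
        rw [← Real.exp_add]
        congr 1
        ring
      rw [e1]
      have := Complex.exp_ne_zero ((m + 1) * u / 2)
      push_cast
      field_simp
    simp only [hk]
    rw [integral_const_mul, h u hle, mul_zero])
  filter_upwards [key, ae_restrict_mem measurableSet_Ioi] with x hx hx0
  exact (mul_eq_zero.1 hx).resolve_right (gauss_ne_zero m u₀ hx0)

/-- For p = 0 the squared modulus behaves like x^{2 Re m + 1} at the origin, so Re m > -1 is exactly
the condition for integrability there. -/
theorem memLp_pow_mul_gauss {m : ℂ} (hm : -1 < m.re) (u : ℝ) (p : ℕ) :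
    MemLp (fun x : ℝ => (x : ℂ) ^ p * gauss m u x) 2 μ := by
  have hmeas : AEStronglyMeasurable (fun x : ℝ => (x : ℂ) ^ p * gauss m u x) μ :=
    (Continuous.aestronglyMeasurable (by fun_prop)).mul (aestronglyMeasurable_gauss m u)
  rw [memLp_two_iff_integrable_sq_norm hmeas]
  have hi := (integrableOn_rpow_mul_exp_neg_mul_sq (Real.exp_pos u)
    (s := 2 * m.re + 1 + 2 * p) (by have : (0 : ℝ) ≤ p := p.cast_nonneg; linarith)).const_mul
    (Real.exp ((m.re + 1) * u / 2) ^ 2)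
  refine hi.congr ?_
  filter_upwards [ae_restrict_mem measurableSet_Ioi] with x hx
  have hx : 0 < x := hx
  rw [norm_mul, norm_gauss m u hx, norm_pow, Complex.norm_real, Real.norm_of_nonneg hx.le]
  have e1 : x ^ (2 * m.re + 1 + 2 * p) = (x ^ p * x ^ (m.re + 1 / 2)) ^ 2 := by
    rw [← Real.rpow_natCast x p, ← Real.rpow_add hx, ← Real.rpow_natCast (x ^ _) 2,
      ← Real.rpow_mul hx.le]
    congr 1
    push_cast
    ring
  have e2 : Real.exp (-Real.exp u * x ^ 2) = Real.exp (-(Real.exp u * x ^ 2 / 2)) ^ 2 := by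
    rw [← Real.exp_nat_mul]
    congr 1
    push_cast
    ring
  rw [e1, e2]
  ring

theorem memLp_gauss {m : ℂ} (hm : -1 < m.re) (u : ℝ) : MemLp (gauss m u) 2 μ := by
  simpa using memLp_pow_mul_gauss hm u 0

/-- `gauss m u` as an element of `L²[0,∞[`. -/
def gaussVec {m : ℂ} (hm : -1 < m.re) (u : ℝ) : L2 := (memLp_gauss hm u).toLp _

theorem coeFn_gaussVec {m : ℂ} (hm : -1 < m.re) (u : ℝ) : gaussVec hm u =ᵐ[μ] gauss m u :=
  MemLp.coeFn_toLp _

/-- The integral is a Gaussian moment. The complex factor e^{(m+1)u/2} in the normalization makes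
the result a function of v - u alone, with Im m entering only through a phase. -/
theorem inner_gaussVec {m : ℂ} (hm : -1 < m.re) (u v : ℝ) :
    inner ℂ (gaussVec hm u) (gaussVec hm v) =
      (2 ^ m.re * Real.Gamma (m.re + 1) : ℝ) * Complex.exp (m.im * (v - u) / 2 * Complex.I) *
        (Real.exp ((m.re + 1) * (v - u) / 2) * (1 + Real.exp (v - u)) ^ (-(m.re + 1)) : ℝ) := by
  rw [L2.inner_def]
  have h1 : ∀ᵐ x ∂μ, inner ℂ (gaussVec hm u x) (gaussVec hm v x) =
      (Real.exp ((m.re + 1) * (u + v) / 2) : ℝ) * Complex.exp (m.im * (v - u) / 2 * Complex.I) *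
        ((x ^ (2 * m.re + 1) * Real.exp (-((Real.exp u + Real.exp v) / 2) * x ^ (2 : ℝ)) : ℝ) : ℂ)
      := by
    filter_upwards [coeFn_gaussVec hm u, coeFn_gaussVec hm v, ae_restrict_mem measurableSet_Ioi]
      with x hu hv hx
    have hx : 0 < x := hx
    rw [hu, hv, RCLike.inner_apply]
    simp only [gauss, map_mul, Complex.conj_ofReal]
    have e1 : (x : ℂ) ^ (m + 1 / 2) * (starRingEnd ℂ) ((x : ℂ) ^ (m + 1 / 2)) =
        ((x ^ (2 * m.re + 1) : ℝ) : ℂ) := by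
      rw [Complex.mul_conj, Complex.normSq_eq_norm_sq, Complex.norm_cpow_eq_rpow_re_of_pos hx,
        ← Real.rpow_natCast (x ^ _) 2, ← Real.rpow_mul hx.le]
      congr 2
      simp
      ring
    have e2 : Complex.exp ((m + 1) * v / 2) * (starRingEnd ℂ) (Complex.exp ((m + 1) * u / 2)) =
        (Real.exp ((m.re + 1) * (u + v) / 2) : ℝ) *
          Complex.exp (m.im * (v - u) / 2 * Complex.I) := by
      rw [← Complex.exp_conj, ← Complex.exp_add, Complex.ofReal_exp, ← Complex.exp_add]
      congr 1
      have h2 : (starRingEnd ℂ) ((m + 1) * u / 2) = ((starRingEnd ℂ) m + 1) * u / 2 := by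
        simp only [map_div₀, map_mul, map_add, map_one, Complex.conj_ofReal]
        congr 1
        exact Complex.conj_ofNat 2
      rw [h2]
      apply Complex.ext
      · have h3 : (m + 1) * v / 2 + ((starRingEnd ℂ) m + 1) * u / 2 =
          ((v / 2 : ℝ) : ℂ) * (m + 1) + ((u / 2 : ℝ) : ℂ) * ((starRingEnd ℂ) m + 1) := by
          push_cast; ring
        have h4 : (((m.re + 1) * (u + v) / 2 : ℝ) : ℂ) + m.im * (v - u) / 2 * Complex.I =
          (((m.re + 1) * (u + v) / 2 : ℝ) : ℂ) + ((m.im * (v - u) / 2 : ℝ) : ℂ) * Complex.I := by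
          push_cast; ring
        rw [h3, h4]
        simp
        ring
      · have h3 : (m + 1) * v / 2 + ((starRingEnd ℂ) m + 1) * u / 2 =
          ((v / 2 : ℝ) : ℂ) * (m + 1) + ((u / 2 : ℝ) : ℂ) * ((starRingEnd ℂ) m + 1) := by
          push_cast; ring
        have h4 : (((m.re + 1) * (u + v) / 2 : ℝ) : ℂ) + m.im * (v - u) / 2 * Complex.I =
          (((m.re + 1) * (u + v) / 2 : ℝ) : ℂ) + ((m.im * (v - u) / 2 : ℝ) : ℂ) * Complex.I := by
          push_cast; ring
        rw [h3, h4]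
        simp
        ring
    have e3 : Real.exp (-(Real.exp v * x ^ 2 / 2)) * Real.exp (-(Real.exp u * x ^ 2 / 2)) =
        Real.exp (-((Real.exp u + Real.exp v) / 2) * x ^ (2 : ℝ)) := by
      rw [← Real.exp_add, Real.rpow_two]
      congr 1
      ring
    rw [← e2, Complex.ofReal_mul, ← e1, ← e3, Complex.ofReal_mul]
    ring
  rw [integral_congr_ae h1, integral_const_mul, integral_complex_ofReal,
    integral_rpow_mul_exp_neg_mul_rpow (by norm_num) (by linarith) (by positivity)]
  have ha : (2 * m.re + 1 + 1) / 2 = m.re + 1 := by ring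
  have hb : -(2 * m.re + 1 + 1) / 2 = -(m.re + 1) := by ring
  rw [ha, hb]
  have e4 : Real.exp ((m.re + 1) * (u + v) / 2) *
      (((Real.exp u + Real.exp v) / 2) ^ (-(m.re + 1)) * (1 / 2) * Real.Gamma (m.re + 1)) =
      2 ^ m.re * Real.Gamma (m.re + 1) *
      (Real.exp ((m.re + 1) * (v - u) / 2) * (1 + Real.exp (v - u)) ^ (-(m.re + 1))) := by
    have h5 : (Real.exp u + Real.exp v) / 2 = Real.exp u * (1 + Real.exp (v - u)) * 2⁻¹ := by
      rw [mul_add, ← Real.exp_add]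
      ring_nf
    rw [h5, Real.mul_rpow (by positivity) (by positivity),
      Real.mul_rpow (by positivity) (by positivity), Real.inv_rpow (by norm_num),
      Real.rpow_neg (by norm_num : (0:ℝ) ≤ 2), inv_inv,
      Real.rpow_add (by norm_num), Real.rpow_one, ← Real.exp_mul]
    have h6 : Real.exp ((m.re + 1) * (u + v) / 2) * Real.exp (u * -(m.re + 1)) =
        Real.exp ((m.re + 1) * (v - u) / 2) := by
      rw [← Real.exp_add]
      congr 1
      ring
    rw [← h6]
    ring
  rw [mul_right_comm, ← Complex.ofReal_mul, e4]
  push_cast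
  ring

theorem gammaWeight_neg (b y : ℝ) : gammaWeight b (-y) = gammaWeight b y := by
  have : (b : ℂ) + (-y : ℝ) * Complex.I = (starRingEnd ℂ) (b + y * Complex.I) := by
    simp
  rw [gammaWeight, this, Complex.Gamma_conj, Complex.norm_conj, gammaWeight]

/-- The phase produced by Im m is absorbed by translating the spectral variable by Im m / 2; the
factor Γ(Re m + 1) cancels against the one from Mellin inversion. -/
theorem inner_gaussVec_eq_integral {m : ℂ} (hm : -1 < m.re) (u v : ℝ) :
    inner ℂ (gaussVec hm u) (gaussVec hm v) =
      (2 ^ m.re / (2 * Real.pi) : ℝ) * ∫ s : ℝ, Complex.exp (-((v - u) * s * Complex.I)) *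
        gammaWeight ((m.re + 1) / 2) (s + m.im / 2) := by
  have ha : 0 < m.re + 1 := by linarith
  have hE := exp_mul_one_add_exp_rpow ha (v - u)
  rw [inner_gaussVec, hE]
  have hshift := integral_add_right_eq_self (μ := volume) (fun y : ℝ =>
    Complex.exp (-((v - u) * (y - m.im / 2) * Complex.I)) * gammaWeight ((m.re + 1) / 2) y)
    (m.im / 2)
  have h1 : ∀ s : ℝ, Complex.exp (-((v - u) * (((s + m.im / 2 : ℝ) : ℂ) - m.im / 2) * Complex.I)) *
      gammaWeight ((m.re + 1) / 2) (s + m.im / 2) =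
      Complex.exp (-((v - u) * s * Complex.I)) *
        gammaWeight ((m.re + 1) / 2) (s + m.im / 2) := by
    intro s
    congr 4
    push_cast
    ring
  have h2 : ∀ y : ℝ, Complex.exp (-((v - u) * (y - m.im / 2) * Complex.I)) *
      gammaWeight ((m.re + 1) / 2) y = Complex.exp (m.im * (v - u) / 2 * Complex.I) *
      (Complex.exp (-(((v - u : ℝ) : ℂ) * y * Complex.I)) * gammaWeight ((m.re + 1) / 2) y) := by
    intro y
    rw [← mul_assoc, ← Complex.exp_add]
    congr 2
    push_cast
    ring
  simp only [h1, h2] at hshift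
  rw [hshift, integral_const_mul]
  have hG : (Real.Gamma (m.re + 1) : ℂ) ≠ 0 := by
    exact_mod_cast (Real.Gamma_pos_of_pos ha).ne'
  push_cast
  field_simp

/-- Substituting -s and using that the weight is even reverses the sign of the translation. For real
m the two weights coincide and the reflection is isometric. -/
theorem inner_gaussVec_neg_eq_integral {m : ℂ} (hm : -1 < m.re) (u v : ℝ) :
    inner ℂ (gaussVec hm (-u)) (gaussVec hm (-v)) =
      (2 ^ m.re / (2 * Real.pi) : ℝ) * ∫ s : ℝ, Complex.exp (-((v - u) * s * Complex.I)) *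
        gammaWeight ((m.re + 1) / 2) (s - m.im / 2) := by
  rw [inner_gaussVec_eq_integral, ← integral_neg_eq_self]
  congr 2
  ext s
  rw [← gammaWeight_neg]
  congr 2
  · congr 2
    push_cast
    ring
  · congr 1
    ring

/-- A Gram matrix that is the Fourier transform of w represents the vectors e u by the characters
exp(-ius) in L²(κ w ds), so comparing two such families reduces to comparing their weights
pointwise. -/
theorem norm_sq_linearCombination {E : Type*} [NormedAddCommGroup E] [InnerProductSpace ℂ E]
    {e : ℝ → E} {κ : ℝ} {w : ℝ → ℝ} (hw : Integrable w)
    (h : ∀ u v, inner ℂ (e u) (e v) =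
      (κ : ℂ) * ∫ s : ℝ, Complex.exp (-((v - u) * s * Complex.I)) * w s) (c : ℝ →₀ ℂ) :
    ‖Finsupp.linearCombination ℂ e c‖ ^ 2 =
      κ * ∫ s : ℝ, ‖∑ v ∈ c.support, c v * Complex.exp (-(v * s * Complex.I))‖ ^ 2 * w s := by
  have hint : ∀ d : ℝ, Integrable fun s : ℝ => Complex.exp (-(d * s * Complex.I)) * w s := by
    intro d
    refine hw.ofReal.bdd_mul (c := 1) (Continuous.aestronglyMeasurable (by fun_prop))
      (ae_of_all _ fun s => ?_)
    have : -((d : ℂ) * s * Complex.I) = ((-(d * s) : ℝ) : ℂ) * Complex.I := by push_cast; ring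
    rw [this, Complex.norm_exp_ofReal_mul_I]
  rw [← Complex.ofReal_inj]
  have h0 : ((‖Finsupp.linearCombination ℂ e c‖ ^ 2 : ℝ) : ℂ) =
      inner ℂ (Finsupp.linearCombination ℂ e c) (Finsupp.linearCombination ℂ e c) := by
    rw [inner_self_eq_norm_sq_to_K]; norm_cast
  rw [h0, Finsupp.linearCombination_apply, Finsupp.sum, sum_inner]
  simp only [inner_sum, inner_smul_left, inner_smul_right, h]
  rw [Complex.ofReal_mul, ← integral_complex_ofReal]
  have h1 : ∀ s : ℝ, ((‖∑ v ∈ c.support, c v * Complex.exp (-(v * s * Complex.I))‖ ^ 2 * w s : ℝ)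
      : ℂ) = ∑ u ∈ c.support, ∑ v ∈ c.support, (starRingEnd ℂ) (c u) * (c v *
        (Complex.exp (-(((v - u : ℝ) : ℂ) * s * Complex.I)) * w s)) := by
    intro s
    rw [Complex.ofReal_mul, ← Complex.normSq_eq_norm_sq, Complex.normSq_eq_conj_mul_self, map_sum,
      Finset.sum_mul_sum, Finset.sum_mul]
    refine Finset.sum_congr rfl fun u _ => ?_
    rw [Finset.sum_mul]
    refine Finset.sum_congr rfl fun v _ => ?_
    have e1 : Complex.exp (-(((v - u : ℝ) : ℂ) * s * Complex.I)) =
        (starRingEnd ℂ) (Complex.exp (-(u * s * Complex.I))) *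
          Complex.exp (-(v * s * Complex.I)) := by
      rw [← Complex.exp_conj, ← Complex.exp_add]
      congr 1
      simp only [map_neg, map_mul, Complex.conj_ofReal, Complex.conj_I]
      push_cast
      ring
    rw [e1, map_mul]
    ring
  simp only [h1]
  rw [integral_finsetSum _ fun u _ => integrable_finsetSum _ fun v _ =>
    ((hint (v - u)).const_mul _).const_mul _, Finset.mul_sum]
  refine Finset.sum_congr rfl fun u _ => ?_
  rw [integral_finsetSum _ fun v _ => ((hint (v - u)).const_mul _).const_mul _, Finset.mul_sum]
  refine Finset.sum_congr rfl fun v _ => ?_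
  rw [integral_const_mul, integral_const_mul]
  push_cast
  ring

/-- Reversal of the parameter is bounded on the span of the vectors `gaussVec hm u`. -/
theorem exists_norm_linearCombination_gaussVec_neg_le {m : ℂ} (hm : -1 < m.re) :
    ∃ C : ℝ, ∀ c : ℝ →₀ ℂ, ‖Finsupp.linearCombination ℂ (fun u => gaussVec hm (-u)) c‖ ≤
      C * ‖Finsupp.linearCombination ℂ (gaussVec hm) c‖ := by
  have hb : 0 < (m.re + 1) / 2 := by linarith
  -- The two weights are translates of each other by Im m, which is the displacement used here.
  obtain ⟨C, hC0, hC⟩ := exists_norm_Gamma_add_le hb (-m.im)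
  have hCw : ∀ s : ℝ, gammaWeight ((m.re + 1) / 2) (s - m.im / 2) ≤
      C ^ 2 * gammaWeight ((m.re + 1) / 2) (s + m.im / 2) := by
    intro s
    have := hC (s + m.im / 2)
    rw [show s + m.im / 2 + -m.im = s - m.im / 2 by ring] at this
    rw [gammaWeight, gammaWeight, ← mul_pow]
    gcongr
  refine ⟨C, fun c => ?_⟩
  have hw := integrable_gammaWeight hb
  have hp := norm_sq_linearCombination (hw.comp_add_right (m.im / 2))
    (inner_gaussVec_eq_integral hm) c
  have hn := norm_sq_linearCombination (hw.comp_sub_right (m.im / 2))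
    (inner_gaussVec_neg_eq_integral hm) c
  refine le_of_sq_le_sq ?_ (by positivity)
  have hcont : Continuous fun s : ℝ =>
      ‖∑ v ∈ c.support, c v * Complex.exp (-(v * s * Complex.I))‖ ^ 2 := by fun_prop
  have hbd : ∀ s : ℝ, ‖(‖∑ v ∈ c.support, c v * Complex.exp (-(v * s * Complex.I))‖ ^ 2 : ℝ)‖ ≤
      (∑ v ∈ c.support, ‖c v‖) ^ 2 := by
    intro s
    rw [Real.norm_of_nonneg (by positivity)]
    gcongr
    refine (norm_sum_le _ _).trans (Finset.sum_le_sum fun v _ => ?_)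
    have : -((v : ℂ) * s * Complex.I) = ((-(v * s) : ℝ) : ℂ) * Complex.I := by push_cast; ring
    rw [norm_mul, this, Complex.norm_exp_ofReal_mul_I, mul_one]
  rw [mul_pow, hp, hn, mul_left_comm, ← integral_const_mul (C ^ 2)]
  have hκ : (0 : ℝ) ≤ 2 ^ m.re / (2 * Real.pi) := by positivity
  refine mul_le_mul_of_nonneg_left (integral_mono ?_ ?_ fun s => ?_) hκ
  · exact (hw.comp_sub_right (m.im / 2)).bdd_mul hcont.aestronglyMeasurable (ae_of_all _ hbd)
  · exact ((hw.comp_add_right (m.im / 2)).bdd_mul hcont.aestronglyMeasurable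
      (ae_of_all _ hbd)).const_mul _
  · calc _ ≤ ‖∑ v ∈ c.support, c v * Complex.exp (-(v * s * Complex.I))‖ ^ 2 *
        (C ^ 2 * gammaWeight ((m.re + 1) / 2) (s + m.im / 2)) := by
          gcongr
          exact hCw s
      _ = _ := by ring

/-! ### Density -/

/-- A vector f orthogonal to the span makes conj(f)·w orthogonal to all Gaussians, hence zero. The
weight w = 1 serves for density of the Gaussians, and w = 1 + x² for the core of X². -/
theorem topologicalClosure_span_eq_top {m : ℂ} {e : ℝ → L2} {w : ℝ → ℂ}
    (he : ∀ u, e u =ᵐ[μ] fun x => w x * gauss m u x) (hw : ∀ x, 0 < x → w x ≠ 0) :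
    (Submodule.span ℂ (Set.range e)).topologicalClosure = ⊤ := by
  rw [Submodule.topologicalClosure_eq_top_iff, Submodule.eq_bot_iff]
  intro f hf
  rw [Submodule.mem_orthogonal] at hf
  have hcongr : ∀ u, ∀ᵐ x ∂μ, (starRingEnd ℂ) (f x) * w x * gauss m u x =
      inner ℂ (f x) (e u x) := by
    intro u
    filter_upwards [he u] with x hx
    rw [hx, RCLike.inner_apply]
    ring
  have h0 := ae_eq_zero_of_integral_gauss (f := fun x => (starRingEnd ℂ) (f x) * w x) m 0
    ((L2.integrable_inner f (e 0)).congr ((hcongr 0).mono fun x hx => hx.symm)) (by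
      intro u _
      rw [integral_congr_ae (hcongr u), ← L2.inner_def, ← inner_conj_symm,
        hf _ (Submodule.subset_span ⟨u, rfl⟩), map_zero])
  apply Lp.ext
  filter_upwards [h0, Lp.coeFn_zero ℂ 2 μ, ae_restrict_mem measurableSet_Ioi] with x h1 h2 h3
  rw [h2]
  simpa using (mul_eq_zero.1 h1).resolve_right (hw x h3)

theorem dense_span_gaussVec {m : ℂ} (hm : -1 < m.re) :
    Dense (Submodule.span ℂ (Set.range (gaussVec hm)) : Set L2) := by
  rw [Submodule.dense_iff_topologicalClosure_eq_top]
  exact topologicalClosure_span_eq_top (m := m) (w := fun _ => 1)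
    (fun u => by simpa using coeFn_gaussVec hm u) (by simp)

theorem ext_gaussVec {m : ℂ} (hm : -1 < m.re) {E : Type*} [NormedAddCommGroup E] [NormedSpace ℂ E]
    {S T : L2 →L[ℂ] E} (h : ∀ u, S (gaussVec hm u) = T (gaussVec hm u)) : S = T := by
  refine ContinuousLinearMap.ext_on (dense_span_gaussVec hm) ?_
  rintro _ ⟨u, rfl⟩
  exact h u

/-! ### The bilinear pairing -/

/-- The bilinear pairing `∫ f g` on `L²[0,∞[`. -/
def pair : L2 →L[ℂ] L2 →L[ℂ] ℂ := (ContinuousLinearMap.mul ℂ ℂ).lpPairing μ 2 2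

theorem pair_apply (f g : L2) : pair f g = ∫ x, f x * g x ∂μ := by
  simp [pair, ContinuousLinearMap.lpPairing_eq_integral]

theorem pair_comm (f g : L2) : pair f g = pair g f := by
  simp only [pair_apply, mul_comm]

theorem pair_toLp (f : L2) {φ : ℝ → ℂ} (hφ : MemLp φ 2 μ) :
    pair f (hφ.toLp φ) = ∫ x, f x * φ x ∂μ := by
  rw [pair_apply]
  exact integral_congr_ae (by filter_upwards [hφ.coeFn_toLp] with x hx; rw [hx])

/-! ### Dilations -/

theorem quasiMeasurePreserving_mul_exp (τ : ℝ) :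
    Measure.QuasiMeasurePreserving (fun x : ℝ => Real.exp τ * x) μ μ := by
  refine ⟨by fun_prop, ?_⟩
  have hpre : Set.Ioi (0 : ℝ) = (fun x => Real.exp τ * x) ⁻¹' Set.Ioi 0 := by
    ext x; simp [Real.exp_pos]
  have h1 : μ = volume.restrict ((fun x => Real.exp τ * x) ⁻¹' Set.Ioi 0) := by rw [← hpre]
  conv_lhs => rw [h1]
  rw [← Measure.restrict_map (by fun_prop) measurableSet_Ioi,
    Real.map_volume_mul_left (Real.exp_pos τ).ne', Measure.restrict_smul]
  exact Measure.smul_absolutelyContinuous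

theorem coeFn_U (τ : ℝ) (f : L2) :
    U τ f =ᵐ[μ] fun x => ((Real.exp (τ / 2) : ℝ) : ℂ) * f (Real.exp τ * x) :=
  MemLp.coeFn_toLp _

theorem integral_exp_mul_comp (τ : ℝ) (h : ℝ → ℂ) :
    ∫ x, (Real.exp τ : ℂ) * h (Real.exp τ * x) ∂μ = ∫ x, h x ∂μ := by
  rw [integral_const_mul, integral_comp_mul_left_Ioi h 0 (Real.exp_pos τ), mul_zero,
    Complex.real_smul, ← mul_assoc, ← Complex.ofReal_mul, mul_inv_cancel₀ (Real.exp_pos τ).ne']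
  simp

theorem ofReal_exp_half_mul_self (τ : ℝ) :
    ((Real.exp (τ / 2) : ℝ) : ℂ) * (Real.exp (τ / 2) : ℝ) = (Real.exp τ : ℝ) := by
  rw [← Complex.ofReal_mul, ← Real.exp_add]
  congr 2
  ring

theorem inner_U (τ : ℝ) (f g : L2) : inner ℂ (U τ f) (U τ g) = inner ℂ f g := by
  rw [L2.inner_def, L2.inner_def, ← integral_exp_mul_comp τ (fun x => inner ℂ (f x) (g x))]
  refine integral_congr_ae ?_
  filter_upwards [coeFn_U τ f, coeFn_U τ g] with x hf hg
  simp only [hf, hg, RCLike.inner_apply, map_mul, Complex.conj_ofReal]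
  rw [← ofReal_exp_half_mul_self τ]
  ring

theorem pair_U_U (τ : ℝ) (f g : L2) : pair (U τ f) (U τ g) = pair f g := by
  rw [pair_apply, pair_apply, ← integral_exp_mul_comp τ (fun x => f x * g x)]
  refine integral_congr_ae ?_
  filter_upwards [coeFn_U τ f, coeFn_U τ g] with x hf hg
  simp only [hf, hg]
  rw [← ofReal_exp_half_mul_self τ]
  ring

theorem U_add_vec (τ : ℝ) (f g : L2) : U τ (f + g) = U τ f + U τ g := by
  apply Lp.ext
  filter_upwards [coeFn_U τ f, coeFn_U τ g, coeFn_U τ (f + g), Lp.coeFn_add (U τ f) (U τ g),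
    (quasiMeasurePreserving_mul_exp τ).ae (Lp.coeFn_add f g)] with x h1 h2 h3 h4 h5
  rw [h3, h4, Pi.add_apply, h1, h2, h5, Pi.add_apply]
  ring

theorem U_smul (τ : ℝ) (c : ℂ) (f : L2) : U τ (c • f) = c • U τ f := by
  apply Lp.ext
  filter_upwards [coeFn_U τ f, coeFn_U τ (c • f), Lp.coeFn_smul c (U τ f),
    (quasiMeasurePreserving_mul_exp τ).ae (Lp.coeFn_smul c f)] with x h1 h3 h4 h5
  rw [h3, h4, Pi.smul_apply, h1, h5, Pi.smul_apply, smul_eq_mul, smul_eq_mul]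
  ring

theorem norm_U (τ : ℝ) (f : L2) : ‖U τ f‖ = ‖f‖ := by
  have h := inner_U τ f f
  rw [inner_self_eq_norm_sq_to_K, inner_self_eq_norm_sq_to_K] at h
  have h2 : ‖U τ f‖ ^ 2 = ‖f‖ ^ 2 := by exact_mod_cast h
  exact (sq_eq_sq₀ (norm_nonneg _) (norm_nonneg _)).1 h2

/-- The dilation `U τ` as a bounded operator. -/
def dilation (τ : ℝ) : L2 →L[ℂ] L2 :=
  LinearMap.mkContinuous
    { toFun := U τ, map_add' := U_add_vec τ, map_smul' := U_smul τ } 1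
    fun f => by simp [norm_U]

@[simp] theorem dilation_apply (τ : ℝ) (f : L2) : dilation τ f = U τ f := rfl

theorem gauss_dilate (m : ℂ) (τ u : ℝ) {x : ℝ} (hx : 0 < x) :
    ((Real.exp (τ / 2) : ℝ) : ℂ) * gauss m u (Real.exp τ * x) = gauss m (u + 2 * τ) x := by
  simp only [gauss]
  have e1 : ((Real.exp τ * x : ℝ) : ℂ) ^ (m + 1 / 2) =
      Complex.exp (τ * (m + 1 / 2)) * (x : ℂ) ^ (m + 1 / 2) := by
    rw [Complex.ofReal_mul, Complex.mul_cpow_ofReal_nonneg (Real.exp_pos τ).le hx.le,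
      Complex.cpow_def_of_ne_zero (by exact_mod_cast (Real.exp_pos τ).ne'),
      ← Complex.ofReal_log (Real.exp_pos τ).le, Real.log_exp]
  have e2 : Real.exp u * (Real.exp τ * x) ^ 2 = Real.exp (u + 2 * τ) * x ^ 2 := by
    rw [Real.exp_add, two_mul, Real.exp_add]
    ring
  have e3 : Complex.exp ((m + 1) * ((u + 2 * τ : ℝ) : ℂ) / 2) =
      ((Real.exp (τ / 2) : ℝ) : ℂ) * Complex.exp ((m + 1) * u / 2) *
        Complex.exp (τ * (m + 1 / 2)) := by
    rw [Complex.ofReal_exp, ← Complex.exp_add, ← Complex.exp_add]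
    congr 1
    push_cast
    ring
  rw [e1, e2, e3]
  ring

theorem U_gaussVec {m : ℂ} (hm : -1 < m.re) (τ u : ℝ) :
    U τ (gaussVec hm u) = gaussVec hm (u + 2 * τ) := by
  apply Lp.ext
  filter_upwards [coeFn_U τ (gaussVec hm u), coeFn_gaussVec hm (u + 2 * τ),
    (quasiMeasurePreserving_mul_exp τ).ae (coeFn_gaussVec hm u),
    ae_restrict_mem measurableSet_Ioi] with x h1 h2 h3 h4
  rw [h1, h2, h3, gauss_dilate m τ u h4]

/-- On Gaussians the group law is addition of parameters. The value m = 0 is an arbitrary admissible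
choice, here and in the next results on dilations. -/
theorem U_U (τ σ : ℝ) (f : L2) : U τ (U σ f) = U (τ + σ) f := by
  have hm : (-1 : ℝ) < (0 : ℂ).re := by simp
  have h : (dilation τ).comp (dilation σ) = dilation (τ + σ) := ext_gaussVec hm fun u => by
    simp only [ContinuousLinearMap.comp_apply, dilation_apply, U_gaussVec]
    congr 1
    ring
  exact congrArg (fun T : L2 →L[ℂ] L2 => T f) h

theorem U_zero (f : L2) : U 0 f = f := by
  have hm : (-1 : ℝ) < (0 : ℂ).re := by simp
  have h : dilation 0 = ContinuousLinearMap.id ℂ L2 := ext_gaussVec hm fun u => by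
    simp [U_gaussVec]
  exact congrArg (fun T : L2 →L[ℂ] L2 => T f) h

theorem pair_U_left (τ : ℝ) (f g : L2) : pair (U τ f) g = pair f (U (-τ) g) := by
  rw [← pair_U_U (-τ), U_U, neg_add_cancel, U_zero]

/-- The squared distance of two Gaussians is read off from the explicit Gram matrix, which is
continuous. -/
theorem continuous_gaussVec {m : ℂ} (hm : -1 < m.re) : Continuous (gaussVec hm) := by
  rw [continuous_iff_continuousAt]
  intro u₀
  rw [ContinuousAt, tendsto_iff_norm_sub_tendsto_zero]
  have hsq : ∀ u, ‖gaussVec hm u - gaussVec hm u₀‖ ^ 2 =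
      (inner ℂ (gaussVec hm u) (gaussVec hm u) - inner ℂ (gaussVec hm u) (gaussVec hm u₀) -
        inner ℂ (gaussVec hm u₀) (gaussVec hm u) +
          inner ℂ (gaussVec hm u₀) (gaussVec hm u₀)).re := by
    intro u
    rw [← inner_sub_sub_self, inner_self_eq_norm_sq_to_K]
    norm_cast
  have hcont : Continuous fun u => ‖gaussVec hm u - gaussVec hm u₀‖ ^ 2 := by
    simp only [hsq, inner_gaussVec]
    have hr : ∀ d : ℝ → ℝ, Continuous d → Continuous fun u =>
        (1 + Real.exp (d u)) ^ (-(m.re + 1)) := fun d hd =>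
      (by fun_prop : Continuous fun u => 1 + Real.exp (d u)).rpow_const fun u =>
        Or.inl (by positivity)
    have h1 := hr (fun u => u - u) (by fun_prop)
    have h2 := hr (fun u => u₀ - u) (by fun_prop)
    have h3 := hr (fun u => u - u₀) (by fun_prop)
    fun_prop
  have ht := (Real.continuous_sqrt.comp hcont).tendsto u₀
  simpa [Function.comp_def, Real.sqrt_sq (norm_nonneg _)] using ht

/-- Strong continuity holds on the span of the Gaussians, and since every U τ is isometric,
approximating f approximates its orbit uniformly in τ. -/
theorem continuous_U (f : L2) : Continuous fun τ => U τ f := by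
  have hm : (-1 : ℝ) < (0 : ℂ).re := by simp
  have hspan : ∀ g ∈ Submodule.span ℂ (Set.range (gaussVec hm)), Continuous fun τ => U τ g := by
    intro g hg
    induction hg using Submodule.span_induction with
    | mem x hx =>
      obtain ⟨u, rfl⟩ := hx
      simp only [U_gaussVec]
      exact (continuous_gaussVec hm).comp (by fun_prop)
    | zero => simpa [← dilation_apply] using continuous_const
    | add x y _ _ hx hy => simpa only [U_add_vec] using hx.fun_add hy
    | smul a x _ hx => simpa only [U_smul] using hx.fun_const_smul a
  refine continuous_of_uniform_approx_of_continuous fun s hs => ?_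
  obtain ⟨ε, hε, hεs⟩ := Metric.mem_uniformity_dist.1 hs
  obtain ⟨g, hg, hfg⟩ := (dense_span_gaussVec hm).exists_dist_lt f hε
  refine ⟨fun τ => U τ g, hspan g hg, fun τ => hεs ?_⟩
  rw [dist_eq_norm] at hfg ⊢
  beta_reduce
  rw [← dilation_apply, ← dilation_apply, ← map_sub, dilation_apply, norm_U]
  exact hfg

/-! ### The Hankel transformation as a bounded operator -/

/-- The Hankel transformation, determined by its action `gauss m u ↦ gauss m (-u)`. -/
def hankel {m : ℂ} (hm : -1 < m.re) : L2 →L[ℂ] L2 :=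
  (Finsupp.linearCombination ℂ fun u => gaussVec hm (-u)).extendOfNorm
    (Finsupp.linearCombination ℂ (gaussVec hm))

/-- Density of the span and the bound on reversal are what `extendOfNorm` requires to extend the
assignment; the bound also makes it independent of the chosen linear combination. -/
theorem hankel_gaussVec {m : ℂ} (hm : -1 < m.re) (u : ℝ) :
    hankel hm (gaussVec hm u) = gaussVec hm (-u) := by
  have hd : DenseRange (Finsupp.linearCombination ℂ (gaussVec hm)) := by
    have := dense_span_gaussVec hm
    rwa [← Finsupp.range_linearCombination] at this
  have := LinearMap.extendOfNorm_eq hd (exists_norm_linearCombination_gaussVec_neg_le hm)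
    (Finsupp.single u 1)
  simpa [hankel] using this

theorem hankel_hankel {m : ℂ} (hm : -1 < m.re) (f : L2) : hankel hm (hankel hm f) = f := by
  have h : (hankel hm).comp (hankel hm) = ContinuousLinearMap.id ℂ L2 := ext_gaussVec hm fun u => by
    simp [hankel_gaussVec]
  exact congrArg (fun T : L2 →L[ℂ] L2 => T f) h

theorem hankel_U {m : ℂ} (hm : -1 < m.re) (τ : ℝ) (f : L2) :
    hankel hm (U τ f) = U (-τ) (hankel hm f) := by
  have h : (hankel hm).comp (dilation τ) = (dilation (-τ)).comp (hankel hm) :=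
    ext_gaussVec hm fun u => by
      simp only [ContinuousLinearMap.comp_apply, dilation_apply, U_gaussVec, hankel_gaussVec]
      congr 1
      ring
  exact congrArg (fun T : L2 →L[ℂ] L2 => T f) h

/-- This is the symmetry of the kernel in k and x, so the pairing must be bilinear and not the inner
product. On Gaussians, dilating by (u-v)/2 takes the parameters (-u, v) to (-v, u). -/
theorem pair_hankel {m : ℂ} (hm : -1 < m.re) (f g : L2) :
    pair (hankel hm f) g = pair f (hankel hm g) := by
  have h : pair.comp (hankel hm) = (pair.flip.comp (hankel hm)).flip :=
    ext_gaussVec hm fun u => ext_gaussVec hm fun v => by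
      simp only [ContinuousLinearMap.comp_apply, ContinuousLinearMap.flip_apply, hankel_gaussVec]
      rw [← pair_U_U ((u - v) / 2), U_gaussVec, U_gaussVec, pair_comm]
      congr 2 <;> congr 1 <;> ring
  exact congrArg (fun T : L2 →L[ℂ] L2 →L[ℂ] ℂ => T f g) h

/-! ### The generator of dilations -/

theorem IsTest.differentiable {φ : ℝ → ℂ} (hφ : IsTest φ) : Differentiable ℝ φ :=
  hφ.contDiff.differentiable (by simp)

theorem dilationTranspose_eq {φ : ℝ → ℂ} (hφ : Differentiable ℝ φ) (x : ℝ) :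
    dilationTranspose φ x = Complex.I * (x * deriv φ x + φ x / 2) := by
  have h : deriv (fun y : ℝ => (y : ℂ) * φ y) x = φ x + x * deriv φ x := by
    have h1 : HasDerivAt (fun y : ℝ => (y : ℂ)) 1 x := Complex.ofRealCLM.hasDerivAt
    simpa using (h1.fun_mul (hφ x).hasDerivAt).deriv
  rw [dilationTranspose, h]
  have : (1 : ℂ) / (2 * Complex.I) = -Complex.I / 2 := by
    rw [div_eq_div_iff (by simp) (by norm_num)]
    linear_combination 2 * Complex.I_mul_I
  rw [this]
  ring

theorem IsTest.dilate {φ : ℝ → ℂ} (hφ : IsTest φ) (τ : ℝ) :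
    IsTest fun x => ((Real.exp (τ / 2) : ℝ) : ℂ) * φ (Real.exp τ * x) := by
  have h1 : IsTest fun x => φ (Real.exp τ * x) := by
    refine ⟨hφ.contDiff.comp (by fun_prop), ?_, ?_⟩
    · simpa only [smul_eq_mul] using hφ.compact.comp_smul (c := Real.exp τ) (Real.exp_pos τ).ne'
    refine (tsupport_comp_subset_preimage φ (f := fun x => Real.exp τ * x) (by fun_prop)).trans ?_
    intro x hx
    have : 0 < Real.exp τ * x := hφ.supp hx
    exact (mul_pos_iff_of_pos_left (Real.exp_pos τ)).1 this
  exact h1.smul _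

theorem dilationTranspose_dilate {φ : ℝ → ℂ} (hφ : IsTest φ) (τ x : ℝ) :
    dilationTranspose (fun x => ((Real.exp (τ / 2) : ℝ) : ℂ) * φ (Real.exp τ * x)) x =
      ((Real.exp (τ / 2) : ℝ) : ℂ) * dilationTranspose φ (Real.exp τ * x) := by
  rw [dilationTranspose_eq (hφ.dilate τ).differentiable, dilationTranspose_eq hφ.differentiable]
  have h1 : HasDerivAt (fun x => φ (Real.exp τ * x)) (Real.exp τ • deriv φ (Real.exp τ * x)) x := by
    have h2 : HasDerivAt (fun x => Real.exp τ * x) (Real.exp τ) x := by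
      simpa using (hasDerivAt_id x).const_mul (Real.exp τ)
    exact (hφ.differentiable _).hasDerivAt.scomp x h2
  rw [(h1.const_mul _).deriv, Complex.real_smul]
  push_cast
  ring

theorem U_toLp (τ : ℝ) {g : ℝ → ℂ} (hg : MemLp g 2 μ) :
    U τ (hg.toLp g) =ᵐ[μ] fun x => ((Real.exp (τ / 2) : ℝ) : ℂ) * g (Real.exp τ * x) := by
  filter_upwards [coeFn_U τ (hg.toLp g), (quasiMeasurePreserving_mul_exp τ).ae hg.coeFn_toLp]
    with x h1 h2
  rw [h1, h2]

theorem integral_U_mul (τ : ℝ) (f : L2) {g : ℝ → ℂ} (hg : MemLp g 2 μ) :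
    ∫ x, U τ f x * g x ∂μ =
      ∫ x, f x * (((Real.exp (-τ / 2) : ℝ) : ℂ) * g (Real.exp (-τ) * x)) ∂μ := by
  rw [← pair_toLp _ hg, pair_U_left, pair_apply]
  exact integral_congr_ae (by filter_upwards [U_toLp (-τ) hg] with x hx; rw [hx])

/-- Since f need not be smooth, the dilation is moved onto the test function and the integral is
differentiated by dominated convergence. -/
theorem hasDerivAt_integral_U_mul (f : L2) {φ : ℝ → ℂ} (hφ : IsTest φ) :
    HasDerivAt (fun τ => ∫ x, U τ f x * φ x ∂μ)
      (Complex.I * ∫ x, f x * dilationTranspose φ x ∂μ) 0 := by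
  simp only [fun τ => integral_U_mul τ f hφ.memLp]
  set χ : ℝ → ℂ := fun y => y * deriv φ y + φ y / 2 with hχ
  have hχT : ∀ y, dilationTranspose φ y = Complex.I * χ y := dilationTranspose_eq hφ.differentiable
  have hχtest : IsTest χ := by
    have := (IsTest.dilationTranspose φ hφ).smul (-Complex.I)
    convert this using 1
    ext y
    simp only [Pi.smul_apply, smul_eq_mul, hχT]
    linear_combination χ y * Complex.I_mul_I
  obtain ⟨M, hM⟩ := hχtest.compact.exists_bound_of_continuous hχtest.contDiff.continuous
  obtain ⟨B, hB⟩ := hχtest.compact.isCompact.isBounded.subset_closedBall 0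
  have hM0 : 0 ≤ M := (norm_nonneg _).trans (hM 0)
  have hB' : ∀ y, B < y → χ y = 0 := by
    intro y hy
    refine image_eq_zero_of_notMem_tsupport fun hy' => ?_
    have := hB hy'
    rw [mem_closedBall_zero_iff] at this
    exact absurd ((le_abs_self y).trans this) (not_le.2 hy)
  have hderiv : ∀ τ x : ℝ, HasDerivAt
      (fun τ : ℝ => f x * (((Real.exp (-τ / 2) : ℝ) : ℂ) * φ (Real.exp (-τ) * x)))
      (f x * (-((Real.exp (-τ / 2) : ℝ) : ℂ) * χ (Real.exp (-τ) * x))) τ := by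
    intro τ x
    have h1 : HasDerivAt (fun τ : ℝ => ((Real.exp (-τ / 2) : ℝ) : ℂ))
        ((Real.exp (-τ / 2) * (-1 / 2) : ℝ) : ℂ) τ := by
      have : HasDerivAt (fun τ : ℝ => -τ / 2) (-1 / 2) τ := (hasDerivAt_neg τ).div_const 2
      exact this.exp.ofReal_comp
    have h2 : HasDerivAt (fun τ : ℝ => φ (Real.exp (-τ) * x))
        ((Real.exp (-τ) * -1 * x) • deriv φ (Real.exp (-τ) * x)) τ := by
      have : HasDerivAt (fun τ : ℝ => Real.exp (-τ) * x) (Real.exp (-τ) * -1 * x) τ :=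
        ((hasDerivAt_neg τ).exp).mul_const x
      exact (hφ.differentiable _).hasDerivAt.scomp τ this
    refine ((h1.mul h2).const_mul (f x)).congr_deriv ?_
    simp only [hχ, Complex.real_smul]
    push_cast
    ring
  have hmeas : ∀ τ : ℝ, AEStronglyMeasurable
      (fun x => f x * (((Real.exp (-τ / 2) : ℝ) : ℂ) * φ (Real.exp (-τ) * x))) μ := fun τ =>
    (Lp.aestronglyMeasurable f).mul ((hφ.dilate (-τ)).contDiff.continuous.aestronglyMeasurable)
  -- For |τ| < 1 the dilated χ vanishes beyond e·B, so a multiple of |f| on the bounded set ]0,R]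
  -- dominates.
  set R : ℝ := Real.exp 1 * B with hR
  have hbint : Integrable (fun x => (Set.Iic R).indicator (fun x => Real.exp 1 * M * ‖f x‖) x) μ := by
    rw [integrable_indicator_iff measurableSet_Iic]
    have hfin : IsFiniteMeasure (μ.restrict (Set.Iic R)) := by
      constructor
      rw [Measure.restrict_apply_univ, Measure.restrict_apply measurableSet_Iic,
        Set.Iic_inter_Ioi]
      simp
    have : IntegrableOn (f : ℝ → ℂ) (Set.Iic R) μ :=
      ((Lp.memLp f).restrict (Set.Iic R)).integrable (by norm_num)
    exact this.norm.const_mul _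
  have key := hasDerivAt_integral_of_dominated_loc_of_deriv_le (μ := μ) (𝕜 := ℝ)
    (F := fun τ x => f x * (((Real.exp (-τ / 2) : ℝ) : ℂ) * φ (Real.exp (-τ) * x)))
    (F' := fun τ x => f x * (-((Real.exp (-τ / 2) : ℝ) : ℂ) * χ (Real.exp (-τ) * x)))
    (x₀ := 0) (s := Metric.ball 0 1) (Metric.ball_mem_nhds 0 one_pos)
    (bound := (Set.Iic R).indicator (fun x => Real.exp 1 * M * ‖f x‖))
    (Eventually.of_forall hmeas) ((hφ.dilate (-0)).integrable_mul f)
    ((Lp.aestronglyMeasurable f).mul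
      (((hχtest.dilate (-0)).smul (-1)).contDiff.continuous.aestronglyMeasurable.congr
        (ae_of_all _ fun x => by simp)))
    ((ae_restrict_mem measurableSet_Ioi).mono fun x hx0 τ hτ => ?_) hbint
    (ae_of_all _ fun x τ _ => hderiv τ x)
  · refine key.2.congr_deriv ?_
    rw [← integral_const_mul]
    refine integral_congr_ae (ae_of_all _ fun x => ?_)
    simp only [hχT, neg_zero, zero_div, Real.exp_zero, Complex.ofReal_one, one_mul]
    linear_combination -(f x * χ x) * Complex.I_mul_I
  · rw [mem_ball_zero_iff, Real.norm_eq_abs, abs_lt] at hτ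
    by_cases hx : x ≤ R
    · rw [Set.indicator_of_mem (Set.mem_Iic.2 hx), norm_mul, norm_mul, norm_neg, Complex.norm_real,
        Real.norm_eq_abs, Real.abs_exp, mul_comm]
      gcongr
      · linarith
      · exact hM _
    · rw [Set.indicator_of_notMem (by simpa using hx), hB', mul_zero, mul_zero, norm_zero]
      have hx : R < x := not_le.1 hx
      have h1 : Real.exp (-1) * R = B := by
        rw [hR, ← mul_assoc, ← Real.exp_add]; simp
      have hx0 : 0 < x := hx0
      calc B = Real.exp (-1) * R := h1.symm
        _ < Real.exp (-1) * x := by gcongr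
        _ ≤ Real.exp (-τ) * x := by gcongr; linarith

theorem mem_weakGraph {T : (ℝ → ℂ) → ℝ → ℂ} {hT : ∀ φ, IsTest φ → IsTest (T φ)} {f g : L2} :
    (f, g) ∈ weakGraph T hT ↔
      ∀ φ, IsTest φ → ∫ x, f x * T φ x ∂μ = ∫ x, g x * φ x ∂μ := Iff.rfl

theorem hasDerivAt_integral_of_hasDerivAt {G : ℝ → L2} {g : L2} {t : ℝ} (h : HasDerivAt G g t)
    {φ : ℝ → ℂ} (hφ : IsTest φ) :
    HasDerivAt (fun τ => ∫ x, G τ x * φ x ∂μ) (∫ x, g x * φ x ∂μ) t := by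
  simp only [← pair_toLp _ hφ.memLp]
  exact ((pair.flip (hφ.memLp.toLp φ)).restrictScalars ℝ).hasFDerivAt.comp_hasDerivAt t h

theorem integral_smul_mul (c : ℂ) (g : L2) {φ : ℝ → ℂ} (hφ : IsTest φ) :
    ∫ x, (c • g) x * φ x ∂μ = c * ∫ x, g x * φ x ∂μ := by
  rw [← pair_toLp _ hφ.memLp, ← pair_toLp _ hφ.memLp, map_smul]
  rfl

/-- The candidate G(τ) = f + ∫₀^τ i U_s g ds is strongly differentiable. Paired with any test
function, U_τ f and G have the same derivative for all τ and the same value at 0, so they coincide.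
-/
theorem hasDerivAt_U_of_mem {f g : L2}
    (h : (f, g) ∈ weakGraph dilationTranspose IsTest.dilationTranspose) :
    HasDerivAt (fun τ : ℝ => U τ f) (Complex.I • g) 0 := by
  set G : ℝ → L2 := fun τ => f + ∫ s in (0 : ℝ)..τ, Complex.I • U s g with hG
  have hc : Continuous fun s => Complex.I • U s g := (continuous_U g).fun_const_smul _
  have hGd : ∀ t, HasDerivAt G (Complex.I • U t g) t := fun t =>
    (intervalIntegral.integral_hasDerivAt_right (hc.intervalIntegrable _ _)
      (hc.stronglyMeasurableAtFilter _ _) hc.continuousAt).const_add f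
  have hUd : ∀ φ, IsTest φ → ∀ t, HasDerivAt (fun τ => ∫ x, U τ f x * φ x ∂μ)
      (∫ x, (Complex.I • U t g) x * φ x ∂μ) t := by
    intro φ hφ t
    -- The group law transports the derivative at 0 to time t; the weak equation is then applied to
    -- the dilated test function, dilations commuting with the formal transpose.
    have h1 := hasDerivAt_integral_U_mul (U t f) hφ
    rw [← sub_self t] at h1
    have h2 := h1.comp_sub_const t t
    simp only [U_U, sub_add_cancel] at h2
    refine h2.congr_deriv ?_
    rw [integral_smul_mul _ _ hφ, integral_U_mul t f (IsTest.dilationTranspose φ hφ).memLp,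
      integral_U_mul t g hφ.memLp, ← h _ (hφ.dilate (-t))]
    simp only [dilationTranspose_dilate hφ]
  have hUG : (fun τ : ℝ => U τ f) = G := by
    ext1 τ
    rw [← sub_eq_zero]
    apply eq_zero_of_integral_test
    intro φ hφ
    have hd : ∀ t, HasDerivAt (fun τ => ∫ x, U τ f x * φ x ∂μ - ∫ x, G τ x * φ x ∂μ) 0 t := by
      intro t
      simpa using (hUd φ hφ t).fun_sub (hasDerivAt_integral_of_hasDerivAt (hGd t) hφ)
    have hconst := is_const_of_deriv_eq_zero (fun t => (hd t).differentiableAt)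
      (fun t => (hd t).deriv) τ 0
    have h0 : G 0 = f := by simp [hG]
    simp only [h0, U_zero, sub_self] at hconst
    rw [← hconst]
    simp only [← pair_toLp _ hφ.memLp, map_sub]
    rfl
  rw [hUG]
  simpa [U_zero] using hGd 0

theorem mem_A_graph_iff (f g : L2) :
    (f, g) ∈ A.graph ↔ HasDerivAt (fun τ : ℝ => U τ f) (Complex.I • g) 0 := by
  rw [A_graph]
  refine ⟨hasDerivAt_U_of_mem, fun h φ hφ => ?_⟩
  have := (hasDerivAt_integral_of_hasDerivAt h hφ).unique (hasDerivAt_integral_U_mul f hφ)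
  rw [integral_smul_mul _ _ hφ] at this
  exact (mul_left_cancel₀ Complex.I_ne_zero this).symm

/-- The inner product of U_τ f₁ and U_τ f₂ is constant in τ; its derivative at 0 gives the symmetry
of A. -/
theorem inner_eq_of_mem_A_graph {f₁ g₁ f₂ g₂ : L2} (h₁ : (f₁, g₁) ∈ A.graph)
    (h₂ : (f₂, g₂) ∈ A.graph) : inner ℂ g₁ f₂ = inner ℂ f₁ g₂ := by
  have hd := ((mem_A_graph_iff _ _).1 h₁).inner ℂ ((mem_A_graph_iff _ _).1 h₂)
  simp only [inner_U, U_zero, inner_smul_left, inner_smul_right, Complex.conj_I] at hd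
  have := hd.unique (hasDerivAt_const _ _)
  have h3 : Complex.I * (inner ℂ f₁ g₂ - inner ℂ g₁ f₂) = 0 := by linear_combination this
  exact (sub_eq_zero.1 ((mul_eq_zero.1 h3).resolve_left Complex.I_ne_zero)).symm

/-- Integration by parts against a test function. -/
theorem integral_mul_deriv_of_contDiffAt {w φ : ℝ → ℂ} (hw : ∀ x, 0 < x → ContDiffAt ℝ ∞ w x)
    (hφ : IsTest φ) : ∫ x, w x * deriv φ x ∂μ = -∫ x, deriv w x * φ x ∂μ := by
  have hw' : ∀ x, 0 < x → ContDiffAt ℝ ∞ (deriv w) x := fun x hx => (hw x hx).derivWithin (by simp)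
  have h1 := hφ.mul_left hw
  have h2 := hφ.deriv.mul_left hw
  have h3 := hφ.mul_left hw'
  have hint : ∀ {η : ℝ → ℂ}, IsTest η → Integrable η μ := fun hη =>
    (hη.contDiff.continuous.integrable_of_hasCompactSupport hη.compact).restrict
  have h0 : ∫ x, deriv (fun x => w x * φ x) x ∂μ = 0 := by
    have hz : ∫ x, deriv (fun x => w x * φ x) x ∂μ = ∫ x, deriv (fun x => w x * φ x) x :=
      setIntegral_eq_integral_of_forall_compl_eq_zero fun x hx =>
        image_eq_zero_of_notMem_tsupport fun hx' => hx (h1.deriv.supp hx')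
    rw [hz]
    exact integral_eq_zero_of_hasDerivAt_of_integrable
      (fun x => (h1.differentiable x).hasDerivAt)
      (h1.deriv.contDiff.continuous.integrable_of_hasCompactSupport h1.deriv.compact)
      (h1.contDiff.continuous.integrable_of_hasCompactSupport h1.compact)
  have hsum : ∫ x, deriv (fun x => w x * φ x) x ∂μ =
      ∫ x, (deriv w x * φ x + w x * deriv φ x) ∂μ := by
    refine setIntegral_congr_fun measurableSet_Ioi fun x hx => ?_
    exact (((hw x hx).differentiableAt (by simp)).hasDerivAt.fun_mul
      (hφ.differentiable x).hasDerivAt).deriv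
  rw [hsum, integral_add (hint h3) (hint h2)] at h0
  linear_combination h0

theorem mem_A_graph_of_contDiffAt {w v : ℝ → ℂ} (hw : ∀ x, 0 < x → ContDiffAt ℝ ∞ w x)
    (hv : ∀ x, 0 < x → v x = -(Complex.I * (x * deriv w x + w x / 2))) {f g : L2}
    (hf : f =ᵐ[μ] w) (hg : g =ᵐ[μ] v) : (f, g) ∈ A.graph := by
  rw [A_graph, mem_weakGraph]
  intro φ hφ
  have hint : ∀ {η : ℝ → ℂ}, IsTest η → Integrable η μ := fun hη =>
    (hη.contDiff.continuous.integrable_of_hasCompactSupport hη.compact).restrict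
  have hx : ∀ x : ℝ, 0 < x → ContDiffAt ℝ ∞ (fun y : ℝ => (y : ℂ) * w y) x := fun x hx =>
    Complex.ofRealCLM.contDiff.contDiffAt.mul (hw x hx)
  have hd : ∀ x : ℝ, 0 < x → deriv (fun y : ℝ => (y : ℂ) * w y) x = w x + x * deriv w x := by
    intro x hx
    have h1 : HasDerivAt (fun y : ℝ => (y : ℂ)) 1 x := Complex.ofRealCLM.hasDerivAt
    simpa using (h1.fun_mul ((hw x hx).differentiableAt (by simp)).hasDerivAt).deriv
  have hparts := integral_mul_deriv_of_contDiffAt hx hφ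
  have hx' : ∀ x, 0 < x → ContDiffAt ℝ ∞ (deriv fun y : ℝ => (y : ℂ) * w y) x :=
    fun x hx0 => (hx x hx0).derivWithin (by simp)
  calc ∫ x, f x * dilationTranspose φ x ∂μ
      = ∫ x, (Complex.I * ((x * w x) * deriv φ x) + Complex.I / 2 * (w x * φ x)) ∂μ := by
        refine integral_congr_ae ?_
        filter_upwards [hf] with x hx
        rw [hx, dilationTranspose_eq hφ.differentiable]
        ring
    _ = Complex.I * ∫ x, (x * w x) * deriv φ x ∂μ + Complex.I / 2 * ∫ x, w x * φ x ∂μ := by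
        rw [integral_add ((hint (hφ.deriv.mul_left hx)).const_mul _)
          ((hint (hφ.mul_left hw)).const_mul _), integral_const_mul, integral_const_mul]
    _ = ∫ x, (-Complex.I * (deriv (fun y : ℝ => (y : ℂ) * w y) x * φ x) +
          Complex.I / 2 * (w x * φ x)) ∂μ := by
        rw [hparts, integral_add ((hint (hφ.mul_left hx')).const_mul _)
          ((hint (hφ.mul_left hw)).const_mul _), integral_const_mul, integral_const_mul]
        ring
    _ = ∫ x, g x * φ x ∂μ := by
        refine integral_congr_ae ?_
        filter_upwards [hg, ae_restrict_mem measurableSet_Ioi] with x hx h0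
        rw [hx, hv x h0, hd x h0]
        ring

theorem IsTest.toLp_mem_A_graph {φ : ℝ → ℂ} (hφ : IsTest φ) :
    (hφ.memLp.toLp φ, ((IsTest.dilationTranspose φ hφ).smul (-1)).memLp.toLp _) ∈ A.graph :=
  mem_A_graph_of_contDiffAt (v := (-1 : ℂ) • HalfLine.dilationTranspose φ)
    (fun _ _ => hφ.contDiff.contDiffAt)
    (fun x _ => by simp [dilationTranspose_eq hφ.differentiable])
    (MemLp.coeFn_toLp _) (MemLp.coeFn_toLp _)

theorem IsTest.conj {φ : ℝ → ℂ} (hφ : IsTest φ) : IsTest fun x => (starRingEnd ℂ) (φ x) :=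
  ⟨Complex.conjCLE.contDiff.comp hφ.contDiff,
    hφ.compact.comp_left (g := (starRingEnd ℂ)) (map_zero _),
    (closure_mono fun x hx => by simpa using hx).trans hφ.supp⟩

theorem dilationTranspose_conj {φ : ℝ → ℂ} (hφ : IsTest φ) (x : ℝ) :
    dilationTranspose (fun x => (starRingEnd ℂ) (φ x)) x =
      -(starRingEnd ℂ) (dilationTranspose φ x) := by
  rw [dilationTranspose_eq hφ.differentiable, dilationTranspose_eq hφ.conj.differentiable]
  have h : deriv (fun x => (starRingEnd ℂ) (φ x)) x = (starRingEnd ℂ) (deriv φ x) :=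
    (hφ.differentiable x).hasDerivAt.star.deriv
  have h2 : (starRingEnd ℂ) (2 : ℂ) = 2 := Complex.conj_ofNat 2
  simp only [h, map_mul, map_add, map_div₀, Complex.conj_I, Complex.conj_ofReal, h2]
  ring

theorem inner_toLp_conj (f : L2) {φ : ℝ → ℂ}
    (hφ : MemLp (fun x => (starRingEnd ℂ) (φ x)) 2 μ) :
    inner ℂ f (hφ.toLp _) = (starRingEnd ℂ) (∫ x, f x * φ x ∂μ) := by
  rw [L2.inner_def, ← integral_conj]
  refine integral_congr_ae ?_
  filter_upwards [hφ.coeFn_toLp] with x hx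
  rw [hx, RCLike.inner_apply, map_mul]
  ring

theorem dense_A_domain : Dense (A.domain : Set L2) := by
  rw [Submodule.dense_iff_topologicalClosure_eq_top, Submodule.topologicalClosure_eq_top_iff,
    Submodule.eq_bot_iff]
  intro f hf
  refine eq_zero_of_integral_test fun φ hφ => ?_
  have h1 := (Submodule.mem_orthogonal' _ _).1 hf _
    (LinearPMap.mem_domain_of_mem_graph hφ.conj.toLp_mem_A_graph)
  rw [inner_toLp_conj] at h1
  exact (map_eq_zero _).1 h1

/-- Testing the adjoint relation only on conjugates of test functions recovers the weak definition
of A, so A* ⊆ A. The opposite inclusion is symmetry. -/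
theorem isSelfAdjoint_A : IsSelfAdjoint A := by
  rw [LinearPMap.isSelfAdjoint_def]
  refine le_antisymm (LinearPMap.le_of_le_graph ?_)
    (LinearPMap.IsFormalAdjoint.le_adjoint dense_A_domain ?_)
  · rintro ⟨y, w⟩ h
    obtain ⟨y', hy, hw⟩ := (LinearPMap.mem_graph_iff _).1 h
    rw [A_graph]
    intro φ hφ
    have hm := hφ.conj.toLp_mem_A_graph
    obtain ⟨x', hx, hAx⟩ := (LinearPMap.mem_graph_iff _).1 hm
    have h1 := LinearPMap.adjoint_isFormalAdjoint dense_A_domain y' x'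
    simp only at hy hw hx hAx
    rw [hw, hx, hAx, hy, inner_toLp_conj] at h1
    have h2 : MemLp (fun x => (starRingEnd ℂ) (dilationTranspose φ x)) 2 μ :=
      (IsTest.dilationTranspose φ hφ).conj.memLp
    have h3 : (((IsTest.dilationTranspose _ hφ.conj).smul (-1)).memLp.toLp _ : L2) =
        h2.toLp _ := by
      congr 1
      ext x
      simp [dilationTranspose_conj hφ]
    rw [h3, inner_toLp_conj] at h1
    exact ((starRingEnd ℂ).injective h1).symm
  · intro x y
    exact inner_eq_of_mem_A_graph (A.mem_graph x) (A.mem_graph y)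

/-- Differentiate F U_τ f = U_{-τ} F f at τ = 0. -/
theorem hankel_mem_A_graph {m : ℂ} (hm : -1 < m.re) {f g : L2} (h : (f, g) ∈ A.graph) :
    (hankel hm f, -hankel hm g) ∈ A.graph := by
  rw [mem_A_graph_iff] at h ⊢
  have h1 := ((hankel hm).restrictScalars ℝ).hasFDerivAt.comp_hasDerivAt (0 : ℝ) h
  have h2 : ((hankel hm).restrictScalars ℝ : L2 → L2) ∘ (fun τ : ℝ => U τ f) =
      fun τ => U (-τ) (hankel hm f) := by
    ext1 τ
    exact hankel_U hm τ f
  rw [h2, ← neg_zero] at h1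
  have h3 := h1.scomp (0 : ℝ) (hasDerivAt_neg 0)
  simpa [Function.comp_def] using h3

/-! ### The Hankel kernel -/

/-- The Gamma integral in the variable t = x². -/
theorem integral_cpow_mul_exp_neg_mul_sq {s : ℂ} (hs : 0 < s.re) {B : ℝ} (hB : 0 < B) :
    ∫ x, (x : ℂ) ^ (2 * s - 1) * (Real.exp (-(B * x ^ 2)) : ℝ) ∂μ =
      1 / 2 * ((1 / B : ℂ) ^ s * Complex.Gamma s) := by
  have h1 := Complex.integral_cpow_mul_exp_neg_mul_Ioi (a := s) hs hB
  have h2 := integral_comp_rpow_Ioi_of_pos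
    (g := fun t : ℝ => (t : ℂ) ^ (s - 1) * Complex.exp (-(B * t))) (p := 2) (by norm_num)
  rw [h1] at h2
  rw [← h2, ← integral_const_mul]
  refine setIntegral_congr_fun measurableSet_Ioi fun x hx => ?_
  have hx : 0 < x := hx
  have hxc : (x : ℂ) ≠ 0 := by exact_mod_cast hx.ne'
  have e1 : ((x ^ (2 : ℝ) : ℝ) : ℂ) ^ (s - 1) = (x : ℂ) ^ (2 * s - 2) := by
    rw [Real.rpow_two, Complex.ofReal_pow, ← Complex.cpow_nat_mul' (n := 2)]
    · congr 1
      push_cast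
      ring
    · rw [Complex.arg_ofReal_of_nonneg hx.le]
      simpa using Real.pi_pos
    · rw [Complex.arg_ofReal_of_nonneg hx.le]
      simpa using Real.pi_pos.le
  have e2 : (x : ℂ) ^ (2 * s - 1) = (x : ℂ) ^ (2 * s - 2) * x := by
    rw [show 2 * s - 1 = (2 * s - 2) + 1 by ring, Complex.cpow_add _ _ hxc, Complex.cpow_one]
  rw [Complex.real_smul, e1, e2, show (2 : ℝ) - 1 = 1 by norm_num, Real.rpow_one, Real.rpow_two]
  push_cast
  ring

theorem exists_norm_inv_Gamma_le {m : ℂ} (hm : -1 < m.re) :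
    ∃ C : ℝ, 0 ≤ C ∧ ∀ j : ℕ, ‖(Complex.Gamma (m + j + 1))⁻¹‖ ≤ C := by
  have hne : ∀ j : ℕ, 0 < ‖Complex.Gamma (m + j + 1)‖ := fun j => norm_pos_iff.2
    (Complex.Gamma_ne_zero_of_re_pos (by
      simp only [Complex.add_re, Complex.natCast_re, Complex.one_re]
      have : (0 : ℝ) ≤ j := j.cast_nonneg
      linarith))
  -- From j = 1 on the modulus does not decrease, because the factor in the functional equation has
  -- real part at least 1. At j = 0 that factor m + 1 may be small, so this value is kept apart.
  set c := min ‖Complex.Gamma (m + (0 : ℕ) + 1)‖ ‖Complex.Gamma (m + (1 : ℕ) + 1)‖ with hc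
  have hcpos : 0 < c := lt_min (hne 0) (hne 1)
  have hle : ∀ j : ℕ, c ≤ ‖Complex.Gamma (m + (j + 1 : ℕ) + 1)‖ := by
    intro j
    induction j with
    | zero => exact min_le_right _ _
    | succ j ih =>
      have hre : 1 ≤ (m + (j + 1 : ℕ) + 1).re := by
        simp only [Complex.add_re, Complex.natCast_re, Complex.one_re]
        push_cast
        have : (0 : ℝ) ≤ j := j.cast_nonneg
        linarith
      have hz : m + (j + 1 : ℕ) + 1 ≠ 0 := fun h => by
        rw [h] at hre
        simp at hre
        linarith
      have : m + (j + 1 + 1 : ℕ) + 1 = (m + (j + 1 : ℕ) + 1) + 1 := by push_cast; ring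
      rw [this, Complex.Gamma_add_one _ hz, norm_mul]
      calc c ≤ ‖Complex.Gamma (m + (j + 1 : ℕ) + 1)‖ := ih
        _ ≤ _ := le_mul_of_one_le_left (norm_nonneg _) (hre.trans (Complex.re_le_norm _))
  refine ⟨c⁻¹, by positivity, fun j => ?_⟩
  rw [norm_inv]
  gcongr
  cases j with
  | zero => exact min_le_left _ _
  | succ j => exact hle j

/-- The coefficients of the power series of `(z/2)^{-m} J_m(z)` in the variable `(z/2)²`. -/
def besselCoeff (m : ℂ) (j : ℕ) : ℂ :=
  (-1) ^ j / (j.factorial * Complex.Gamma (m + j + 1))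

/-- The entire function `(z/2)^{-m} J_m(z)`. -/
def besselEntire (m : ℂ) (z : ℝ) : ℂ :=
  ∑' j : ℕ, besselCoeff m j * (((z / 2) ^ 2) ^ j : ℝ)

theorem exists_norm_besselCoeff_le {m : ℂ} (hm : -1 < m.re) :
    ∃ C : ℝ, 0 ≤ C ∧ ∀ j : ℕ, ‖besselCoeff m j‖ ≤ C * (1 / j.factorial) := by
  obtain ⟨C, hC0, hC⟩ := exists_norm_inv_Gamma_le hm
  refine ⟨C, hC0, fun j => ?_⟩
  have := hC j
  rw [norm_inv] at this
  rw [besselCoeff, norm_div, norm_mul, norm_pow, norm_neg, norm_one, one_pow, Complex.norm_natCast,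
    one_div, mul_inv, mul_comm, one_div]
  gcongr

theorem hasSum_exp_series (y : ℝ) : HasSum (fun j : ℕ => 1 / (j.factorial : ℝ) * y ^ j)
    (Real.exp y) := by
  rw [Real.exp_eq_exp_ℝ]
  simpa [div_eq_inv_mul] using NormedSpace.expSeries_div_hasSum_exp y

theorem summable_besselEntire {m : ℂ} (hm : -1 < m.re) (z : ℝ) :
    Summable fun j : ℕ => besselCoeff m j * (((z / 2) ^ 2) ^ j : ℝ) := by
  obtain ⟨C, hC0, hC⟩ := exists_norm_besselCoeff_le hm
  refine Summable.of_norm_bounded ((hasSum_exp_series ((z / 2) ^ 2)).summable.mul_left C)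
    fun j => ?_
  rw [norm_mul, Complex.norm_real, Real.norm_of_nonneg (by positivity), ← mul_assoc]
  gcongr
  exact hC j

theorem exists_norm_besselEntire_le {m : ℂ} (hm : -1 < m.re) :
    ∃ C : ℝ, 0 ≤ C ∧ ∀ z : ℝ, ‖besselEntire m z‖ ≤ C * Real.exp ((z / 2) ^ 2) := by
  obtain ⟨C, hC0, hC⟩ := exists_norm_besselCoeff_le hm
  refine ⟨C, hC0, fun z => ?_⟩
  refine tsum_of_norm_bounded ((hasSum_exp_series ((z / 2) ^ 2)).mul_left C) fun j => ?_
  rw [norm_mul, Complex.norm_real, Real.norm_of_nonneg (by positivity), ← mul_assoc]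
  gcongr
  exact hC j

theorem measurable_besselEntire {m : ℂ} (hm : -1 < m.re) : Measurable (besselEntire m) := by
  refine measurable_of_tendsto_metrizable (f := fun (n : ℕ) (z : ℝ) =>
    ∑ j ∈ Finset.range n, besselCoeff m j * (((z / 2) ^ 2) ^ j : ℝ)) (fun n => ?_) ?_
  · exact Continuous.measurable (by fun_prop)
  · exact tendsto_pi_nhds.2 fun z => (summable_besselEntire hm z).hasSum.tendsto_sum_nat

/-- A measurable version of `z ↦ J_m(z) √z`. -/
def kernelFun (m : ℂ) (z : ℝ) : ℂ :=
  (2 : ℂ) ^ (-m) * (z : ℂ) ^ (m + 1 / 2) * besselEntire m z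

theorem measurable_kernelFun {m : ℂ} (hm : -1 < m.re) : Measurable (kernelFun m) :=
  ((Complex.measurable_ofReal.pow_const _).const_mul _).mul (measurable_besselEntire hm)

theorem hankelKernel_eq (m : ℂ) {k x : ℝ} (hk : 0 < k) (hx : 0 < x) :
    hankelKernel m k x = kernelFun m (k * x) := by
  have hz : 0 < k * x := mul_pos hk hx
  generalize hzz : k * x = z at *
  have hzc : (z : ℂ) ≠ 0 := by exact_mod_cast hz.ne'
  rw [hankelKernel, hzz, besselJ, kernelFun, besselEntire, ← tsum_mul_left, ← tsum_mul_right]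
  congr 1
  ext j
  have h2 : ((z : ℂ) / 2) = ((z / 2 : ℝ) : ℂ) := by push_cast; rfl
  have hne : ((z / 2 : ℝ) : ℂ) ≠ 0 := by exact_mod_cast (half_pos hz).ne'
  have e1 : ((z : ℂ) / 2) ^ (2 * (j : ℂ) + m) =
      (((z / 2) ^ 2) ^ j : ℝ) * ((2 : ℂ) ^ (-m) * (z : ℂ) ^ m) := by
    rw [h2, Complex.cpow_add _ _ hne]
    congr 1
    · rw [← pow_mul]
      have : (2 * (j : ℂ)) = ((2 * j : ℕ) : ℂ) := by push_cast; rfl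
      rw [this, Complex.cpow_natCast]
      push_cast
      rfl
    · rw [div_eq_inv_mul, Complex.ofReal_mul, Complex.mul_cpow_ofReal_nonneg (by norm_num) hz.le,
        Complex.ofReal_inv, Complex.inv_cpow, Complex.cpow_neg]
      · norm_num
      · rw [Complex.arg_ofReal_of_nonneg (by norm_num)]
        exact Real.pi_pos.ne
  have e2 : ((Real.sqrt z : ℝ) : ℂ) = (z : ℂ) ^ (1 / 2 : ℂ) := by
    rw [Real.sqrt_eq_rpow, Complex.ofReal_cpow hz.le]
    norm_num
  rw [e1, e2, Complex.cpow_add _ _ hzc, besselCoeff]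
  ring

theorem exists_norm_kernelFun_le {m : ℂ} (hm : -1 < m.re) :
    ∃ C : ℝ, 0 ≤ C ∧ ∀ z : ℝ, 0 < z →
      ‖kernelFun m z‖ ≤ C * z ^ (m.re + 1 / 2) * Real.exp ((z / 2) ^ 2) := by
  obtain ⟨C, hC0, hC⟩ := exists_norm_besselEntire_le hm
  refine ⟨‖(2 : ℂ) ^ (-m)‖ * C, by positivity, fun z hz => ?_⟩
  rw [kernelFun, norm_mul, norm_mul, Complex.norm_cpow_eq_rpow_re_of_pos hz]
  have : (m + 1 / 2).re = m.re + 1 / 2 := by simp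
  rw [this]
  calc _ ≤ ‖(2 : ℂ) ^ (-m)‖ * z ^ (m.re + 1 / 2) * (C * Real.exp ((z / 2) ^ 2)) := by
        gcongr
        exact hC z
    _ = _ := by ring

theorem integrable_norm_gauss_sq {m : ℂ} (hm : -1 < m.re) (u : ℝ) :
    Integrable (fun x => ‖gauss m u x‖ ^ 2) μ :=
  (memLp_two_iff_integrable_sq_norm (aestronglyMeasurable_gauss m u)).1 (memLp_gauss hm u)

/-- The termwise bound exp((kR/2)²) on the kernel ignores all cancellation in the Bessel series. A
Gaussian with e^u ≥ R² + 2 absorbs it and leaves exp(-k²). Hence only large u are used to identify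
the kernel. -/
theorem gauss_growth (m : ℂ) {u R k : ℝ} (hu : R ^ 2 + 2 ≤ Real.exp u) (hk : 0 < k) :
    k ^ (m.re + 1 / 2) * Real.exp ((k * R / 2) ^ 2) * ‖gauss m u k‖ ≤
      Real.exp ((m.re + 1) * u / 2) * ‖gauss m 0 k‖ ^ 2 := by
  rw [norm_gauss m u hk, norm_gauss m 0 hk]
  have h1 : Real.exp ((k * R / 2) ^ 2) * Real.exp (-(Real.exp u * k ^ 2 / 2)) ≤
      Real.exp (-(Real.exp 0 * k ^ 2 / 2)) ^ 2 := by
    rw [← Real.exp_add, ← Real.exp_nat_mul]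
    refine Real.exp_le_exp.2 ?_
    have h2 : (R ^ 2 + 2) * k ^ 2 ≤ Real.exp u * k ^ 2 := by gcongr
    rw [Real.exp_zero]
    push_cast
    nlinarith [sq_nonneg (R * k)]
  have h2 : 0 ≤ Real.exp ((m.re + 1) * u / 2) * (k ^ (m.re + 1 / 2)) ^ 2 := by positivity
  calc _ = Real.exp ((m.re + 1) * u / 2) * (k ^ (m.re + 1 / 2)) ^ 2 *
        (Real.exp ((k * R / 2) ^ 2) * Real.exp (-(Real.exp u * k ^ 2 / 2))) := by ring
    _ ≤ Real.exp ((m.re + 1) * u / 2) * (k ^ (m.re + 1 / 2)) ^ 2 *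
        Real.exp (-(Real.exp 0 * k ^ 2 / 2)) ^ 2 := mul_le_mul_of_nonneg_left h1 h2
    _ = _ := by simp; ring

/-- Each term of the Bessel series integrates to a Gamma integral whose value Γ(m+j+1) cancels the
denominator of the coefficient; what remains is the exponential series at -e^{-u}x²/2. -/
theorem integral_kernelFun_mul_gauss {m : ℂ} (hm : -1 < m.re) {u x : ℝ} (hx : 0 < x)
    (hu : x ^ 2 + 2 ≤ Real.exp u) :
    ∫ k, kernelFun m (k * x) * gauss m u k ∂μ = gauss m (-u) x := by
  obtain ⟨C, hC0, hC⟩ := exists_norm_besselCoeff_le hm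
  set F : ℕ → ℝ → ℂ := fun j k => (2 : ℂ) ^ (-m) * ((k * x : ℝ) : ℂ) ^ (m + 1 / 2) *
    (besselCoeff m j * ((((k * x) / 2) ^ 2) ^ j : ℝ)) * gauss m u k with hF
  have hxc : (x : ℂ) ≠ 0 := by exact_mod_cast hx.ne'
  have hBpos : 0 < Real.exp u / 2 := by positivity
  have hsum := hasSum_integral_of_dominated_convergence (μ := μ) (F := F)
    (f := fun k => kernelFun m (k * x) * gauss m u k)
    (fun j k => ‖(2 : ℂ) ^ (-m) * ((k * x : ℝ) : ℂ) ^ (m + 1 / 2)‖ *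
      (C * (1 / j.factorial * ((k * x / 2) ^ 2) ^ j)) * ‖gauss m u k‖)
    (fun j => ?_) (fun j => ae_of_all _ fun k => ?_) (ae_of_all _ fun k => ?_) ?_
    (ae_of_all _ fun k => ?_)
  · have hval : ∀ j, ∫ k, F j k ∂μ = Complex.exp ((m + 1) * (-u : ℝ) / 2) * (x : ℂ) ^ (m + 1 / 2) *
        (1 / j.factorial * (-(Real.exp (-u) * x ^ 2 / 2 : ℝ) : ℂ) ^ j) := by
      intro j
      have hs : 0 < (m + j + 1).re := by
        simp only [Complex.add_re, Complex.natCast_re, Complex.one_re]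
        have : (0 : ℝ) ≤ j := j.cast_nonneg
        linarith
      have hcongr : ∫ k, F j k ∂μ = ∫ k, ((2 : ℂ) ^ (-m) * (x : ℂ) ^ (m + 1 / 2) * besselCoeff m j *
          ((x / 2) ^ 2) ^ j * Complex.exp ((m + 1) * u / 2)) *
          ((k : ℂ) ^ (2 * (m + j + 1) - 1) * (Real.exp (-(Real.exp u / 2 * k ^ 2)) : ℝ)) ∂μ := by
        refine setIntegral_congr_fun measurableSet_Ioi fun k hk => ?_
        have hk : 0 < k := hk
        have hkc : (k : ℂ) ≠ 0 := by exact_mod_cast hk.ne'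
        simp only [hF, gauss]
        rw [Complex.ofReal_mul, Complex.mul_cpow_ofReal_nonneg hk.le hx.le,
          show 2 * (m + j + 1) - 1 = (m + 1 / 2) + (m + 1 / 2) + ((2 * j : ℕ) : ℂ) by
            push_cast; ring,
          Complex.cpow_add (m + 1 / 2 + (m + 1 / 2)) _ hkc,
          Complex.cpow_add (m + 1 / 2) (m + 1 / 2) hkc, Complex.cpow_natCast,
          show Real.exp u * k ^ 2 / 2 = Real.exp u / 2 * k ^ 2 by ring]
        push_cast
        rw [pow_mul]
        ring
      have hB : (1 / ((Real.exp u / 2 : ℝ) : ℂ)) ^ (m + j + 1) =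
          2 ^ m * 2 * Complex.exp (-u * (m + 1)) * (2 * Real.exp (-u) : ℝ) ^ j := by
        have hq : (1 / ((Real.exp u / 2 : ℝ) : ℂ)) = ((2 * Real.exp (-u) : ℝ) : ℂ) := by
          rw [Real.exp_neg]
          push_cast
          field_simp
        have hqne : ((2 * Real.exp (-u) : ℝ) : ℂ) ≠ 0 := by
          exact_mod_cast (by positivity : 2 * Real.exp (-u) ≠ 0)
        rw [hq, show m + (j : ℂ) + 1 = (m + 1) + (j : ℂ) by ring, Complex.cpow_add _ _ hqne,
          Complex.cpow_natCast, Complex.ofReal_mul, Complex.mul_cpow_ofReal_nonneg (by norm_num)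
          (Real.exp_pos _).le]
        have h3 : ((Real.exp (-u) : ℝ) : ℂ) ^ (m + 1) = Complex.exp (-u * (m + 1)) := by
          rw [Complex.cpow_def_of_ne_zero (by exact_mod_cast (Real.exp_pos _).ne'),
            ← Complex.ofReal_log (Real.exp_pos _).le, Real.log_exp]
          push_cast
          rfl
        rw [h3, Complex.cpow_add _ _ (by norm_num)]
        push_cast
        simp
      rw [hcongr, integral_const_mul, integral_cpow_mul_exp_neg_mul_sq hs hBpos, hB, besselCoeff]
      have hG := Complex.Gamma_ne_zero_of_re_pos hs
      have hfac : (j.factorial : ℂ) ≠ 0 := by exact_mod_cast j.factorial_ne_zero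
      have h2m : (2 : ℂ) ^ (-m) * 2 ^ m = 1 := by
        rw [← Complex.cpow_add _ _ (by norm_num)]
        simp
      have hexp : Complex.exp ((m + 1) * u / 2) * Complex.exp (-u * (m + 1)) =
          Complex.exp ((m + 1) * (-u : ℝ) / 2) := by
        rw [← Complex.exp_add]
        congr 1
        push_cast
        ring
      have hpow : (-1 : ℂ) ^ j * (((x : ℂ) / 2) ^ 2) ^ j * ((2 * Real.exp (-u) : ℝ) : ℂ) ^ j =
          (-(Real.exp (-u) * x ^ 2 / 2 : ℝ) : ℂ) ^ j := by
        rw [← mul_pow, ← mul_pow]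
        congr 1
        push_cast
        ring
      rw [← hexp, ← hpow]
      field_simp
      linear_combination (x : ℂ) ^ ((m * 2 + 1) / 2) * h2m
    simp only [hval] at hsum
    have hexp : HasSum (fun j : ℕ => 1 / (j.factorial : ℂ) *
        (-(Real.exp (-u) * x ^ 2 / 2 : ℝ) : ℂ) ^ j)
        (Real.exp (-(Real.exp (-u) * x ^ 2 / 2)) : ℝ) := by
      have := Complex.hasSum_ofReal.2 (hasSum_exp_series (-(Real.exp (-u) * x ^ 2 / 2)))
      refine this.congr_fun fun j => ?_
      push_cast
      rfl
    exact hsum.unique (hexp.mul_left _)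
  · refine AEStronglyMeasurable.mul (Measurable.aestronglyMeasurable ?_)
      (aestronglyMeasurable_gauss m u)
    exact (((Complex.measurable_ofReal.comp (measurable_id.mul_const x)).pow_const _).const_mul
      _).mul (Continuous.measurable (by fun_prop))
  · simp only [hF]
    rw [norm_mul, norm_mul _ (besselCoeff m j * _), norm_mul (besselCoeff m j), Complex.norm_real,
      Real.norm_of_nonneg (by positivity), ← mul_assoc C]
    gcongr
    exact hC j
  · exact (((hasSum_exp_series _).summable.mul_left C).mul_left _).mul_right _
  · have htsum : ∀ k : ℝ, ∑' j : ℕ, ‖(2 : ℂ) ^ (-m) * ((k * x : ℝ) : ℂ) ^ (m + 1 / 2)‖ *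
        (C * (1 / j.factorial * ((k * x / 2) ^ 2) ^ j)) * ‖gauss m u k‖ =
        ‖(2 : ℂ) ^ (-m) * ((k * x : ℝ) : ℂ) ^ (m + 1 / 2)‖ *
        (C * Real.exp ((k * x / 2) ^ 2)) * ‖gauss m u k‖ := fun k =>
      ((((hasSum_exp_series _).mul_left C).mul_left _).mul_right _).tsum_eq
    simp only [htsum]
    refine ((integrable_norm_gauss_sq hm 0).const_mul (‖(2 : ℂ) ^ (-m)‖ * C * x ^ (m.re + 1 / 2) *
      Real.exp ((m.re + 1) * u / 2))).mono' ?_ ?_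
    · refine AEStronglyMeasurable.mul (Measurable.aestronglyMeasurable ?_)
        (aestronglyMeasurable_gauss m u).norm
      exact (((Complex.measurable_ofReal.comp (measurable_id.mul_const x)).pow_const _).const_mul
        _).norm.mul (Continuous.measurable (by fun_prop))
    · filter_upwards [ae_restrict_mem measurableSet_Ioi] with k hk
      have hk : 0 < k := hk
      rw [Real.norm_of_nonneg (by positivity), norm_mul,
        Complex.norm_cpow_eq_rpow_re_of_pos (mul_pos hk hx), Real.mul_rpow hk.le hx.le]
      have hre : (m + 1 / 2).re = m.re + 1 / 2 := by simp
      rw [hre]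
      have := mul_le_mul_of_nonneg_left (gauss_growth m hu hk)
        (by positivity : 0 ≤ ‖(2 : ℂ) ^ (-m)‖ * C * x ^ (m.re + 1 / 2))
      calc _ = _ := by ring
        _ ≤ _ := this
        _ = _ := by ring
  · simp only [hF]
    exact ((summable_besselEntire hm (k * x)).hasSum.mul_left _).mul_right _

/-! ### Identification of the truncated Hankel integrals -/

/-- The restriction of `f` to `]0,R]`. -/
def truncVec (R : ℝ) (f : L2) : L2 :=
  ((Lp.memLp f).indicator (measurableSet_Iic (a := R))).toLp _

theorem coeFn_truncVec (R : ℝ) (f : L2) : truncVec R f =ᵐ[μ] (Set.Iic R).indicator f :=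
  MemLp.coeFn_toLp _

theorem norm_sq_eq_integral (f : L2) : ‖f‖ ^ 2 = ∫ x, ‖f x‖ ^ 2 ∂μ := by
  have h := inner_self_eq_norm_sq_to_K (𝕜 := ℂ) f
  rw [L2.inner_def] at h
  have h2 : ∫ x, inner ℂ (f x) (f x) ∂μ = ((∫ x, ‖f x‖ ^ 2 ∂μ : ℝ) : ℂ) := by
    rw [← integral_complex_ofReal]
    refine integral_congr_ae (ae_of_all _ fun x => ?_)
    simp only [inner_self_eq_norm_sq_to_K]
    norm_cast
  rw [h2] at h
  refine Complex.ofReal_injective (Eq.trans ?_ h.symm)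
  push_cast
  rfl

theorem tendsto_truncVec (f : L2) : Tendsto (fun R => truncVec R f) atTop (𝓝 f) := by
  rw [tendsto_iff_norm_sub_tendsto_zero]
  have hcongr : ∀ R, ‖truncVec R f - f‖ ^ 2 =
      ∫ x, (Set.Ioi R).indicator (fun x => ‖f x‖ ^ 2) x ∂μ := by
    intro R
    rw [norm_sq_eq_integral]
    refine integral_congr_ae ?_
    filter_upwards [coeFn_truncVec R f, Lp.coeFn_sub (truncVec R f) f] with x h1 h2
    rw [h2, Pi.sub_apply, h1]
    by_cases hx : x ≤ R
    · rw [Set.indicator_of_mem (Set.mem_Iic.2 hx), Set.indicator_of_notMem (by simpa using hx)]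
      simp
    · rw [Set.indicator_of_notMem (by simpa using hx), Set.indicator_of_mem (by simpa using hx)]
      simp
  have hi : Integrable (fun x => ‖f x‖ ^ 2) μ :=
    (memLp_two_iff_integrable_sq_norm (Lp.aestronglyMeasurable f)).1 (Lp.memLp f)
  have hlim : Tendsto (fun R => ‖truncVec R f - f‖ ^ 2) atTop (𝓝 0) := by
    simp only [hcongr]
    have := tendsto_integral_filter_of_dominated_convergence (μ := μ) (l := atTop)
      (F := fun R x => (Set.Ioi R).indicator (fun x => ‖f x‖ ^ 2) x) (f := fun _ => 0)
      (fun x => ‖f x‖ ^ 2)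
      (Eventually.of_forall fun R => hi.aestronglyMeasurable.indicator measurableSet_Ioi)
      (Eventually.of_forall fun R => ae_of_all _ fun x => ?_) hi (ae_of_all _ fun x => ?_)
    · simpa using this
    · refine (norm_indicator_le_norm_self _ _).trans (le_of_eq ?_)
      rw [Real.norm_of_nonneg (by positivity)]
    · refine tendsto_const_nhds.congr' ?_
      filter_upwards [eventually_ge_atTop x] with R hR
      rw [Set.indicator_of_notMem (by simpa using hR)]
  have := (Real.continuous_sqrt.tendsto 0).comp hlim
  simpa [Function.comp_def, Real.sqrt_sq (norm_nonneg _)] using this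

theorem rpow_le_norm_gauss (m : ℂ) {x R : ℝ} (hx : 0 < x) (hxR : x ≤ R) :
    x ^ (m.re + 1 / 2) ≤ Real.exp (R ^ 2 / 2) * ‖gauss m 0 x‖ := by
  rw [norm_gauss m 0 hx]
  have h1 : 1 ≤ Real.exp (R ^ 2 / 2) * Real.exp (-(Real.exp 0 * x ^ 2 / 2)) := by
    rw [← Real.exp_add, Real.exp_zero]
    refine Real.one_le_exp ?_
    nlinarith
  have h2 : 0 ≤ x ^ (m.re + 1 / 2) := by positivity
  calc x ^ (m.re + 1 / 2) = x ^ (m.re + 1 / 2) * 1 := (mul_one _).symm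
    _ ≤ x ^ (m.re + 1 / 2) * (Real.exp (R ^ 2 / 2) * Real.exp (-(Real.exp 0 * x ^ 2 / 2))) := by
      gcongr
    _ = _ := by simp; ring

/-- For x ≤ R the dependence on x is dominated by a fixed square integrable function, so products
with f are integrable by Cauchy–Schwarz, also when x^{m+1/2} is singular at 0. -/
theorem exists_norm_kernelFun_mul_le {m : ℂ} (hm : -1 < m.re) (R : ℝ) :
    ∃ C : ℝ, 0 ≤ C ∧ ∀ k x : ℝ, 0 < k → 0 < x → x ≤ R → ‖kernelFun m (k * x)‖ ≤
      C * (k ^ (m.re + 1 / 2) * Real.exp ((k * R / 2) ^ 2)) * ‖gauss m 0 x‖ := by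
  obtain ⟨C, hC0, hC⟩ := exists_norm_kernelFun_le hm
  refine ⟨C * Real.exp (R ^ 2 / 2), by positivity, fun k x hk hx hxR => ?_⟩
  refine (hC _ (mul_pos hk hx)).trans ?_
  rw [Real.mul_rpow hk.le hx.le]
  calc _ ≤ C * (k ^ (m.re + 1 / 2) * (Real.exp (R ^ 2 / 2) * ‖gauss m 0 x‖)) *
        Real.exp ((k * R / 2) ^ 2) := by
        gcongr
        exact rpow_le_norm_gauss m hx hxR
    _ = _ := by ring

theorem integrable_norm_gauss_mul_norm {m : ℂ} (hm : -1 < m.re) (f : L2) :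
    Integrable (fun x => ‖gauss m 0 x‖ * ‖f x‖) μ := by
  simpa using ((memLp_gauss hm 0).integrable_mul (Lp.memLp f)).norm

theorem integrable_kernelFun_mul_truncVec {m : ℂ} (hm : -1 < m.re) (f : L2) (R : ℝ) {k : ℝ}
    (hk : 0 < k) : Integrable (fun x => kernelFun m (k * x) * truncVec R f x) μ := by
  obtain ⟨C, hC0, hC⟩ := exists_norm_kernelFun_mul_le hm R
  refine ((integrable_norm_gauss_mul_norm hm (truncVec R f)).const_mul
    (C * (k ^ (m.re + 1 / 2) * Real.exp ((k * R / 2) ^ 2)))).mono' ?_ ?_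
  · exact (((measurable_kernelFun hm).comp (measurable_const_mul k)).aestronglyMeasurable).mul
      (Lp.aestronglyMeasurable _)
  · filter_upwards [coeFn_truncVec R f, ae_restrict_mem measurableSet_Ioi] with x h1 hx
    rw [norm_mul, ← mul_assoc]
    by_cases hxR : x ≤ R
    · gcongr
      exact hC k x hk hx hxR
    · rw [h1, Set.indicator_of_notMem (by simpa using hxR)]
      simp

theorem integrable_kernelFun_mul_gauss_prod {m : ℂ} (hm : -1 < m.re) (f : L2) {R u : ℝ}
    (hu : R ^ 2 + 2 ≤ Real.exp u) :
    Integrable (fun p : ℝ × ℝ => kernelFun m (p.1 * p.2) * truncVec R f p.2 * gauss m u p.1)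
      (μ.prod μ) := by
  obtain ⟨C, hC0, hC⟩ := exists_norm_kernelFun_mul_le hm R
  refine (((integrable_norm_gauss_sq hm 0).const_mul (C * Real.exp ((m.re + 1) * u / 2))).mul_prod
    (integrable_norm_gauss_mul_norm hm (truncVec R f))).mono' ?_ ?_
  · exact (((measurable_kernelFun hm).comp (by fun_prop)).aestronglyMeasurable.mul
      (Lp.aestronglyMeasurable (truncVec R f)).comp_snd).mul (aestronglyMeasurable_gauss m u).comp_fst
  · have h1 : ∀ᵐ p ∂(μ.prod μ), truncVec R f p.2 = (Set.Iic R).indicator f p.2 :=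
      Measure.quasiMeasurePreserving_snd.ae (coeFn_truncVec R f)
    have h2 : ∀ᵐ p : ℝ × ℝ ∂(μ.prod μ), p.1 ∈ Set.Ioi (0 : ℝ) :=
      Measure.quasiMeasurePreserving_fst.ae (ae_restrict_mem measurableSet_Ioi)
    have h3 : ∀ᵐ p : ℝ × ℝ ∂(μ.prod μ), p.2 ∈ Set.Ioi (0 : ℝ) :=
      Measure.quasiMeasurePreserving_snd.ae (ae_restrict_mem measurableSet_Ioi)
    filter_upwards [h1, h2, h3] with p h1 hk hx
    have hk : 0 < p.1 := hk
    rw [norm_mul, norm_mul]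
    by_cases hxR : p.2 ≤ R
    · calc _ ≤ C * (p.1 ^ (m.re + 1 / 2) * Real.exp ((p.1 * R / 2) ^ 2)) * ‖gauss m 0 p.2‖ *
            ‖truncVec R f p.2‖ * ‖gauss m u p.1‖ := by
            gcongr
            exact hC _ _ hk hx hxR
        _ = C * (p.1 ^ (m.re + 1 / 2) * Real.exp ((p.1 * R / 2) ^ 2) * ‖gauss m u p.1‖) *
            (‖gauss m 0 p.2‖ * ‖truncVec R f p.2‖) := by ring
        _ ≤ C * (Real.exp ((m.re + 1) * u / 2) * ‖gauss m 0 p.1‖ ^ 2) *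
            (‖gauss m 0 p.2‖ * ‖truncVec R f p.2‖) := by
            exact mul_le_mul_of_nonneg_right (mul_le_mul_of_nonneg_left (gauss_growth m hu hk) hC0)
              (by positivity)
        _ = _ := by ring
    · rw [h1, Set.indicator_of_notMem (by simpa using hxR)]
      simp

theorem hankelTrunc_eq {m : ℂ} (f : L2) (R : ℝ) {k : ℝ} (hk : 0 < k) :
    hankelTrunc m f R k = ∫ x, kernelFun m (k * x) * truncVec R f x ∂μ := by
  have h1 : ∫ x, kernelFun m (k * x) * truncVec R f x ∂μ =
      ∫ x, (Set.Iic R).indicator (fun x => hankelKernel m k x * f x) x ∂μ := by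
    refine integral_congr_ae ?_
    filter_upwards [coeFn_truncVec R f, ae_restrict_mem measurableSet_Ioi] with x h1 hx
    rw [h1]
    by_cases hxR : x ∈ Set.Iic R
    · rw [Set.indicator_of_mem hxR, Set.indicator_of_mem hxR, hankelKernel_eq m hk hx]
    · rw [Set.indicator_of_notMem hxR, Set.indicator_of_notMem hxR, mul_zero]
  rw [h1, integral_indicator measurableSet_Iic, Measure.restrict_restrict measurableSet_Iic,
    Set.inter_comm, Set.Ioi_inter_Iic, hankelTrunc]

/-- The truncated Hankel integrals are given by the bounded operator `hankel`. -/
theorem hankelTrunc_ae_eq {m : ℂ} (hm : -1 < m.re) (f : L2) (R : ℝ) :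
    hankelTrunc m f R =ᵐ[μ] hankel hm (truncVec R f) := by
  -- The threshold beyond which `gauss_growth` applies for all x ≤ R.
  set u₀ : ℝ := Real.log (R ^ 2 + 2) with hu₀
  have hle : ∀ u, u₀ ≤ u → R ^ 2 + 2 ≤ Real.exp u := fun u hu => by
    rwa [hu₀, Real.log_le_iff_le_exp (by positivity)] at hu
  set G : ℝ → ℂ := fun k => ∫ x, kernelFun m (k * x) * truncVec R f x ∂μ with hG
  have hGint : ∀ u, u₀ ≤ u → Integrable (fun k => G k * gauss m u k) μ := by
    intro u hu
    have := (integrable_kernelFun_mul_gauss_prod hm f (hle u hu)).integral_prod_left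
    simpa only [integral_mul_const] using this
  have hFint : ∀ u, Integrable (fun k => hankel hm (truncVec R f) k * gauss m u k) μ := fun u =>
    (Lp.memLp _).integrable_mul (memLp_gauss hm u)
  have key := ae_eq_zero_of_integral_gauss (f := fun k => G k - hankel hm (truncVec R f) k) m u₀
    (by simpa only [sub_mul] using! (hGint u₀ le_rfl).sub (hFint u₀)) (by
      intro u hu
      simp only [sub_mul]
      rw [integral_sub (hGint u hu) (hFint u), sub_eq_zero]
      -- The transposition rule moves F onto the Gaussian. On the other side Fubini does the same
      -- for the kernel, and both give the integral of the truncated f against `gauss m (-u)`.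
      have h1 : ∫ k, hankel hm (truncVec R f) k * gauss m u k ∂μ =
          pair (truncVec R f) (gaussVec hm (-u)) := by
        rw [← pair_toLp _ (memLp_gauss hm u)]
        change pair _ (gaussVec hm u) = _
        rw [pair_hankel, hankel_gaussVec]
      have hsw := integral_integral_swap
        (f := fun k x => kernelFun m (k * x) * truncVec R f x * gauss m u k)
        (integrable_kernelFun_mul_gauss_prod hm f (hle u hu))
      simp only [integral_mul_const] at hsw
      rw [h1, hsw, gaussVec, pair_toLp]
      refine integral_congr_ae ?_
      filter_upwards [coeFn_truncVec R f, ae_restrict_mem measurableSet_Ioi] with x h1 hx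
      have hx : 0 < x := hx
      by_cases hxR : x ≤ R
      · rw [← integral_kernelFun_mul_gauss hm hx (u := u)
          ((by gcongr : x ^ 2 + 2 ≤ R ^ 2 + 2).trans (hle u hu)), ← integral_const_mul]
        congr 1
        ext k
        ring
      · rw [h1, Set.indicator_of_notMem (by simpa using hxR)]
        simp)
  filter_upwards [key, ae_restrict_mem measurableSet_Ioi] with k hk hk0
  rw [hankelTrunc_eq f R hk0]
  exact sub_eq_zero.1 hk

theorem isHankelTransform_hankel {m : ℂ} (hm : -1 < m.re) : IsHankelTransform m (hankel hm) where
  integrable := by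
    intro f R k hR hk
    have h1 := (integrable_kernelFun_mul_truncVec hm f R hk).congr
      (g := (Set.Iic R).indicator (fun x => hankelKernel m k x * f x)) (by
        filter_upwards [coeFn_truncVec R f, ae_restrict_mem measurableSet_Ioi] with x h1 hx
        rw [h1]
        by_cases hxR : x ∈ Set.Iic R
        · rw [Set.indicator_of_mem hxR, Set.indicator_of_mem hxR, hankelKernel_eq m hk hx]
        · rw [Set.indicator_of_notMem hxR, Set.indicator_of_notMem hxR, mul_zero])
    rw [integrable_indicator_iff measurableSet_Iic, IntegrableOn,
      Measure.restrict_restrict measurableSet_Iic, Set.inter_comm, Set.Ioi_inter_Iic] at h1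
    exact h1
  memLp := fun f R _ => (Lp.memLp _).ae_eq (hankelTrunc_ae_eq hm f R).symm
  tendsto := by
    intro f
    have h1 : ∀ R, eLpNorm (fun k => hankelTrunc m f R k - hankel hm f k) 2 μ =
        ‖hankel hm (truncVec R f) - hankel hm f‖ₑ := by
      intro R
      rw [Lp.enorm_def]
      refine eLpNorm_congr_ae ?_
      filter_upwards [hankelTrunc_ae_eq hm f R,
        Lp.coeFn_sub (hankel hm (truncVec R f)) (hankel hm f)] with k h1 h2
      rw [h2, Pi.sub_apply, h1]
    simp only [h1]
    have h2 := (((hankel hm).continuous.tendsto f).comp (tendsto_truncVec f)).sub_const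
      (hankel hm f)
    simpa using h2.enorm

/-! ### Functions of the form `x^b q(x)` -/

/-- The function `x^b q(x)`. -/
def powMul (b : ℂ) (q : ℝ → ℝ) (x : ℝ) : ℂ := (x : ℂ) ^ b * (q x : ℂ)

theorem hasDerivAt_ofReal_cpow (b : ℂ) {x : ℝ} (hx : 0 < x) :
    HasDerivAt (fun y : ℝ => (y : ℂ) ^ b) (b * (x : ℂ) ^ b / x) x := by
  have hxc : (x : ℂ) ≠ 0 := by exact_mod_cast hx.ne'
  have h := ((hasDerivAt_id (x : ℂ)).cpow_const (c := b)
    (Complex.ofReal_mem_slitPlane.2 hx)).comp_ofReal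
  refine h.congr_deriv ?_
  simp only [id]
  rw [Complex.cpow_sub _ _ hxc, Complex.cpow_one]
  ring

theorem contDiffAt_ofReal_cpow (b : ℂ) {x : ℝ} (hx : 0 < x) :
    ContDiffAt ℝ ∞ (fun y : ℝ => (y : ℂ) ^ b) x := by
  have h1 : ContDiffAt ℝ ∞ (fun y : ℝ => Complex.exp ((Real.log y : ℂ) * b)) x := by
    refine Complex.contDiff_exp.contDiffAt.comp x (ContDiffAt.mul ?_ contDiffAt_const)
    exact Complex.ofRealCLM.contDiff.contDiffAt.comp x (Real.contDiffAt_log.2 hx.ne')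
  refine h1.congr_of_eventuallyEq ?_
  filter_upwards [Ioi_mem_nhds hx] with y hy
  have hy : 0 < y := hy
  rw [Complex.cpow_def_of_ne_zero (by exact_mod_cast hy.ne'), Complex.ofReal_log hy.le]

theorem contDiffAt_powMul (b : ℂ) {q : ℝ → ℝ} (hq : ContDiff ℝ ∞ q) {x : ℝ} (hx : 0 < x) :
    ContDiffAt ℝ ∞ (powMul b q) x :=
  (contDiffAt_ofReal_cpow b hx).mul (Complex.ofRealCLM.contDiff.comp hq).contDiffAt

theorem hasDerivAt_powMul (b : ℂ) {q : ℝ → ℝ} {q' x : ℝ} (hq : HasDerivAt q q' x) (hx : 0 < x) :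
    HasDerivAt (powMul b q) ((x : ℂ) ^ b * (b / x * q x + q')) x := by
  refine ((hasDerivAt_ofReal_cpow b hx).mul hq.ofReal_comp).congr_deriv ?_
  ring

/-- The power x^{m+1/2} solves the homogeneous equation, so q itself drops out and only its
derivatives remain. -/
theorem schrodinger_powMul (m : ℂ) {q : ℝ → ℝ} (hq : ContDiff ℝ ∞ q) {x : ℝ} (hx : 0 < x) :
    schrodinger (m ^ 2) (powMul (m + 1 / 2) q) x =
      (x : ℂ) ^ (m + 1 / 2) *
        (-(2 * (m + 1 / 2)) / x * (deriv q x : ℝ) - (deriv (deriv q) x : ℝ)) := by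
  have hxc : (x : ℂ) ≠ 0 := by exact_mod_cast hx.ne'
  have hq1 : ∀ y, HasDerivAt q (deriv q y) y := fun y =>
    (hq.differentiable (by simp) y).hasDerivAt
  have hq' : ContDiff ℝ ∞ (deriv q) := hq.iterate_deriv 1
  have hq2 : HasDerivAt (deriv q) (deriv (deriv q) x) x :=
    (hq'.differentiable (by simp) x).hasDerivAt
  set b := m + 1 / 2 with hb
  have h1 : deriv (powMul b q) =ᶠ[𝓝 x]
      fun y => (y : ℂ) ^ b * (b / y * q y + deriv q y) := by
    filter_upwards [Ioi_mem_nhds hx] with y hy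
    exact (hasDerivAt_powMul b (hq1 y) hy).deriv
  have h2 : HasDerivAt (fun y : ℝ => (y : ℂ) ^ b * (b / y * q y + deriv q y))
      (b * (x : ℂ) ^ b / x * (b / x * q x + deriv q x) + (x : ℂ) ^ b *
        ((-b / x ^ 2 * q x + b / x * deriv q x) + deriv (deriv q) x)) x := by
    have h3 : HasDerivAt (fun y : ℝ => b / (y : ℂ)) (-b / (x : ℂ) ^ 2) x := by
      have := ((hasDerivAt_const (x : ℂ) b).div (hasDerivAt_id _) hxc).comp_ofReal
      refine this.congr_deriv ?_
      simp
    exact (hasDerivAt_ofReal_cpow b hx).mul ((h3.mul (hq1 x).ofReal_comp).add hq2.ofReal_comp)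
  rw [schrodinger, h1.deriv_eq, h2.deriv, powMul]
  have hm : m = b - 1 / 2 := by rw [hb]; ring
  rw [hm]
  field_simp
  ring

/-- The Gaussian `exp (-e^u x²/2)`. -/
def gaussReal (u x : ℝ) : ℝ := Real.exp (-(Real.exp u * x ^ 2 / 2))

theorem contDiff_gaussReal (u : ℝ) : ContDiff ℝ ∞ (gaussReal u) := by
  unfold gaussReal
  fun_prop

theorem hasDerivAt_gaussReal (u x : ℝ) :
    HasDerivAt (gaussReal u) (-(Real.exp u * x) * gaussReal u x) x := by
  have h : HasDerivAt (fun x : ℝ => -(Real.exp u * x ^ 2 / 2)) (-(Real.exp u * x)) x := by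
    refine ((((hasDerivAt_pow 2 x).const_mul (Real.exp u)).div_const 2).neg).congr_deriv ?_
    simp
    ring
  refine h.exp.congr_deriv ?_
  rw [gaussReal]
  ring

theorem deriv_gaussReal (u : ℝ) : deriv (gaussReal u) = fun x => -(Real.exp u * x) * gaussReal u x :=
  funext fun x => (hasDerivAt_gaussReal u x).deriv

theorem deriv_deriv_gaussReal (u x : ℝ) : deriv (deriv (gaussReal u)) x =
    (Real.exp u ^ 2 * x ^ 2 - Real.exp u) * gaussReal u x := by
  rw [deriv_gaussReal]
  have h1 : HasDerivAt (fun x : ℝ => -(Real.exp u * x)) (-Real.exp u) x := by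
    simpa using ((hasDerivAt_id x).const_mul (Real.exp u)).fun_neg
  refine ((h1.fun_mul (hasDerivAt_gaussReal u x)).deriv).trans ?_
  ring

theorem gauss_eq_powMul (m : ℂ) (u : ℝ) : gauss m u =
    fun x => Complex.exp ((m + 1) * u / 2) * powMul (m + 1 / 2) (gaussReal u) x := by
  ext x
  rw [gauss, powMul, gaussReal]
  ring

/-! ### Approximation by test functions -/

theorem tendsto_toLp_of_dominated {g : ℕ → ℝ → ℂ} {g₀ : ℝ → ℂ} {D : ℝ → ℝ}
    (hg : ∀ n, MemLp (g n) 2 μ) (hg₀ : MemLp g₀ 2 μ) (hD : MemLp D 2 μ)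
    (hbound : ∀ n, ∀ᵐ x ∂μ, ‖g n x - g₀ x‖ ≤ D x)
    (hlim : ∀ᵐ x ∂μ, Tendsto (fun n => g n x) atTop (𝓝 (g₀ x))) :
    Tendsto (fun n => (hg n).toLp (g n)) atTop (𝓝 (hg₀.toLp g₀)) := by
  rw [tendsto_iff_norm_sub_tendsto_zero]
  have hcongr : ∀ n, ‖(hg n).toLp (g n) - hg₀.toLp g₀‖ ^ 2 = ∫ x, ‖g n x - g₀ x‖ ^ 2 ∂μ := by
    intro n
    rw [← MemLp.toLp_sub, norm_sq_eq_integral]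
    refine integral_congr_ae ?_
    filter_upwards [((hg n).sub hg₀).coeFn_toLp] with x hx
    rw [hx, Pi.sub_apply]
  have hsq : Tendsto (fun n => ‖(hg n).toLp (g n) - hg₀.toLp g₀‖ ^ 2) atTop (𝓝 0) := by
    simp only [hcongr]
    have := tendsto_integral_of_dominated_convergence (μ := μ)
      (F := fun n x => ‖g n x - g₀ x‖ ^ 2) (f := fun _ => 0) (fun x => D x ^ 2)
      (fun n => (((hg n).sub hg₀).aestronglyMeasurable.norm.pow 2)) hD.integrable_sq
      (fun n => ?_) ?_
    · simpa using this
    · filter_upwards [hbound n] with x hx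
      rw [Real.norm_of_nonneg (by positivity)]
      gcongr
    · filter_upwards [hlim] with x hx
      simpa using ((hx.sub_const (g₀ x)).norm.pow 2)
  have := (Real.continuous_sqrt.tendsto 0).comp hsq
  simpa [Function.comp_def, Real.sqrt_sq (norm_nonneg _)] using this

theorem schrodinger_congr {α : ℂ} {f g : ℝ → ℂ} {x : ℝ} (h : f =ᶠ[𝓝 x] g) :
    schrodinger α f x = schrodinger α g x := by
  have h1 : deriv f =ᶠ[𝓝 x] deriv g := h.deriv
  rw [schrodinger, schrodinger, h1.deriv_eq, h.eq_of_nhds]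

/-- A smooth cutoff on the half-line in the logarithmic scale `1/r`. -/
def logCutoff (Θ : ℝ → ℝ) (r : ℝ) (w : ℝ → ℂ) (x : ℝ) : ℂ :=
  if 0 < x then (Θ (r * Real.log x) : ℂ) * w x else 0

theorem logCutoff_eventuallyEq (Θ : ℝ → ℝ) (r : ℝ) (w : ℝ → ℂ) {x : ℝ} (hx : 0 < x) :
    logCutoff Θ r w =ᶠ[𝓝 x] fun y => (Θ (r * Real.log y) : ℂ) * w y := by
  filter_upwards [Ioi_mem_nhds hx] with y hy
  exact if_pos hy

theorem isTest_logCutoff {Θ : ℝ → ℝ} (hΘ : ContDiff ℝ ∞ Θ) {B : ℝ}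
    (hB : ∀ y, B ≤ |y| → Θ y = 0) {r : ℝ} (hr : 0 < r) {w : ℝ → ℂ}
    (hw : ∀ x, 0 < x → ContDiffAt ℝ ∞ w x) : IsTest (logCutoff Θ r w) := by
  have hsupp : Function.support (logCutoff Θ r w) ⊆
      Set.Icc (Real.exp (-(B / r))) (Real.exp (B / r)) := by
    intro x hx
    have hx0 : 0 < x := by
      by_contra h
      exact hx (if_neg h)
    have h1 : Θ (r * Real.log x) ≠ 0 := fun h => hx (by simp [logCutoff, h])
    have h2 : |r * Real.log x| < B := by
      by_contra h
      exact h1 (hB _ (not_lt.1 h))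
    rw [abs_mul, abs_of_pos hr, mul_comm, ← lt_div_iff₀ hr, abs_lt] at h2
    exact ⟨((Real.lt_log_iff_exp_lt hx0).1 h2.1).le, ((Real.log_lt_iff_lt_exp hx0).1 h2.2).le⟩
  have hts : tsupport (logCutoff Θ r w) ⊆ Set.Icc (Real.exp (-(B / r))) (Real.exp (B / r)) :=
    closure_minimal hsupp isClosed_Icc
  refine ⟨contDiff_iff_contDiffAt.2 fun x => ?_,
    HasCompactSupport.of_support_subset_isCompact isCompact_Icc hsupp,
    fun x hx => (Real.exp_pos _).trans_le (hts hx).1⟩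
  by_cases hx : 0 < x
  · refine ContDiffAt.congr_of_eventuallyEq ?_ (logCutoff_eventuallyEq Θ r w hx)
    refine ContDiffAt.mul (Complex.ofRealCLM.contDiff.contDiffAt.comp x ?_) (hw x hx)
    exact hΘ.contDiffAt.comp x (contDiffAt_const.mul (Real.contDiffAt_log.2 hx.ne'))
  · have : x ∉ tsupport (logCutoff Θ r w) := fun h => hx ((Real.exp_pos _).trans_le (hts h).1)
    exact contDiffAt_const.congr_of_eventuallyEq (notMem_tsupport_iff_eventuallyEq.1 this)

/-- Each derivative of Θ(r log x) costs a factor 1/x but gains a factor r, so the commutator terms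
are controlled by w'/x and w/x², uniformly for r ≤ 1. -/
theorem schrodinger_logCutoff {α : ℂ} {Θ : ℝ → ℝ} (hΘ : ContDiff ℝ ∞ Θ) (r : ℝ) {w : ℝ → ℂ}
    (hw : ∀ x, 0 < x → ContDiffAt ℝ ∞ w x) {x : ℝ} (hx : 0 < x) :
    schrodinger α (logCutoff Θ r w) x = Θ (r * Real.log x) * schrodinger α w x -
      2 * r * (deriv Θ (r * Real.log x) : ℝ) * (deriv w x / x) -
      (r ^ 2 * (deriv (deriv Θ) (r * Real.log x) : ℝ) - r * (deriv Θ (r * Real.log x) : ℝ)) *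
        (w x / x ^ 2) := by
  have hxc : (x : ℂ) ≠ 0 := by exact_mod_cast hx.ne'
  have hl : ∀ y : ℝ, 0 < y → HasDerivAt (fun z => r * Real.log z) (r * y⁻¹) y := fun y hy =>
    (Real.hasDerivAt_log hy.ne').const_mul r
  have hΘ' : ContDiff ℝ ∞ (deriv Θ) := hΘ.iterate_deriv 1
  have hc : ∀ {χ : ℝ → ℝ}, ContDiff ℝ ∞ χ → ∀ y : ℝ, 0 < y →
      HasDerivAt (fun z => ((χ (r * Real.log z) : ℝ) : ℂ))
        ((deriv χ (r * Real.log y) : ℝ) * (r / y)) y := by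
    intro χ hχ y hy
    have h1 : HasDerivAt χ (deriv χ (r * Real.log y)) (r * Real.log y) :=
      (hχ.differentiable (by simp) _).hasDerivAt
    refine (h1.comp y (hl y hy)).ofReal_comp.congr_deriv ?_
    push_cast
    ring
  have hw1 : ∀ y, 0 < y → HasDerivAt w (deriv w y) y := fun y hy =>
    ((hw y hy).differentiableAt (by simp)).hasDerivAt
  have hw2 : HasDerivAt (deriv w) (deriv (deriv w) x) x := by
    have : ContDiffAt ℝ ∞ (deriv w) x := (hw x hx).derivWithin (by simp)
    exact (this.differentiableAt (by simp)).hasDerivAt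
  rw [schrodinger_congr (logCutoff_eventuallyEq Θ r w hx), schrodinger, schrodinger]
  have h1 : deriv (fun y => (Θ (r * Real.log y) : ℂ) * w y) =ᶠ[𝓝 x] fun y =>
      ((deriv Θ (r * Real.log y) : ℝ) : ℂ) * (r / y) * w y + Θ (r * Real.log y) * deriv w y := by
    filter_upwards [Ioi_mem_nhds hx] with y hy
    exact ((hc hΘ y hy).fun_mul (hw1 y hy)).deriv
  have h3 : HasDerivAt (fun y : ℝ => (r : ℂ) / (y : ℂ)) (-r / (x : ℂ) ^ 2) x := by
    have := ((hasDerivAt_const (x : ℂ) (r : ℂ)).div (hasDerivAt_id _) hxc).comp_ofReal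
    refine this.congr_deriv ?_
    simp
  have h2 := ((((hc hΘ' x hx).fun_mul h3).fun_mul (hw1 x hx)).fun_add
    ((hc hΘ x hx).fun_mul hw2)).deriv
  rw [h1.deriv_eq, h2]
  field_simp
  ring

/-- A criterion for belonging to the domain of the minimal operator. -/
theorem mem_closure_coreGraph {α : ℂ} {w : ℝ → ℂ} (hw : ∀ x, 0 < x → ContDiffAt ℝ ∞ w x)
    (h0 : MemLp w 2 μ) (h1 : MemLp (fun x => deriv w x / x) 2 μ)
    (h2 : MemLp (fun x => w x / (x : ℂ) ^ 2) 2 μ) (h3 : MemLp (schrodinger α w) 2 μ) :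
    (h0.toLp w, h3.toLp _) ∈ (coreGraph α).topologicalClosure := by
  let b : ContDiffBump (0 : ℝ) := ⟨1, 2, one_pos, one_lt_two⟩
  set Θ : ℝ → ℝ := fun y => b y with hΘdef
  have hΘ : ContDiff ℝ ∞ Θ := b.contDiff
  have hzero : ∀ y, 2 ≤ |y| → Θ y = 0 := fun y hy => b.zero_of_le_dist (by simpa using hy)
  have hone : ∀ y, |y| < 1 → Θ =ᶠ[𝓝 y] 1 := fun y hy =>
    b.eventuallyEq_one_of_mem_ball (by simpa using hy)
  have h01 : ∀ y, Θ y ∈ Set.Icc (0 : ℝ) 1 := fun y => ⟨b.nonneg, b.le_one⟩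
  have hcomp : HasCompactSupport Θ := b.hasCompactSupport
  obtain ⟨M₁, hM₁⟩ := hcomp.deriv.exists_bound_of_continuous (hΘ.continuous_deriv (by simp))
  obtain ⟨M₂, hM₂⟩ := hcomp.deriv.deriv.exists_bound_of_continuous
    ((hΘ.iterate_deriv 1).continuous_deriv (by simp))
  have hM₁0 : 0 ≤ M₁ := (norm_nonneg _).trans (hM₁ 0)
  have hM₂0 : 0 ≤ M₂ := (norm_nonneg _).trans (hM₂ 0)
  set r : ℕ → ℝ := fun n => 1 / ((n : ℝ) + 1) with hr
  have hrpos : ∀ n, 0 < r n := fun n => by positivity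
  have hrle : ∀ n, r n ≤ 1 := fun n => by
    rw [hr]
    exact (div_le_one (by positivity)).2 (by linarith [n.cast_nonneg (α := ℝ)])
  have htest : ∀ n, IsTest (logCutoff Θ (r n) w) := fun n =>
    isTest_logCutoff hΘ hzero (hrpos n) hw
  -- As r n tends to 0 the cutoff is eventually 1 near each fixed x, which gives pointwise
  -- convergence of the function and of its image at once.
  have hev : ∀ x : ℝ, 0 < x → ∀ᶠ n in atTop, logCutoff Θ (r n) w =ᶠ[𝓝 x] w := by
    intro x hx
    have ht : Tendsto (fun n => r n * Real.log x) atTop (𝓝 0) := by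
      have h4 := tendsto_one_div_add_atTop_nhds_zero_nat (𝕜 := ℝ).mul_const (Real.log x)
      rwa [zero_mul] at h4
    have : ∀ᶠ n in atTop, |r n * Real.log x| < 1 := by
      have := ht.abs
      rw [abs_zero] at this
      exact this.eventually_lt_const one_pos
    filter_upwards [this] with n hn
    have hcont : ContinuousAt (fun y => r n * Real.log y) x :=
      continuousAt_const.mul (Real.continuousAt_log hx.ne')
    filter_upwards [logCutoff_eventuallyEq Θ (r n) w hx, hcont.eventually (hone _ hn)] with y h4 h5
    rw [h4, h5]
    simp
  have hclos : Tendsto (fun n => ((htest n).memLp.toLp _,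
      (IsTest.schrodinger α _ (htest n)).memLp.toLp _)) atTop (𝓝 (h0.toLp w, h3.toLp _)) := by
    refine Tendsto.prodMk_nhds ?_ ?_
    · refine tendsto_toLp_of_dominated (fun n => (htest n).memLp) h0 h0.norm (fun n => ?_) ?_
      · filter_upwards [ae_restrict_mem measurableSet_Ioi] with x hx
        rw [logCutoff, if_pos (Set.mem_Ioi.1 hx)]
        have e : (Θ (r n * Real.log x) : ℂ) * w x - w x =
            ((Θ (r n * Real.log x) - 1 : ℝ) : ℂ) * w x := by push_cast; ring
        rw [e, norm_mul, Complex.norm_real, Real.norm_eq_abs]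
        refine mul_le_of_le_one_left (norm_nonneg _) (abs_le.2 ⟨?_, ?_⟩)
        · linarith [(h01 (r n * Real.log x)).1]
        · linarith [(h01 (r n * Real.log x)).2]
      · filter_upwards [ae_restrict_mem measurableSet_Ioi] with x hx
        exact tendsto_const_nhds.congr' ((hev x hx).mono fun n hn => hn.eq_of_nhds.symm)
    · have hD : MemLp (fun x => ‖schrodinger α w x‖ + 2 * M₁ * ‖deriv w x / x‖ +
          (M₂ + M₁) * ‖w x / (x : ℂ) ^ 2‖) 2 μ :=
        (h3.norm.add (h1.norm.const_mul _)).add (h2.norm.const_mul _)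
      refine tendsto_toLp_of_dominated (fun n => (IsTest.schrodinger α _ (htest n)).memLp) h3 hD
        (fun n => ?_) ?_
      · filter_upwards [ae_restrict_mem measurableSet_Ioi] with x hx
        rw [schrodinger_logCutoff hΘ (r n) hw hx]
        set y := r n * Real.log x
        have e : (Θ y : ℂ) * schrodinger α w x -
            2 * r n * (deriv Θ y : ℝ) * (deriv w x / x) -
            (r n ^ 2 * (deriv (deriv Θ) y : ℝ) - r n * (deriv Θ y : ℝ)) * (w x / x ^ 2) -
            schrodinger α w x = ((Θ y - 1 : ℝ) : ℂ) * schrodinger α w x +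
            ((-(2 * r n * deriv Θ y) : ℝ) : ℂ) * (deriv w x / x) +
            ((r n * deriv Θ y - r n ^ 2 * deriv (deriv Θ) y : ℝ) : ℂ) * (w x / x ^ 2) := by
          push_cast; ring
        rw [e]
        have hd1 : |deriv Θ y| ≤ M₁ := hM₁ y
        have hd2 : |deriv (deriv Θ) y| ≤ M₂ := hM₂ y
        have hrn := hrpos n
        have hrn1 := hrle n
        refine (norm_add₃_le).trans ?_
        rw [norm_mul, norm_mul, norm_mul, Complex.norm_real, Complex.norm_real, Complex.norm_real,
          Real.norm_eq_abs, Real.norm_eq_abs, Real.norm_eq_abs]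
        refine add_le_add_three ?_ ?_ ?_
        · refine mul_le_of_le_one_left (norm_nonneg _) (abs_le.2 ⟨?_, ?_⟩)
          · linarith [(h01 y).1]
          · linarith [(h01 y).2]
        · gcongr
          rw [abs_neg, abs_mul, abs_of_pos (by positivity : 0 < 2 * r n)]
          gcongr
          linarith
        · gcongr
          refine (abs_sub _ _).trans ?_
          rw [abs_mul, abs_mul, abs_of_pos hrn, abs_of_pos (pow_pos hrn 2), add_comm]
          refine add_le_add ?_ ?_
          · calc r n ^ 2 * |deriv (deriv Θ) y| ≤ 1 * M₂ := by
                  gcongr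
                  exact pow_le_one₀ hrn.le hrn1
              _ = M₂ := one_mul _
          · calc r n * |deriv Θ y| ≤ 1 * M₁ := by gcongr
              _ = M₁ := one_mul _
      · filter_upwards [ae_restrict_mem measurableSet_Ioi] with x hx
        exact tendsto_const_nhds.congr' ((hev x hx).mono fun n hn => (schrodinger_congr hn).symm)
  refine mem_closure_of_tendsto hclos (Eventually.of_forall fun n => ?_)
  exact ⟨logCutoff Θ (r n) w, htest n, (htest n).memLp.coeFn_toLp,
    (IsTest.schrodinger α _ (htest n)).memLp.coeFn_toLp⟩

/-! ### Differences of Gaussians and cutoffs -/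

theorem gaussReal_pos (u x : ℝ) : 0 < gaussReal u x := Real.exp_pos _

theorem gaussReal_le_one (u x : ℝ) : gaussReal u x ≤ 1 := by
  rw [gaussReal, Real.exp_le_one_iff]
  have := mul_nonneg (Real.exp_pos u).le (sq_nonneg x)
  linarith

theorem exists_abs_le_mul_gaussReal {χ : ℝ → ℝ} (hχ : Continuous χ) (hs : HasCompactSupport χ)
    (u : ℝ) : ∃ C, 0 ≤ C ∧ ∀ x, |χ x| ≤ C * gaussReal u x := by
  have hc : Continuous fun x => χ x * (gaussReal u x)⁻¹ :=
    hχ.mul ((contDiff_gaussReal u).continuous.inv₀ fun x => (gaussReal_pos u x).ne')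
  obtain ⟨C, hC⟩ := (hs.mul_right (f' := fun x => (gaussReal u x)⁻¹)).exists_bound_of_continuous hc
  refine ⟨C, (norm_nonneg _).trans (hC 0), fun x => ?_⟩
  have h := hC x
  rw [Pi.mul_apply, norm_mul, norm_inv, Real.norm_of_nonneg (gaussReal_pos u x).le,
    ← div_eq_mul_inv, div_le_iff₀ (gaussReal_pos u x)] at h
  exact h

/-- Lowering u by 1 widens the Gaussian, and the gap absorbs polynomial factors. -/
theorem exists_one_add_sq_mul_gaussReal_le (u : ℝ) :
    ∃ C, 0 ≤ C ∧ ∀ x, (1 + x ^ 2) * gaussReal u x ≤ C * gaussReal (u - 1) x := by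
  set c := (Real.exp u - Real.exp (u - 1)) / 2 with hc
  have hc0 : 0 < c := by
    have : Real.exp (u - 1) < Real.exp u := Real.exp_lt_exp.2 (by linarith)
    rw [hc]
    linarith
  refine ⟨1 + 1 / c, by positivity, fun x => ?_⟩
  have e : gaussReal u x = Real.exp (-(c * x ^ 2)) * gaussReal (u - 1) x := by
    rw [gaussReal, gaussReal, ← Real.exp_add, hc]
    congr 1
    ring
  rw [e, ← mul_assoc]
  refine mul_le_mul_of_nonneg_right ?_ (gaussReal_pos _ _).le
  rw [Real.exp_neg, ← div_eq_mul_inv, div_le_iff₀ (Real.exp_pos _)]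
  have h1 := Real.add_one_le_exp (c * x ^ 2)
  have h2 : 0 ≤ c * x ^ 2 := by positivity
  have h3 : 1 ≤ Real.exp (c * x ^ 2) := by linarith
  have h4 : x ^ 2 ≤ 1 / c * Real.exp (c * x ^ 2) := by
    rw [div_mul_eq_mul_div, one_mul, le_div_iff₀ hc0]
    linarith
  linarith

/-- A smooth function that vanishes to second order at `0` and is dominated by a Gaussian together
with its first two derivatives. -/
theorem exists_bounds_of_flat {q : ℝ → ℝ} (hq : ContDiff ℝ ∞ q) (h0 : q 0 = 0)
    (h1 : deriv q 0 = 0) {u C : ℝ} (hC : 0 ≤ C) (b0 : ∀ x, |q x| ≤ C * gaussReal u x)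
    (b1 : ∀ x, |deriv q x| ≤ C * gaussReal u x)
    (b2 : ∀ x, |deriv (deriv q) x| ≤ C * gaussReal u x) :
    ∃ K, 0 ≤ K ∧ ∀ x, 0 < x → |q x| ≤ K * (x ^ 2 * gaussReal u x) ∧
      |deriv q x| ≤ K * (x * gaussReal u x) ∧ |deriv (deriv q) x| ≤ K * gaussReal u x := by
  have hq' : ContDiff ℝ ∞ (deriv q) := hq.iterate_deriv 1
  have m1 : ∀ x, 0 ≤ x → |deriv q x| ≤ C * x := by
    intro x hx
    have := (convex_Icc 0 x).norm_image_sub_le_of_norm_deriv_le (f := deriv q) (C := C)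
      (fun y _ => hq'.differentiable (by simp) y)
      (fun y _ => (b2 y).trans (mul_le_of_le_one_right hC (gaussReal_le_one _ _)))
      (Set.left_mem_Icc.2 hx) (Set.right_mem_Icc.2 hx)
    simpa [h1, abs_of_nonneg hx] using this
  have m0 : ∀ x, 0 ≤ x → |q x| ≤ C * x ^ 2 := by
    intro x hx
    have := (convex_Icc 0 x).norm_image_sub_le_of_norm_deriv_le (f := q) (C := C * x)
      (fun y _ => hq.differentiable (by simp) y)
      (fun y hy => (m1 y hy.1).trans (mul_le_mul_of_nonneg_left hy.2 hC))
      (Set.left_mem_Icc.2 hx) (Set.right_mem_Icc.2 hx)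
    simpa [h0, abs_of_nonneg hx, pow_two, mul_assoc] using this
  -- A lower bound for the Gaussian on [0,1]: it converts the Taylor bounds near 0 into Gaussian
  -- ones. For x ≥ 1 the powers of x are at least 1 and the decay hypotheses suffice.
  set ε := gaussReal u 1 with hε
  have hε0 : 0 < ε := gaussReal_pos _ _
  have hε1 : ε ≤ 1 := gaussReal_le_one _ _
  have hK : C ≤ C / ε := by rw [le_div_iff₀ hε0]; exact mul_le_of_le_one_right hC hε1
  refine ⟨C / ε, by positivity, fun x hx => ⟨?_, ?_, ?_⟩⟩
  · rcases le_total x 1 with h | h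
    · have : ε ≤ gaussReal u x := by
        rw [hε, gaussReal, gaussReal]
        gcongr
      calc |q x| ≤ C * x ^ 2 := m0 x hx.le
        _ = C / ε * (x ^ 2 * ε) := by field_simp
        _ ≤ _ := by gcongr
    · refine (b0 x).trans (mul_le_mul hK ?_ (gaussReal_pos _ _).le (by positivity))
      exact le_mul_of_one_le_left (gaussReal_pos _ _).le (one_le_pow₀ h)
  · rcases le_total x 1 with h | h
    · have : ε ≤ gaussReal u x := by
        rw [hε, gaussReal, gaussReal]
        gcongr
      calc |deriv q x| ≤ C * x := m1 x hx.le
        _ = C / ε * (x * ε) := by field_simp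
        _ ≤ _ := by gcongr
    · refine (b1 x).trans (mul_le_mul hK ?_ (gaussReal_pos _ _).le (by positivity))
      exact le_mul_of_one_le_left (gaussReal_pos _ _).le h
  · exact (b2 x).trans (mul_le_mul_of_nonneg_right hK (gaussReal_pos _ _).le)

/-- Both functions equal 1 with zero derivative at the origin, so the difference is O(x²) there; at
infinity the Gaussian with parameter u - 1 dominates. -/
theorem IsCutoff.exists_bounds {ξ : ℝ → ℝ} (hξ : IsCutoff ξ) (u : ℝ) :
    ∃ K, 0 ≤ K ∧ ∀ x, 0 < x →
      |gaussReal u x - ξ x| ≤ K * (x ^ 2 * gaussReal (u - 1) x) ∧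
      |deriv (gaussReal u - ξ) x| ≤ K * (x * gaussReal (u - 1) x) ∧
      |deriv (deriv (gaussReal u - ξ)) x| ≤ K * gaussReal (u - 1) x := by
  have hξ' : ContDiff ℝ ∞ (deriv ξ) := hξ.contDiff.iterate_deriv 1
  have hξ'' : ContDiff ℝ ∞ (deriv (deriv ξ)) := hξ'.iterate_deriv 1
  have hg := contDiff_gaussReal u
  have hg' : ContDiff ℝ ∞ (deriv (gaussReal u)) := hg.iterate_deriv 1
  obtain ⟨A₀, hA0, hA⟩ := exists_abs_le_mul_gaussReal hξ.contDiff.continuous hξ.compact (u - 1)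
  obtain ⟨B₀, hB0, hB⟩ := exists_abs_le_mul_gaussReal hξ'.continuous hξ.compact.deriv (u - 1)
  obtain ⟨D₀, hD0, hD⟩ := exists_abs_le_mul_gaussReal hξ''.continuous hξ.compact.deriv.deriv (u - 1)
  obtain ⟨G₀, hG0, hG⟩ := exists_one_add_sq_mul_gaussReal_le u
  set e := Real.exp u with he
  have he0 : 0 < e := Real.exp_pos u
  have hd1 : deriv (gaussReal u - ξ) = deriv (gaussReal u) - deriv ξ := by
    ext x
    exact deriv_sub (hg.differentiable (by simp) x) (hξ.contDiff.differentiable (by simp) x)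
  have hd2 : deriv (deriv (gaussReal u - ξ)) = deriv (deriv (gaussReal u)) - deriv (deriv ξ) := by
    rw [hd1]
    ext x
    exact deriv_sub (hg'.differentiable (by simp) x) (hξ'.differentiable (by simp) x)
  have key : ∀ (a c : ℝ) (x : ℝ), |a| ≤ (1 + e + e ^ 2) * (1 + x ^ 2) →
      |c| ≤ (A₀ + B₀ + D₀) * gaussReal (u - 1) x →
      |a * gaussReal u x - c| ≤
        ((1 + e + e ^ 2) * G₀ + (A₀ + B₀ + D₀)) * gaussReal (u - 1) x := by
    intro a c x ha hc
    refine (abs_sub _ _).trans ?_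
    rw [add_mul]
    refine add_le_add ?_ hc
    rw [abs_mul, abs_of_pos (gaussReal_pos u x)]
    calc |a| * gaussReal u x ≤ (1 + e + e ^ 2) * (1 + x ^ 2) * gaussReal u x :=
          mul_le_mul_of_nonneg_right ha (gaussReal_pos u x).le
      _ = (1 + e + e ^ 2) * ((1 + x ^ 2) * gaussReal u x) := by ring
      _ ≤ (1 + e + e ^ 2) * (G₀ * gaussReal (u - 1) x) :=
          mul_le_mul_of_nonneg_left (hG x) (by positivity)
      _ = _ := by ring
  refine exists_bounds_of_flat (q := gaussReal u - ξ) (hg.sub hξ.contDiff) (by simp [gaussReal, hξ.eq_one.self_of_nhds])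
    ?_ (C := (1 + e + e ^ 2) * G₀ + (A₀ + B₀ + D₀)) (by positivity) ?_ ?_ ?_
  · have : deriv ξ 0 = 0 := by
      rw [EventuallyEq.deriv_eq (f := fun _ => (1 : ℝ)) hξ.eq_one]
      simp
    rw [hd1, Pi.sub_apply, this, deriv_gaussReal]
    simp
  · intro x
    have := key 1 (ξ x) x ?_ ?_
    · simpa using this
    · rw [abs_one]
      nlinarith [sq_nonneg x, mul_nonneg he0.le (sq_nonneg x), mul_nonneg (sq_nonneg e) (sq_nonneg x)]
    · refine (hA x).trans (mul_le_mul_of_nonneg_right ?_ (gaussReal_pos _ _).le)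
      linarith
  · intro x
    rw [hd1, Pi.sub_apply, deriv_gaussReal]
    refine key _ _ x ?_ ?_
    · rw [abs_neg, abs_mul, abs_of_pos he0]
      have h1 : |x| ≤ 1 + x ^ 2 := by nlinarith [sq_abs x, sq_nonneg (|x| - 1), abs_nonneg x]
      calc e * |x| ≤ e * (1 + x ^ 2) := by gcongr
        _ ≤ _ := by gcongr; nlinarith [sq_nonneg e]
    · refine (hB x).trans (mul_le_mul_of_nonneg_right ?_ (gaussReal_pos _ _).le)
      linarith
  · intro x
    rw [hd2, Pi.sub_apply, deriv_deriv_gaussReal]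
    refine key _ _ x ?_ ?_
    · rw [abs_le]
      constructor <;>
        nlinarith [sq_nonneg x, sq_nonneg e, mul_nonneg he0.le (sq_nonneg x),
          mul_nonneg (sq_nonneg e) (sq_nonneg x)]
    · refine (hD x).trans (mul_le_mul_of_nonneg_right ?_ (gaussReal_pos _ _).le)
      linarith

theorem aestronglyMeasurable_of_contDiffAt {w : ℝ → ℂ} (hw : ∀ x, 0 < x → ContDiffAt ℝ ∞ w x) :
    AEStronglyMeasurable w μ :=
  ContinuousOn.aestronglyMeasurable
    (fun x hx => (hw x hx).continuousAt.continuousWithinAt) measurableSet_Ioi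

theorem memLp_of_le_powMul_gaussReal {m : ℂ} (hm : -1 < m.re) {w : ℝ → ℂ}
    (hw : ∀ x, 0 < x → ContDiffAt ℝ ∞ w x) {u K : ℝ} (p : ℕ)
    (h : ∀ x, 0 < x → ‖w x‖ ≤ K * (x ^ p * (‖(x : ℂ) ^ (m + 1 / 2)‖ * gaussReal u x))) :
    MemLp w 2 μ := by
  set c := Complex.exp ((m + 1) * u / 2) with hc
  have hc0 : 0 < ‖c‖ := norm_pos_iff.2 (Complex.exp_ne_zero _)
  refine MemLp.of_le_mul (c := K / ‖c‖) (memLp_pow_mul_gauss hm u p)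
    (aestronglyMeasurable_of_contDiffAt hw) ?_
  filter_upwards [ae_restrict_mem measurableSet_Ioi] with x hx
  have hx : 0 < x := hx
  refine (h x hx).trans (le_of_eq ?_)
  simp only [gauss_eq_powMul, powMul]
  rw [norm_mul, norm_mul, norm_mul, norm_pow, Complex.norm_real,
    Complex.norm_real, Real.norm_of_nonneg hx.le, Real.norm_of_nonneg (gaussReal_pos u x).le, ← hc]
  field_simp

theorem contDiffAt_schrodinger (α : ℂ) {w : ℝ → ℂ} (hw : ∀ x, 0 < x → ContDiffAt ℝ ∞ w x) {x : ℝ}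
    (hx : 0 < x) : ContDiffAt ℝ ∞ (schrodinger α w) x := by
  have h1 : ContDiffAt ℝ ∞ (deriv w) x := (hw x hx).derivWithin (by simp)
  have h2 : ContDiffAt ℝ ∞ (deriv (deriv w)) x := h1.derivWithin (by simp)
  have hx' : (x : ℂ) ^ 2 ≠ 0 := by exact_mod_cast (pow_pos hx 2).ne'
  have hp : ContDiffAt ℝ ∞ (fun y : ℝ => (y : ℂ) ^ 2) x :=
    (Complex.ofRealCLM.contDiff.pow 2).contDiffAt
  exact h2.neg.add ((contDiffAt_const.mul (hp.inv hx')).mul (hw x hx))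

theorem IsCutoff.memLp {m : ℂ} (hm : -1 < m.re) {ξ : ℝ → ℝ} (hξ : IsCutoff ξ) :
    MemLp (powMul (m + 1 / 2) ξ) 2 μ := by
  obtain ⟨C, -, hC⟩ := exists_abs_le_mul_gaussReal hξ.contDiff.continuous hξ.compact 0
  refine memLp_of_le_powMul_gaussReal hm (fun x hx => contDiffAt_powMul _ hξ.contDiff hx)
    (u := 0) (K := C) 0 fun x _ => ?_
  rw [powMul, norm_mul, Complex.norm_real, Real.norm_eq_abs, pow_zero, one_mul, mul_left_comm]
  exact mul_le_mul_of_nonneg_left (hC x) (norm_nonneg _)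

/-- The difference of a Gaussian and the cutoff function belongs to the domain of `L^min`. -/
theorem IsCutoff.exists_mem_closure_coreGraph {m : ℂ} (hm : -1 < m.re) {ξ : ℝ → ℝ}
    (hξ : IsCutoff ξ) (u : ℝ) :
    ∃ h : MemLp (powMul (m + 1 / 2) (gaussReal u - ξ)) 2 μ, ∃ g : L2,
      (h.toLp _, g) ∈ (coreGraph (m ^ 2)).topologicalClosure := by
  obtain ⟨K, hK0, hK⟩ := hξ.exists_bounds u
  set q : ℝ → ℝ := gaussReal u - ξ with hq
  have hqs : ContDiff ℝ ∞ q := (contDiff_gaussReal u).sub hξ.contDiff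
  set b := m + 1 / 2 with hb
  have hw : ∀ x, 0 < x → ContDiffAt ℝ ∞ (powMul b q) x := fun x hx => contDiffAt_powMul b hqs hx
  have hw' : ∀ x, 0 < x → ContDiffAt ℝ ∞ (deriv (powMul b q)) x :=
    fun x hx => (hw x hx).derivWithin (by simp)
  have hxc : ∀ x : ℝ, 0 < x → ContDiffAt ℝ ∞ (fun y : ℝ => (y : ℂ)) x :=
    fun x _ => Complex.ofRealCLM.contDiff.contDiffAt
  have hne : ∀ x : ℝ, 0 < x → (x : ℂ) ≠ 0 := fun x hx => by exact_mod_cast hx.ne'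
  have h0 : MemLp (powMul b q) 2 μ := by
    refine memLp_of_le_powMul_gaussReal hm hw (u := u - 1) (K := K) 2 fun x hx => ?_
    rw [powMul, norm_mul, Complex.norm_real, Real.norm_eq_abs]
    refine (mul_le_mul_of_nonneg_left (hK x hx).1 (norm_nonneg _)).trans (le_of_eq ?_)
    ring
  have h1 : MemLp (fun x => deriv (powMul b q) x / x) 2 μ := by
    refine memLp_of_le_powMul_gaussReal hm
      (fun x hx => (hw' x hx).mul ((hxc x hx).inv (hne x hx)))
      (u := u - 1) (K := (‖b‖ + 1) * K) 0 fun x hx => ?_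
    obtain ⟨k0, k1, k2⟩ := hK x hx
    rw [(hasDerivAt_powMul b (hqs.differentiable (by simp) x).hasDerivAt hx).deriv, norm_div,
      norm_mul, Complex.norm_real, Real.norm_of_nonneg hx.le, div_le_iff₀ hx]
    have : ‖b / (x : ℂ) * (q x : ℝ) + (deriv q x : ℝ)‖ ≤
        ‖b‖ / x * (K * (x ^ 2 * gaussReal (u - 1) x)) + K * (x * gaussReal (u - 1) x) := by
      refine (norm_add_le _ _).trans (add_le_add ?_ ?_)
      · rw [norm_mul, norm_div, Complex.norm_real, Complex.norm_real, Real.norm_of_nonneg hx.le]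
        gcongr
        exact k0
      · rw [Complex.norm_real]
        exact k1
    refine (mul_le_mul_of_nonneg_left this (norm_nonneg _)).trans (le_of_eq ?_)
    rw [← hb]
    field_simp
  -- Second order vanishing of q exactly compensates the division by x², leaving x^{m+1/2} times a
  -- Gaussian, which is square integrable.
  have h2 : MemLp (fun x => powMul b q x / (x : ℂ) ^ 2) 2 μ := by
    refine memLp_of_le_powMul_gaussReal hm
      (fun x hx => (hw x hx).mul (((hxc x hx).pow 2).inv (pow_ne_zero 2 (hne x hx))))
      (u := u - 1) (K := K) 0 fun x hx => ?_
    rw [norm_div, norm_pow, Complex.norm_real, Real.norm_of_nonneg hx.le,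
      div_le_iff₀ (by positivity), powMul, norm_mul, Complex.norm_real, Real.norm_eq_abs]
    refine (mul_le_mul_of_nonneg_left (hK x hx).1 (norm_nonneg _)).trans (le_of_eq ?_)
    ring
  have h3 : MemLp (schrodinger (m ^ 2) (powMul b q)) 2 μ := by
    refine memLp_of_le_powMul_gaussReal hm (fun x hx => contDiffAt_schrodinger _ hw hx)
      (u := u - 1) (K := (2 * ‖b‖ + 1) * K) 0 fun x hx => ?_
    obtain ⟨k0, k1, k2⟩ := hK x hx
    rw [schrodinger_powMul m hqs hx, norm_mul]
    have : ‖-(2 * (m + 1 / 2)) / (x : ℂ) * (deriv q x : ℝ) - (deriv (deriv q) x : ℝ)‖ ≤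
        2 * ‖b‖ / x * (K * (x * gaussReal (u - 1) x)) + K * gaussReal (u - 1) x := by
      refine (norm_sub_le _ _).trans (add_le_add ?_ ?_)
      · rw [norm_mul, norm_div, norm_neg, norm_mul, Complex.norm_real, Complex.norm_real,
          Real.norm_of_nonneg hx.le, Complex.norm_two]
        gcongr
        exact k1
      · rw [Complex.norm_real]
        exact k2
    refine (mul_le_mul_of_nonneg_left this (norm_nonneg _)).trans (le_of_eq ?_)
    field_simp
  exact ⟨h0, h3.toLp _, mem_closure_coreGraph hw h0 h1 h2 h3⟩

/-- Test functions vanish near 0 and infinity, so Green's identity has no boundary terms whatever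
the behaviour of w there. -/
theorem mem_weakGraph_schrodinger {α : ℂ} {w : ℝ → ℂ} (hw : ∀ x, 0 < x → ContDiffAt ℝ ∞ w x)
    {f g : L2} (hf : f =ᵐ[μ] w) (hg : g =ᵐ[μ] schrodinger α w) :
    (f, g) ∈ weakGraph (schrodinger α) (IsTest.schrodinger α) := by
  rw [mem_weakGraph]
  intro φ hφ
  have hw' : ∀ x, 0 < x → ContDiffAt ℝ ∞ (deriv w) x := fun x hx => (hw x hx).derivWithin (by simp)
  have hw'' : ∀ x, 0 < x → ContDiffAt ℝ ∞ (deriv (deriv w)) x :=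
    fun x hx => (hw' x hx).derivWithin (by simp)
  have hint : ∀ {v φ : ℝ → ℂ}, (∀ x, 0 < x → ContDiffAt ℝ ∞ v x) → IsTest φ →
      Integrable (fun x => v x * φ x) μ := fun hv hφ =>
    ((hφ.mul_left hv).contDiff.continuous.integrable_of_hasCompactSupport
      (hφ.mul_left hv).compact).restrict
  have hV : ∀ x, 0 < x → ContDiffAt ℝ ∞ (fun x : ℝ => (-1 / 4 + α) / (x : ℂ) ^ 2 * w x) x := by
    intro x hx
    convert (contDiffAt_schrodinger α hw hx).add (hw'' x hx) using 1
    ext y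
    simp [schrodinger]
  rw [integral_congr_ae (g := fun x : ℝ => (-1 / 4 + α) / (x : ℂ) ^ 2 * w x * φ x -
      w x * deriv (deriv φ) x) (by
        filter_upwards [hf] with x hx
        rw [hx, schrodinger]
        ring),
    integral_congr_ae (f := fun x => g x * φ x)
      (g := fun x : ℝ => (-1 / 4 + α) / (x : ℂ) ^ 2 * w x * φ x - deriv (deriv w) x * φ x) (by
        filter_upwards [hg] with x hx
        rw [hx, schrodinger]
        ring),
    integral_sub (hint hV hφ) (hint hw hφ.deriv.deriv), integral_sub (hint hV hφ) (hint hw'' hφ),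
    integral_mul_deriv_of_contDiffAt hw hφ.deriv, integral_mul_deriv_of_contDiffAt hw' hφ, neg_neg]

/-! ### The action of the operators on Gaussians -/

/-- The function `x² gauss m u` as an element of `L²[0,∞[`. -/
def sqVec {m : ℂ} (hm : -1 < m.re) (u : ℝ) : L2 := (memLp_pow_mul_gauss hm u 2).toLp _

theorem coeFn_sqVec {m : ℂ} (hm : -1 < m.re) (u : ℝ) :
    sqVec hm u =ᵐ[μ] fun x => (x : ℂ) ^ 2 * gauss m u x :=
  MemLp.coeFn_toLp _

/-- The image of `gauss m u` under the Schrödinger operator. -/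
def schVec {m : ℂ} (hm : -1 < m.re) (u : ℝ) : L2 :=
  (2 * (m + 1) * Real.exp u) • gaussVec hm u - ((Real.exp u : ℂ) ^ 2) • sqVec hm u

theorem coeFn_smul_sub_smul (a b : ℂ) (f g : L2) :
    (a • f - b • g : L2) =ᵐ[μ] fun x => a * f x - b * g x := by
  filter_upwards [Lp.coeFn_sub (a • f) (b • g), Lp.coeFn_smul a f, Lp.coeFn_smul b g]
    with x h1 h2 h3
  rw [h1, Pi.sub_apply, h2, h3, Pi.smul_apply, Pi.smul_apply, smul_eq_mul, smul_eq_mul]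

theorem contDiffAt_gauss (m : ℂ) (u : ℝ) {x : ℝ} (hx : 0 < x) : ContDiffAt ℝ ∞ (gauss m u) x := by
  rw [gauss_eq_powMul]
  exact contDiffAt_const.mul (contDiffAt_powMul _ (contDiff_gaussReal u) hx)

theorem deriv_gauss (m : ℂ) (u : ℝ) {x : ℝ} (hx : 0 < x) :
    deriv (gauss m u) x = ((m + 1 / 2) / x - Real.exp u * x) * gauss m u x := by
  rw [gauss_eq_powMul]
  refine ((hasDerivAt_powMul _ (hasDerivAt_gaussReal u x) hx).const_mul _).deriv.trans ?_
  simp only [powMul]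
  push_cast
  ring

theorem schrodinger_const_mul (α c : ℂ) (w : ℝ → ℂ) (x : ℝ) :
    schrodinger α (fun y => c * w y) x = c * schrodinger α w x := by
  rw [schrodinger, schrodinger, deriv_const_mul_field', deriv_const_mul_field']
  ring

theorem schrodinger_gauss (m : ℂ) (u : ℝ) {x : ℝ} (hx : 0 < x) :
    schrodinger (m ^ 2) (gauss m u) x =
      2 * (m + 1) * Real.exp u * gauss m u x - (Real.exp u : ℂ) ^ 2 * (x ^ 2 * gauss m u x) := by
  have hxc : (x : ℂ) ≠ 0 := by exact_mod_cast hx.ne'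
  rw [gauss_eq_powMul, schrodinger_const_mul, schrodinger_powMul m (contDiff_gaussReal u) hx,
    deriv_deriv_gaussReal, deriv_gaussReal]
  simp only [powMul]
  push_cast
  field_simp
  ring

theorem coeFn_schVec {m : ℂ} (hm : -1 < m.re) (u : ℝ) :
    schVec hm u =ᵐ[μ] schrodinger (m ^ 2) (gauss m u) := by
  filter_upwards [coeFn_smul_sub_smul (2 * (m + 1) * Real.exp u) ((Real.exp u : ℂ) ^ 2)
    (gaussVec hm u) (sqVec hm u), coeFn_gaussVec hm u, coeFn_sqVec hm u,
    ae_restrict_mem measurableSet_Ioi] with x h1 h2 h3 hx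
  rw [schVec, h1, h2, h3, schrodinger_gauss m u hx]

theorem gaussVec_mem_A_graph {m : ℂ} (hm : -1 < m.re) (u : ℝ) :
    (gaussVec hm u, (-Complex.I * (m + 1)) • gaussVec hm u -
      (-Complex.I * Real.exp u) • sqVec hm u) ∈ A.graph := by
  refine mem_A_graph_of_contDiffAt (fun x hx => contDiffAt_gauss m u hx)
    (v := fun x => -Complex.I * (m + 1) * gauss m u x -
      -Complex.I * Real.exp u * (x ^ 2 * gauss m u x)) (fun x hx => ?_) (coeFn_gaussVec hm u) ?_
  · have hxc : (x : ℂ) ≠ 0 := by exact_mod_cast hx.ne'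
    rw [deriv_gauss m u hx]
    field_simp
    ring
  · filter_upwards [coeFn_smul_sub_smul (-Complex.I * (m + 1)) (-Complex.I * Real.exp u)
      (gaussVec hm u) (sqVec hm u), coeFn_gaussVec hm u, coeFn_sqVec hm u] with x h1 h2 h3
    rw [h1, h2, h3]

/-- Apply FA = -AF to a Gaussian and solve for F(x² g_u), whose coefficient contains e^u ≠ 0. This
is the eigenvalue relation between L and X² on Gaussians. -/
theorem hankel_sqVec {m : ℂ} (hm : -1 < m.re) (u : ℝ) :
    hankel hm (sqVec hm u) = schVec hm (-u) := by
  have h1 := hankel_mem_A_graph hm (gaussVec_mem_A_graph hm u)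
  rw [hankel_gaussVec] at h1
  have h2 := A.mem_graph_snd_inj h1 (gaussVec_mem_A_graph hm (-u)) rfl
  rw [map_sub, map_smul, map_smul, hankel_gaussVec] at h2
  have he : (Real.exp u : ℂ) ≠ 0 := by exact_mod_cast (Real.exp_pos u).ne'
  have hen : (Real.exp (-u) : ℂ) = (Real.exp u : ℂ)⁻¹ := by rw [Real.exp_neg]; push_cast; rfl
  rw [hen] at h2
  rw [schVec, hen]
  have h3 : (Complex.I * Real.exp u) • hankel hm (sqVec hm u) =
      (2 * Complex.I * (m + 1)) • gaussVec hm (-u) -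
        (Complex.I * (Real.exp u : ℂ)⁻¹) • sqVec hm (-u) := by
    linear_combination (norm := module) -h2
  have h4 := congrArg (fun f : L2 => (-Complex.I * (Real.exp u : ℂ)⁻¹) • f) h3
  simp only [smul_sub, smul_smul] at h4
  convert h4 using 1
  · rw [show -Complex.I * (Real.exp u : ℂ)⁻¹ * (Complex.I * Real.exp u) = 1 by
      field_simp; simp, one_smul]
  · congr 2
    · linear_combination (2 * (m + 1) * (Real.exp u : ℂ)⁻¹) * Complex.I_mul_I
    · linear_combination ((Real.exp u : ℂ)⁻¹ ^ 2) * Complex.I_mul_I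

theorem hankel_schVec {m : ℂ} (hm : -1 < m.re) (u : ℝ) :
    hankel hm (schVec hm u) = sqVec hm (-u) := by
  have h := hankel_sqVec hm (-u)
  rw [neg_neg] at h
  rw [← h, hankel_hankel]

theorem gaussVec_schVec_mem_weakGraph {m : ℂ} (hm : -1 < m.re) (u : ℝ) :
    (gaussVec hm u, schVec hm u) ∈ weakGraph (schrodinger (m ^ 2)) (IsTest.schrodinger (m ^ 2)) :=
  mem_weakGraph_schrodinger (fun _ hx => contDiffAt_gauss m u hx) (coeFn_gaussVec hm u)
    (coeFn_schVec hm u)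

theorem gaussVec_sqVec_mem_mulGraph {m : ℂ} (hm : -1 < m.re) (u : ℝ) :
    (gaussVec hm u, sqVec hm u) ∈ mulGraph fun x => (x : ℂ) ^ 2 := by
  change sqVec hm u =ᵐ[μ] fun x => (x : ℂ) ^ 2 * gaussVec hm u x
  filter_upwards [coeFn_gaussVec hm u, coeFn_sqVec hm u] with x h1 h2
  rw [h1, h2]

/-- The Hankel transformation maps the graph of `L_{m²}` on test functions into that of `X²`. -/
theorem hankel_mem_mulGraph_of_mem_coreGraph {m : ℂ} (hm : -1 < m.re) {f g : L2}
    (h : (f, g) ∈ coreGraph (m ^ 2)) :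
    (hankel hm f, hankel hm g) ∈ mulGraph fun x => (x : ℂ) ^ 2 := by
  obtain ⟨φ, hφ, hf, hg⟩ := h
  have hf : f =ᵐ[μ] φ := hf
  have hg : g =ᵐ[μ] schrodinger (m ^ 2) φ := hg
  -- Transposing F onto Gaussians turns the claim into Green's identity between L g_{-u} and the
  -- test function φ.
  have key : ∀ u, pair (hankel hm g) (gaussVec hm u) = pair (hankel hm f) (sqVec hm u) := by
    intro u
    rw [pair_hankel, pair_hankel, hankel_gaussVec, hankel_sqVec, pair_comm g, pair_comm f,
      pair_apply, pair_apply]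
    rw [integral_congr_ae (g := fun x => gaussVec hm (-u) x * schrodinger (m ^ 2) φ x) (by
        filter_upwards [hg] with x hx; rw [hx]),
      integral_congr_ae (f := fun x => schVec hm (-u) x * f x)
        (g := fun x => schVec hm (-u) x * φ x) (by filter_upwards [hf] with x hx; rw [hx])]
    exact mem_weakGraph.1 (gaussVec_schVec_mem_weakGraph hm (-u)) φ hφ
  have i1 : ∀ u, Integrable (fun x => hankel hm g x * gauss m u x) μ := fun u =>
    (Lp.memLp _).integrable_mul (memLp_gauss hm u)
  have i2 : ∀ u, Integrable (fun x => hankel hm f x * ((x : ℂ) ^ 2 * gauss m u x)) μ := fun u =>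
    (Lp.memLp _).integrable_mul (memLp_pow_mul_gauss hm u 2)
  have e : ∀ u, (fun x : ℝ => (hankel hm g x - (x : ℂ) ^ 2 * hankel hm f x) * gauss m u x) =
      fun x => hankel hm g x * gauss m u x - hankel hm f x * ((x : ℂ) ^ 2 * gauss m u x) := by
    intro u
    ext x
    ring
  have hz := ae_eq_zero_of_integral_gauss
    (f := fun x => hankel hm g x - (x : ℂ) ^ 2 * hankel hm f x) m 0
    (by rw [e]; exact (i1 0).sub (i2 0)) (fun u _ => by
      have := key u
      rw [gaussVec, sqVec, pair_toLp, pair_toLp] at this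
      rw [e, integral_sub (i1 u) (i2 u), this, sub_self])
  change hankel hm g =ᵐ[μ] fun x => (x : ℂ) ^ 2 * hankel hm f x
  filter_upwards [hz] with x hx
  exact sub_eq_zero.1 hx

/-! ### Multiplication operators -/

theorem memLp_mul_of_norm_le_one {w : ℝ → ℂ} (hw : Continuous w) (hb : ∀ x, ‖w x‖ ≤ 1) (f : L2) :
    MemLp (fun x => w x * f x) 2 μ := by
  refine (Lp.memLp f).of_le (hw.aestronglyMeasurable.mul (Lp.aestronglyMeasurable f))
    (ae_of_all _ fun x => ?_)
  rw [norm_mul]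
  exact mul_le_of_le_one_left (norm_nonneg _) (hb x)

/-- Multiplication by a continuous function that is bounded by `1`. -/
def mulBdd {w : ℝ → ℂ} (hw : Continuous w) (hb : ∀ x, ‖w x‖ ≤ 1) : L2 →L[ℂ] L2 :=
  LinearMap.mkContinuous
    { toFun := fun f => (memLp_mul_of_norm_le_one hw hb f).toLp _
      map_add' := fun f g => by
        rw [← MemLp.toLp_add]
        refine (MemLp.toLp_eq_toLp_iff _ _).2 ?_
        filter_upwards [Lp.coeFn_add f g] with x hx
        rw [hx, Pi.add_apply, Pi.add_apply, mul_add]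
      map_smul' := fun c f => by
        rw [RingHom.id_apply, ← MemLp.toLp_const_smul]
        refine (MemLp.toLp_eq_toLp_iff _ _).2 ?_
        filter_upwards [Lp.coeFn_smul c f] with x hx
        rw [hx, Pi.smul_apply, Pi.smul_apply, smul_eq_mul, smul_eq_mul, mul_left_comm] } 1
    fun f => by
      rw [one_mul]
      refine Lp.norm_le_norm_of_ae_le ?_
      filter_upwards [(memLp_mul_of_norm_le_one hw hb f).coeFn_toLp] with x hx
      simp only [LinearMap.coe_mk, AddHom.coe_mk]
      rw [hx, norm_mul]
      exact mul_le_of_le_one_left (norm_nonneg _) (hb x)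

theorem coeFn_mulBdd {w : ℝ → ℂ} (hw : Continuous w) (hb : ∀ x, ‖w x‖ ≤ 1) (f : L2) :
    mulBdd hw hb f =ᵐ[μ] fun x => w x * f x :=
  (memLp_mul_of_norm_le_one hw hb f).coeFn_toLp

theorem one_add_sq_ne_zero (x : ℝ) : (1 + (x : ℂ) ^ 2) ≠ 0 := by
  have : (1 + x ^ 2 : ℝ) ≠ 0 := by positivity
  exact_mod_cast this

theorem norm_one_add_sq (x : ℝ) : ‖1 + (x : ℂ) ^ 2‖ = 1 + x ^ 2 := by
  rw [show (1 : ℂ) + (x : ℂ) ^ 2 = ((1 + x ^ 2 : ℝ) : ℂ) by push_cast; rfl, Complex.norm_real,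
    Real.norm_of_nonneg (by positivity)]

/-- Multiplication by `1 / (1 + x²)`, the resolvent of `X²` at `-1`. -/
def resolventXsq : L2 →L[ℂ] L2 :=
  mulBdd (w := fun x : ℝ => 1 / (1 + (x : ℂ) ^ 2))
    (continuous_const.div (by fun_prop) one_add_sq_ne_zero) fun x => by
      rw [norm_div, norm_one_add_sq, norm_one, div_le_one (by positivity)]
      linarith [sq_nonneg x]

theorem coeFn_resolventXsq (f : L2) :
    resolventXsq f =ᵐ[μ] fun x : ℝ => 1 / (1 + (x : ℂ) ^ 2) * f x :=
  coeFn_mulBdd _ _ f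

/-- Written with the bounded resolvent, membership becomes a closed condition. -/
theorem mem_mulGraph_sq_iff (p : L2 × L2) :
    (p ∈ mulGraph fun x => (x : ℂ) ^ 2) ↔ p.1 = resolventXsq (p.1 + p.2) := by
  constructor
  · intro h
    have h : p.2 =ᵐ[μ] fun x => (x : ℂ) ^ 2 * p.1 x := h
    apply Lp.ext
    filter_upwards [h, coeFn_resolventXsq (p.1 + p.2), Lp.coeFn_add p.1 p.2] with x h1 h2 h3
    have := one_add_sq_ne_zero x
    rw [h2, h3, Pi.add_apply, h1]
    field_simp
  · intro h
    change p.2 =ᵐ[μ] fun x => (x : ℂ) ^ 2 * p.1 x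
    have h' : p.1 =ᵐ[μ] resolventXsq (p.1 + p.2) := by rw [← h]
    filter_upwards [h', coeFn_resolventXsq (p.1 + p.2), Lp.coeFn_add p.1 p.2] with x h1 h2 h3
    have := one_add_sq_ne_zero x
    rw [h2, h3, Pi.add_apply] at h1
    field_simp at h1
    linear_combination -h1

theorem isClosed_mulGraph_sq : IsClosed (mulGraph fun x => (x : ℂ) ^ 2 : Set (L2 × L2)) := by
  have : (mulGraph fun x => (x : ℂ) ^ 2 : Set (L2 × L2)) =
      {p | p.1 = resolventXsq (p.1 + p.2)} := Set.ext mem_mulGraph_sq_iff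
  rw [this]
  exact isClosed_eq continuous_fst (resolventXsq.continuous.comp (continuous_fst.add continuous_snd))

/-- The Gaussians span a core of `X²`. -/
theorem mulGraph_sq_le {m : ℂ} (hm : -1 < m.re) {T : Submodule ℂ (L2 × L2)}
    (hT : IsClosed (T : Set (L2 × L2))) (h : ∀ u, (gaussVec hm u, sqVec hm u) ∈ T) :
    mulGraph (fun x => (x : ℂ) ^ 2) ≤ T := by
  -- N = (R, 1 - R), with R the resolvent, parametrizes the graph of X² continuously by all of L². A
  -- set of pairs is therefore a core as soon as the sums of their components span a dense subspace;
  -- here these are (1 + x²) g_u.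
  set N : L2 →L[ℂ] L2 × L2 :=
    resolventXsq.prod (ContinuousLinearMap.id ℂ L2 - resolventXsq) with hN
  have hNp : ∀ p ∈ mulGraph (fun x => (x : ℂ) ^ 2), N (p.1 + p.2) = p := by
    intro p hp
    have := (mem_mulGraph_sq_iff p).1 hp
    refine Prod.ext this.symm ?_
    change p.1 + p.2 - resolventXsq (p.1 + p.2) = p.2
    rw [← this, add_sub_cancel_left]
  have hclosed : IsClosed ((T.comap (N : L2 →ₗ[ℂ] L2 × L2) : Submodule ℂ L2) : Set L2) :=
    hT.preimage N.continuous
  have htop : (⊤ : Submodule ℂ L2) ≤ T.comap (N : L2 →ₗ[ℂ] L2 × L2) := by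
    rw [← topologicalClosure_span_eq_top (m := m) (e := fun u => gaussVec hm u + sqVec hm u)
      (w := fun x => 1 + (x : ℂ) ^ 2) ?_ fun x _ => one_add_sq_ne_zero x]
    · refine Submodule.topologicalClosure_minimal _ (Submodule.span_le.2 ?_) hclosed
      rintro _ ⟨u, rfl⟩
      change N (gaussVec hm u + sqVec hm u) ∈ T
      rw [hNp _ (gaussVec_sqVec_mem_mulGraph hm u)]
      exact h u
    · intro u
      filter_upwards [coeFn_gaussVec hm u, coeFn_sqVec hm u,
        Lp.coeFn_add (gaussVec hm u) (sqVec hm u)] with x h1 h2 h3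
      rw [h3, Pi.add_apply, h1, h2]
      ring
  intro p hp
  have : N (p.1 + p.2) ∈ T := htop (Submodule.mem_top (x := p.1 + p.2))
  rwa [hNp p hp] at this

/-! ### The graph of `H_m` -/

theorem mem_H_graph_iff {m : ℂ} {ξ : ℝ → ℝ} {f g : L2} : (f, g) ∈ (H m ξ).graph ↔
    f ∈ domH m ξ ∧ (f, g) ∈ weakGraph (schrodinger (m ^ 2)) (IsTest.schrodinger (m ^ 2)) := by
  rw [← schrodingerMax_graph]
  constructor
  · intro h
    obtain ⟨y, hy, hyg⟩ := (LinearPMap.mem_graph_iff _).1 h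
    obtain ⟨y, hy1, hy2⟩ := y
    obtain rfl : y = f := hy
    refine ⟨hy1, (LinearPMap.mem_graph_iff _).2 ⟨⟨y, hy2⟩, rfl, ?_⟩⟩
    rw [← hyg]
    exact (LinearPMap.domRestrict_apply rfl).symm
  · rintro ⟨h1, h⟩
    obtain ⟨y, hy, hyg⟩ := (LinearPMap.mem_graph_iff _).1 h
    obtain ⟨y, hy2⟩ := y
    obtain rfl : y = f := hy
    refine (LinearPMap.mem_graph_iff _).2 ⟨⟨y, h1, hy2⟩, rfl, ?_⟩
    rw [← hyg]
    exact LinearPMap.domRestrict_apply rfl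

theorem closure_coreGraph_le_weakGraph (α : ℂ) :
    (coreGraph α).topologicalClosure ≤ weakGraph (schrodinger α) (IsTest.schrodinger α) :=
  Submodule.topologicalClosure_minimal _ (coreGraph_le α) (isClosed_weakGraph _ _)

theorem snd_unique_of_mem_weakGraph {α : ℂ} {f g h : L2}
    (hg : (f, g) ∈ weakGraph (schrodinger α) (IsTest.schrodinger α))
    (hh : (f, h) ∈ weakGraph (schrodinger α) (IsTest.schrodinger α)) : g = h := by
  rw [← schrodingerMax_graph] at hg hh
  exact LinearPMap.mem_graph_snd_inj _ hg hh rfl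

theorem add_smul_sub_mem {G : Submodule ℂ (L2 × L2)} {f₀ g₀ f₁ g₁ f₂ g₂ : L2} (c : ℂ)
    (h₀ : (f₀, g₀) ∈ G) (h₁ : (f₁, g₁) ∈ G) (h₂ : (f₂, g₂) ∈ G) :
    (f₀ + c • (f₁ - f₂), g₀ + c • (g₁ - g₂)) ∈ G :=
  G.add_mem h₀ (G.smul_mem c (G.sub_mem h₁ h₂))

/-- Each Gaussian is a multiple of the sum of an element of the domain of `L^min` and the cutoff
function. -/
theorem IsCutoff.exists_gaussVec_eq {m : ℂ} (hm : -1 < m.re) {ξ : ℝ → ℝ} (hξ : IsCutoff ξ) (u : ℝ) :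
    ∃ c : ℂ, ∃ w g : L2, (w, g) ∈ (coreGraph (m ^ 2)).topologicalClosure ∧ (u = 0 → c = 1) ∧
      gaussVec hm u = c • (w + (hξ.memLp hm).toLp _) := by
  obtain ⟨h, g, hg⟩ := hξ.exists_mem_closure_coreGraph hm u
  refine ⟨Complex.exp ((m + 1) * u / 2), _, g, hg, fun h0 => by simp [h0], Lp.ext ?_⟩
  filter_upwards [coeFn_gaussVec hm u, h.coeFn_toLp, (hξ.memLp hm).coeFn_toLp,
    Lp.coeFn_smul (Complex.exp ((m + 1) * u / 2)) (h.toLp _ + (hξ.memLp hm).toLp _),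
    Lp.coeFn_add (h.toLp _) ((hξ.memLp hm).toLp _)] with x h1 h2 h3 h4 h5
  rw [h1, h4, Pi.smul_apply, h5, Pi.add_apply, h2, h3, gauss_eq_powMul]
  simp only [powMul, Pi.sub_apply, smul_eq_mul]
  push_cast
  ring

theorem IsCutoff.mem_domH_iff {m : ℂ} (hm : -1 < m.re) {ξ : ℝ → ℝ} (hξ : IsCutoff ξ) {f : L2} :
    f ∈ domH m ξ ↔ ∃ f₀ g₀ : L2, (f₀, g₀) ∈ (coreGraph (m ^ 2)).topologicalClosure ∧
      ∃ c : ℂ, f = f₀ + c • (hξ.memLp hm).toLp _ := by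
  have hcongr : ∀ (f₀ : L2) (c : ℂ), (f =ᵐ[μ] fun x => f₀ x + c * ((x : ℂ) ^ (1 / 2 + m) * ξ x)) ↔
      f = f₀ + c • (hξ.memLp hm).toLp _ := by
    intro f₀ c
    have h : (f₀ + c • (hξ.memLp hm).toLp _ : L2) =ᵐ[μ]
        fun x => f₀ x + c * ((x : ℂ) ^ (1 / 2 + m) * ξ x) := by
      filter_upwards [(hξ.memLp hm).coeFn_toLp, Lp.coeFn_smul c ((hξ.memLp hm).toLp _),
        Lp.coeFn_add f₀ (c • (hξ.memLp hm).toLp _)] with x h1 h2 h3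
      rw [h3, Pi.add_apply, h2, Pi.smul_apply, h1, powMul, add_comm (1 / 2 : ℂ), smul_eq_mul]
    exact ⟨fun h' => Lp.ext (h'.trans h.symm), fun h' => h' ▸ h⟩
  change (∃ f₀ ∈ (schrodingerMin (m ^ 2)).domain, ∃ c : ℂ, _) ↔ _
  constructor
  · rintro ⟨f₀, h0, c, hc⟩
    obtain ⟨g₀, hg⟩ := LinearPMap.mem_domain_iff.1 h0
    rw [schrodingerMin_graph] at hg
    exact ⟨f₀, g₀, hg, c, (hcongr _ _).1 hc⟩
  · rintro ⟨f₀, g₀, hg, c, hc⟩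
    rw [← schrodingerMin_graph] at hg
    exact ⟨f₀, LinearPMap.mem_domain_iff.2 ⟨g₀, hg⟩, c, (hcongr _ _).2 hc⟩

theorem hankel_mem_mulGraph_of_mem_closure {m : ℂ} (hm : -1 < m.re) {f g : L2}
    (h : (f, g) ∈ (coreGraph (m ^ 2)).topologicalClosure) :
    (hankel hm f, hankel hm g) ∈ mulGraph fun x => (x : ℂ) ^ 2 := by
  have hc : IsClosed (((mulGraph fun x => (x : ℂ) ^ 2).comap
      ((hankel hm).prodMap (hankel hm) : L2 × L2 →ₗ[ℂ] L2 × L2) : Submodule ℂ (L2 × L2)) :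
      Set (L2 × L2)) :=
    isClosed_mulGraph_sq.preimage ((hankel hm).prodMap (hankel hm)).continuous
  exact Submodule.topologicalClosure_minimal _
    (fun p hp => hankel_mem_mulGraph_of_mem_coreGraph hm hp) hc h

/-- The Hankel transformation maps the graph of `H_m` onto that of `X²`. -/
theorem hankel_mem_mulGraph_iff {m : ℂ} (hm : -1 < m.re) {ξ : ℝ → ℝ} (hξ : IsCutoff ξ) {f g : L2} :
    ((hankel hm f, hankel hm g) ∈ mulGraph fun x => (x : ℂ) ^ 2) ↔ (f, g) ∈ (H m ξ).graph := by
  obtain ⟨c₀, w₀, g₀, hw₀, hc₀, he₀⟩ := hξ.exists_gaussVec_eq hm 0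
  obtain rfl := hc₀ rfl
  rw [one_smul] at he₀
  set η := (hξ.memLp hm).toLp _ with hη
  -- The parameter u = 0 has factor 1, so modulo Dom L^min the cutoff function may be replaced by
  -- the Gaussian g_0.
  have hη' : η = gaussVec hm 0 - w₀ := by rw [he₀, add_sub_cancel_left]
  constructor
  -- T is closed because one dimension is added to a closed subspace. This provides the closed
  -- target needed for the core argument without first proving that H_m is closed.
  · set T : Submodule ℂ (L2 × L2) := (coreGraph (m ^ 2)).topologicalClosure ⊔
      Submodule.span ℂ {(gaussVec hm 0, schVec hm 0)} with hT
    have hTc : IsClosed (T : Set (L2 × L2)) :=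
      Submodule.isClosed_sup_finiteDimensional _ _ (Submodule.isClosed_topologicalClosure _)
    have hTcore : (coreGraph (m ^ 2)).topologicalClosure ≤ T := le_sup_left
    have hT0 : (gaussVec hm 0, schVec hm 0) ∈ T :=
      (le_sup_right : _ ≤ T) (Submodule.mem_span_singleton_self _)
    have hTweak : T ≤ weakGraph (schrodinger (m ^ 2)) (IsTest.schrodinger (m ^ 2)) := by
      refine sup_le (closure_coreGraph_le_weakGraph _) ((Submodule.span_singleton_le_iff_mem _ _).2 ?_)
      exact gaussVec_schVec_mem_weakGraph hm 0
    have hTH : T ≤ (H m ξ).graph := by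
      refine sup_le ?_ ((Submodule.span_singleton_le_iff_mem _ _).2 ?_)
      · rintro ⟨p, q⟩ hp
        exact mem_H_graph_iff.2 ⟨(hξ.mem_domH_iff hm).2 ⟨p, q, hp, 0, by simp⟩,
          closure_coreGraph_le_weakGraph _ hp⟩
      · exact mem_H_graph_iff.2 ⟨(hξ.mem_domH_iff hm).2 ⟨w₀, g₀, hw₀, 1, by rw [one_smul, he₀]⟩,
          gaussVec_schVec_mem_weakGraph hm 0⟩
    -- Modulo Dom L^min, g_u is a multiple of g_0; the second component is then forced, since the
    -- maximal operator is single valued.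
    have hTu : ∀ u, (gaussVec hm u, schVec hm u) ∈ T := by
      intro u
      obtain ⟨c, w, g, hw, -, he⟩ := hξ.exists_gaussVec_eq hm u
      have h1 : c • ((w, g) + ((gaussVec hm 0, schVec hm 0) - (w₀, g₀))) ∈ T :=
        T.smul_mem c (T.add_mem (hTcore hw) (T.sub_mem hT0 (hTcore hw₀)))
      have h2 : c • ((w, g) + ((gaussVec hm 0, schVec hm 0) - (w₀, g₀))) =
          (gaussVec hm u, c • (g + (schVec hm 0 - g₀))) := by
        rw [he, ← hη, hη']
        rfl
      rw [h2] at h1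
      rwa [snd_unique_of_mem_weakGraph (gaussVec_schVec_mem_weakGraph hm u) (hTweak h1)]
    intro h
    have hc : IsClosed ((T.comap ((hankel hm).prodMap (hankel hm) : L2 × L2 →ₗ[ℂ] L2 × L2) :
        Submodule ℂ (L2 × L2)) : Set (L2 × L2)) :=
      hTc.preimage ((hankel hm).prodMap (hankel hm)).continuous
    have h1 : (hankel hm (hankel hm f), hankel hm (hankel hm g)) ∈ T := by
      refine mulGraph_sq_le hm hc (fun u => ?_) h
      change (hankel hm (gaussVec hm u), hankel hm (sqVec hm u)) ∈ T
      rw [hankel_gaussVec, hankel_sqVec]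
      exact hTu _
    rw [hankel_hankel, hankel_hankel] at h1
    exact hTH h1
  · intro h
    obtain ⟨h1, h2⟩ := mem_H_graph_iff.1 h
    obtain ⟨f₀, k₀, hf₀, c, rfl⟩ := (hξ.mem_domH_iff hm).1 h1
    rw [← hη, hη'] at h2 ⊢
    have h3 : (f₀ + c • (gaussVec hm 0 - w₀), k₀ + c • (schVec hm 0 - g₀)) ∈
        weakGraph (schrodinger (m ^ 2)) (IsTest.schrodinger (m ^ 2)) :=
      add_smul_sub_mem c (closure_coreGraph_le_weakGraph _ hf₀) (gaussVec_schVec_mem_weakGraph hm 0)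
        (closure_coreGraph_le_weakGraph _ hw₀)
    rw [snd_unique_of_mem_weakGraph h2 h3]
    simp only [map_add, map_smul, map_sub]
    have h4 : (hankel hm (gaussVec hm 0), hankel hm (schVec hm 0)) ∈
        mulGraph fun x => (x : ℂ) ^ 2 := by
      rw [hankel_gaussVec, hankel_schVec]
      exact gaussVec_sqVec_mem_mulGraph hm _
    exact add_smul_sub_mem c (hankel_mem_mulGraph_of_mem_closure hm hf₀) h4
      (hankel_mem_mulGraph_of_mem_closure hm hw₀)

/-! ### Graphs of products -/

theorem mem_compRight_graph {B : L2 →ₗ.[ℂ] L2} {F : L2 →L[ℂ] L2} {f g : L2} :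
    (f, g) ∈ (compRight B F).graph ↔ (F f, g) ∈ B.graph := by
  constructor
  · intro h
    obtain ⟨⟨y, hy⟩, rfl, hyg⟩ := (LinearPMap.mem_graph_iff _).1 h
    exact (LinearPMap.mem_graph_iff _).2 ⟨⟨F y, hy⟩, rfl, hyg⟩
  · intro h
    obtain ⟨⟨y, hy⟩, hyf, hyg⟩ := (LinearPMap.mem_graph_iff _).1 h
    obtain rfl : y = F f := hyf
    exact (LinearPMap.mem_graph_iff _).2 ⟨⟨f, hy⟩, rfl, hyg⟩

theorem mem_compLeft_graph {B : L2 →ₗ.[ℂ] L2} {F : L2 →L[ℂ] L2} {f g : L2} :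
    (f, g) ∈ (compLeft F B).graph ↔ ∃ h, (f, h) ∈ B.graph ∧ F h = g := by
  constructor
  · intro h
    obtain ⟨y, hy, hyg⟩ := (LinearPMap.mem_graph_iff _).1 h
    exact ⟨B y, (LinearPMap.mem_graph_iff _).2 ⟨y, hy, rfl⟩, hyg⟩
  · rintro ⟨h, hh, rfl⟩
    obtain ⟨y, hy, hyg⟩ := (LinearPMap.mem_graph_iff _).1 hh
    exact (LinearPMap.mem_graph_iff _).2 ⟨y, hy, congrArg F hyg⟩

theorem mem_neg_graph {B : L2 →ₗ.[ℂ] L2} {f g : L2} :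
    (f, g) ∈ (-B).graph ↔ (f, -g) ∈ B.graph := by
  constructor
  · intro h
    obtain ⟨y, hy, hyg⟩ := (LinearPMap.mem_graph_iff _).1 h
    exact (LinearPMap.mem_graph_iff _).2 ⟨y, hy, neg_eq_iff_eq_neg.1 hyg⟩
  · intro h
    obtain ⟨y, hy, hyg⟩ := (LinearPMap.mem_graph_iff _).1 h
    exact (LinearPMap.mem_graph_iff _).2 ⟨y, hy, neg_eq_iff_eq_neg.2 hyg⟩

/-- The Hankel transformation as an invertible operator. -/
def hankelEquiv {m : ℂ} (hm : -1 < m.re) : L2 ≃L[ℂ] L2 :=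
  ContinuousLinearEquiv.equivOfInverse (hankel hm) (hankel hm) (hankel_hankel hm) (hankel_hankel hm)

theorem hankel_H_hankel {m : ℂ} (hm : -1 < m.re) {ξ : ℝ → ℝ} (hξ : IsCutoff ξ) :
    compRight (compLeft (hankelEquiv hm) (H m ξ)) (hankelEquiv hm).symm = Xsq := by
  refine LinearPMap.eq_of_eq_graph (Submodule.ext ?_)
  rintro ⟨f, g⟩
  rw [mem_compRight_graph, mem_compLeft_graph, Xsq_graph]
  constructor
  · rintro ⟨h, hh, rfl⟩
    have := (hankel_mem_mulGraph_iff hm hξ).2 hh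
    change (hankel hm (hankel hm f), hankel hm h) ∈ _ at this
    rwa [hankel_hankel] at this
  · intro h
    refine ⟨hankel hm g, (hankel_mem_mulGraph_iff hm hξ).1 ?_, hankel_hankel hm g⟩
    change (hankel hm (hankel hm f), hankel hm (hankel hm g)) ∈ _
    rwa [hankel_hankel, hankel_hankel]

/-- The inclusion of graphs applied to Ff, together with F² = 1, gives the reverse inclusion and
hence equality of domains. -/
theorem hankel_A {m : ℂ} (hm : -1 < m.re) :
    compLeft (hankelEquiv hm) A = -compRight A (hankelEquiv hm) := by
  refine LinearPMap.eq_of_eq_graph (Submodule.ext ?_)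
  rintro ⟨f, g⟩
  rw [mem_neg_graph, mem_compRight_graph, mem_compLeft_graph]
  constructor
  · rintro ⟨h, hh, rfl⟩
    exact hankel_mem_A_graph hm hh
  · intro h
    have := hankel_mem_A_graph hm (f := hankel hm f) h
    rw [hankel_hankel, map_neg, neg_neg] at this
    exact ⟨hankel hm g, this, hankel_hankel hm g⟩

end HalfLine

end

theorem mainTheorem7 (m : ℂ) (hm : -1 < m.re) :
    IsSelfAdjoint HalfLine.A ∧
    (∀ f g : HalfLine.L2, (f, g) ∈ HalfLine.A.graph ↔
      HasDerivAt (fun τ : ℝ => HalfLine.U τ f) (Complex.I • g) 0) ∧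
    ∃ F : HalfLine.L2 ≃L[ℂ] HalfLine.L2,
      HalfLine.IsHankelTransform m F ∧
      (∀ f : HalfLine.L2, F (F f) = f) ∧
      (∀ ξ : ℝ → ℝ, HalfLine.IsCutoff ξ →
        HalfLine.compRight (HalfLine.compLeft F (HalfLine.H m ξ)) F.symm = HalfLine.Xsq) ∧
      HalfLine.compLeft F HalfLine.A = -HalfLine.compRight HalfLine.A F :=
  ⟨HalfLine.isSelfAdjoint_A, HalfLine.mem_A_graph_iff, HalfLine.hankelEquiv hm,
    HalfLine.isHankelTransform_hankel hm, HalfLine.hankel_hankel hm,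
    fun _ hξ => HalfLine.hankel_H_hankel hm hξ, HalfLine.hankel_A hm⟩
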